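/- Let $\mathbb{H}=\{z\in\mathbb{C}:\Im z>0\}$, and for $\alpha>0$ and $z\in\mathbb{H}$ put $$M(\alpha,z)=\sum_{(m,n)\in\mathbb{Z}^2}\frac{|mz+n|^2}{\Im(z)}\,e^{-\pi\alpha\frac{|mz+n|^2}{\Im(z)}} .$$ Let $\Gamma_b=\{e^{i\theta}:\theta\in[\frac{\pi}{3},\frac{\pi}{2}]\}\subset\mathbb{H}$. **Theorem.** The equation $M(\alpha,i)=M(\alpha,e^{i\pi/3})$ has exactly one solution $\alpha_2$ in the interval $[\frac56,1]$; numerically $\alpha_2=0.9203340927$ to ten decimal places, that is, $|\alpha_2-0.9203340927|<5\cdot 10^{-11}$. Moreover, for every $\alpha\in(0,1]$ the minimum of $M(\alpha,\cdot)$ on $\Gamma_b$ is attained, and - if $\alpha<\alpha_2$, it is attained at $i$ and at no other point of $\Gamma_b$; - if $\alpha=\alpha_2$, it is attained at both $i$ and $e^{i\pi/3}$ and at no other point of $\Gamma_b$; - if $\alpha>\alpha_2$, it is attained at $e^{i\pi/3}$ and at no other point of $\Gamma_b$. -/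

import Mathlib

open scoped UpperHalfPlane

namespace LatticePhase

/-- The normalized quadratic form `|m z + n|² / Im z`: the squared length of the vector
`(m z + n) / √(Im z)` of the unit-density lattice `√(1 / Im z) (ℤ ⊕ z ℤ)`. -/
noncomputable def quadForm (z : ℍ) (p : ℤ × ℤ) : ℝ :=
  ‖(p.1 : ℂ) * (z : ℂ) + (p.2 : ℂ)‖ ^ 2 / z.im

/-- `M(α, z) = ∑_{(m,n) ∈ ℤ²} (|m z + n|² / Im z) exp (- π α |m z + n|² / Im z)`. -/
noncomputable def M (α : ℝ) (z : ℍ) : ℝ :=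
  ∑' p : ℤ × ℤ, quadForm z p * Real.exp (-(Real.pi * α * quadForm z p))

/-- The series defining `M(α, z)` converges (all terms are nonnegative) for every `α > 0`, so the
`tsum` in the definition of `M` is the genuine sum. -/
theorem summable_M {α : ℝ} (hα : 0 < α) (z : ℍ) :
    Summable fun p : ℤ × ℤ => quadForm z p * Real.exp (-(Real.pi * α * quadForm z p)) := by
  have hc : 0 < Real.pi * α := mul_pos Real.pi_pos hα
  have hy : 0 < z.im := z.im_pos
  have h1 : Summable fun x : Fin 2 → ℤ => ‖x‖ ^ (-(4 : ℝ)) :=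
    EisensteinSeries.summable_one_div_norm_rpow (by norm_num)
  have h2 : Summable fun p : ℤ × ℤ => ‖(![p.1, p.2] : Fin 2 → ℤ)‖ ^ (-(4 : ℝ)) :=
    h1.comp_injective (finTwoArrowEquiv ℤ).symm.injective
  refine Summable.of_nonneg_of_le (fun p => ?_) (fun p => ?_)
    (h2.mul_left (6 * z.im ^ 2 / (Real.pi * α) ^ 3 * EisensteinSeries.r z ^ (-(4 : ℝ))))
  · unfold quadForm; positivity
  · have hb := EisensteinSeries.summand_bound z (k := 4) (by norm_num) ![p.1, p.2]
    simp only [Matrix.cons_val_zero, Matrix.cons_val_one] at hb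
    rw [mul_assoc (6 * z.im ^ 2 / (Real.pi * α) ^ 3)]
    refine le_trans ?_ (mul_le_mul_of_nonneg_left hb (show (0 : ℝ) ≤ 6 * z.im ^ 2 / (Real.pi * α) ^ 3 by positivity))
    unfold quadForm
    set N : ℝ := ‖(p.1 : ℂ) * (z : ℂ) + (p.2 : ℂ)‖ with hN
    have hN0 : 0 ≤ N := norm_nonneg _
    rcases hN0.eq_or_lt with h0 | h0
    · rw [← h0]; simp
    · have ht : 0 < Real.pi * α * (N ^ 2 / z.im) := by positivity
      have he := Real.pow_div_factorial_le_exp _ ht.le 3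
      have hN4 : N ^ (-(4 : ℝ)) = (N ^ 4)⁻¹ := by
        rw [Real.rpow_neg hN0]; norm_cast
      rw [Real.exp_neg, hN4, ← div_eq_mul_inv, div_le_iff₀ (Real.exp_pos _)]
      refine le_trans (le_of_eq ?_) (mul_le_mul_of_nonneg_left he (by positivity))
      simp only [Nat.factorial]
      field_simp
      norm_num

/-- The point `e^{iπ/3}` of the upper half-plane (the hexagonal lattice). -/
noncomputable def hexPoint : ℍ :=
  ⟨Complex.exp ((Real.pi / 3 : ℝ) * Complex.I), by
    rw [Complex.exp_ofReal_mul_I_im]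
    exact Real.sin_pos_of_pos_of_lt_pi (by positivity) (by linarith [Real.pi_pos])⟩

/-- The closed arc `Γ_b = {e^{iθ} : π/3 ≤ θ ≤ π/2}`. -/
def arcB : Set ℍ :=
  {z | ∃ θ ∈ Set.Icc (Real.pi / 3) (Real.pi / 2), (z : ℂ) = Complex.exp ((θ : ℂ) * Complex.I)}

/-- The set of points of the arc `Γ_b` at which the restriction of `M(α, ·)` to `Γ_b` attains its
minimum. -/
def arcMinimizers (α : ℝ) : Set ℍ :=
  {z | z ∈ arcB ∧ IsMinOn (M α) arcB z}

end LatticePhase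

/-! On the unit circle put e^u = (1 + cos θ) / sin θ. The quadratic form becomes q(u) = ((m+n)² e^u
+ (m-n)² e^{-u}) / 2, and the arc becomes 0 ≤ u ≤ (log 3)/2, with i at u = 0 and the hexagonal point
at the other end (`exists_param`). The form has determinant 1, so its theta series satisfies a
functional equation exchanging α and 1/α (`theta_functional`). Differentiating it in α gives M(α, z)
= -G₀(X, u) / (π α²) with X = π/α and G₀ = ∑ (x - 1) e^{-x}, x = X q(u) (`M_eq_G`). For α ≤ 1 one
has X ≥ π, so the new sum converges fast, and minimizing M means maximizing G₀ in u.

Interior points lose because of the shape of G₀ in u. The reflection n ↦ -n makes the odd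
u-derivatives vanish at u = 0 (`G_odd_zero`), and the rotation of order six makes the first one
vanish at the hexagonal end (`G_one_uHex`). If an interior value were at least both end values, mean
value arguments would make the third derivative nonpositive somewhere and nonnegative further right
(`lt_max_of_not_dip`). For X ≤ 3.77 this is excluded by sign information on derivatives three to six
(`G_lt_max`). For 3.77 ≤ X ≤ 6 the third derivative is positive on the arc away from u = 0, so G₀ is
largest at i (`G_lt_left_of_le`). For X ≥ 6 the four shortest vectors of the square lattice
dominate, and estimates relative to e^{-X} give the same conclusion (`G_lt_left_of_ge`).

The signs are certified by integer affine arithmetic. The lattice sum is cut to 23 vectors with an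
explicit tail bound (`abs_G_sub_core_le`), written in H = X/2 and y = e^u so that only e^{-Hy} and
e^{-H/y} have to be evaluated, and enclosed on a subdivided rectangle (`sign_of_check`).

It remains to compare the two ends. Their difference `latticeDiff`, as a function of X, is strictly
increasing on [3.1415, 3.78] (`strictMonoOn_latticeDiff`), which covers α in [5/6, 1]. It has
opposite signs at the two values of X that correspond to 0.9203340927 ± 5·10⁻¹¹. Its unique zero
gives α₂, and its sign decides which end wins. -/

namespace LatticePhase

/-! ### Affine arithmetic with fixed-point integers -/

/-- A fixed-point affine form `(c + a s + b t ± e) / 2 ^ 64` in two parameters `s, t ∈ [-1, 1]`. -/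
structure Aff where
  c : ℤ
  a : ℤ
  b : ℤ
  e : ℕ

/-- The affine form `F` encloses the real number `f` at the parameters `s, t`. -/
structure Aff.Has (F : Aff) (s t f : ℝ) : Prop where
  hs : |s| ≤ 1
  ht : |t| ≤ 1
  le : |f * 2 ^ 64 - ((F.c : ℝ) + (F.a : ℝ) * s + (F.b : ℝ) * t)| ≤ (F.e : ℝ)

namespace Aff

def add (F G : Aff) : Aff := ⟨F.c + G.c, F.a + G.a, F.b + G.b, F.e + G.e⟩

def sub (F G : Aff) : Aff := ⟨F.c - G.c, F.a - G.a, F.b - G.b, F.e + G.e⟩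

def neg (F : Aff) : Aff := ⟨-F.c, -F.a, -F.b, F.e⟩

def smul (k : ℤ) (F : Aff) : Aff := ⟨k * F.c, k * F.a, k * F.b, k.natAbs * F.e⟩

def addC (F : Aff) (k : ℤ) : Aff := ⟨F.c + k * 18446744073709551616, F.a, F.b, F.e⟩

/-- The product of the two linear parts is not tracked; its size goes into the error. The final 4 is
three rounded shifts plus the floor in the error quotient itself. -/
def mul (F G : Aff) : Aff :=
  ⟨(F.c * G.c) >>> (64 : ℕ), (F.c * G.a + F.a * G.c) >>> (64 : ℕ), (F.c * G.b + F.b * G.c) >>> (64 : ℕ),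
    ((F.a.natAbs + F.b.natAbs) * (G.a.natAbs + G.b.natAbs)
      + F.e * (G.c.natAbs + G.a.natAbs + G.b.natAbs + G.e)
      + G.e * (F.c.natAbs + F.a.natAbs + F.b.natAbs)) / 18446744073709551616 + 4⟩

variable {F G : Aff} {s t f g : ℝ}

theorem Has.add (hF : F.Has s t f) (hG : G.Has s t g) : (F.add G).Has s t (f + g) := by
  refine ⟨hF.hs, hF.ht, ?_⟩
  have h1 := abs_le.1 hF.le
  have h2 := abs_le.1 hG.le
  simp only [Aff.add]
  push_cast
  rw [abs_le]
  constructor <;> nlinarith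

theorem Has.sub (hF : F.Has s t f) (hG : G.Has s t g) : (F.sub G).Has s t (f - g) := by
  refine ⟨hF.hs, hF.ht, ?_⟩
  have h1 := abs_le.1 hF.le
  have h2 := abs_le.1 hG.le
  simp only [Aff.sub]
  push_cast
  rw [abs_le]
  constructor <;> nlinarith

theorem Has.neg (hF : F.Has s t f) : F.neg.Has s t (-f) := by
  refine ⟨hF.hs, hF.ht, ?_⟩
  have h1 := abs_le.1 hF.le
  simp only [Aff.neg]
  push_cast
  rw [abs_le]
  constructor <;> nlinarith

theorem Has.smul (k : ℤ) (hF : F.Has s t f) : (F.smul k).Has s t (k * f) := by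
  refine ⟨hF.hs, hF.ht, ?_⟩
  simp only [Aff.smul]
  push_cast
  rw [show (k * f * 2 ^ 64 - (k * F.c + k * F.a * s + k * F.b * t) : ℝ)
      = k * (f * 2 ^ 64 - (F.c + F.a * s + F.b * t)) by ring, abs_mul, Nat.cast_natAbs, Int.cast_abs]
  exact mul_le_mul_of_nonneg_left hF.le (abs_nonneg _)

theorem Has.addC (hF : F.Has s t f) (k : ℤ) : (F.addC k).Has s t (f + k) := by
  refine ⟨hF.hs, hF.ht, ?_⟩
  have := hF.le
  simp only [Aff.addC]
  push_cast
  rw [show ((f + k) * 2 ^ 64 - (F.c + k * 18446744073709551616 + F.a * s + F.b * t) : ℝ)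
      = f * 2 ^ 64 - (F.c + F.a * s + F.b * t) by ring]
  exact this

theorem abs_shiftRight_sub_le (z : ℤ) (n : ℕ) : |((z >>> n : ℤ) : ℝ) - z / 2 ^ n| ≤ 1 := by
  rw [Int.shiftRight_eq_div_pow]
  have hp : (0 : ℤ) < ((2 ^ n : ℕ) : ℤ) := by positivity
  have h1 := Int.emod_nonneg z hp.ne'
  have h2 := Int.emod_lt_of_pos z hp
  have h3 := Int.mul_ediv_add_emod z ((2 ^ n : ℕ) : ℤ)
  have h1' : (0 : ℝ) ≤ (z % ((2 ^ n : ℕ) : ℤ) : ℤ) := by exact_mod_cast h1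
  have h2' : ((z % ((2 ^ n : ℕ) : ℤ) : ℤ) : ℝ) < 2 ^ n := by
    have : ((z % ((2 ^ n : ℕ) : ℤ) : ℤ) : ℝ) < (((2 ^ n : ℕ) : ℤ) : ℝ) := by exact_mod_cast h2
    simpa using this
  have h3' : (2 : ℝ) ^ n * ((z / ((2 ^ n : ℕ) : ℤ) : ℤ) : ℝ) + ((z % ((2 ^ n : ℕ) : ℤ) : ℤ) : ℝ) = z := by
    have : ((((2 ^ n : ℕ) : ℤ) * (z / ((2 ^ n : ℕ) : ℤ)) + z % ((2 ^ n : ℕ) : ℤ) : ℤ) : ℝ) = z := by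
      exact_mod_cast h3
    push_cast at this ⊢
    exact this
  have hp' : (0 : ℝ) < 2 ^ n := by positivity
  rw [show (((z / ((2 ^ n : ℕ) : ℤ) : ℤ) : ℝ) - z / 2 ^ n)
    = -((z % ((2 ^ n : ℕ) : ℤ) : ℤ) : ℝ) / 2 ^ n by rw [← h3']; field_simp; ring]
  rw [abs_div, abs_neg, abs_of_nonneg h1', abs_of_pos hp', div_le_one hp']
  exact h2'.le

theorem div_le_cast_div_add_one (n k : ℕ) (hk : 0 < k) : (n : ℝ) / k ≤ (n / k : ℕ) + 1 := by
  rw [div_le_iff₀ (by positivity)]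
  have := Nat.div_add_mod n k
  have h2 := Nat.mod_lt n hk
  have : n ≤ (n / k + 1) * k := by nlinarith
  exact_mod_cast this

theorem abs_lin_le (a b : ℤ) (hs : |s| ≤ 1) (ht : |t| ≤ 1) :
    |(a : ℝ) * s + b * t| ≤ (a.natAbs + b.natAbs : ℕ) := by
  push_cast
  rw [Nat.cast_natAbs, Nat.cast_natAbs, Int.cast_abs, Int.cast_abs]
  refine (abs_add_le _ _).trans (add_le_add ?_ ?_) <;> rw [abs_mul]
  · exact mul_le_of_le_one_right (abs_nonneg _) hs
  · exact mul_le_of_le_one_right (abs_nonneg _) ht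

theorem Has.mul (hF : F.Has s t f) (hG : G.Has s t g) : (F.mul G).Has s t (f * g) := by
  have hs := hF.hs
  have ht := hF.ht
  refine ⟨hs, ht, ?_⟩
  set e1 := f * 2 ^ 64 - (F.c + F.a * s + F.b * t) with he1
  set e2 := g * 2 ^ 64 - (G.c + G.a * s + G.b * t) with he2
  have h1 : |e1| ≤ F.e := hF.le
  have h2 : |e2| ≤ G.e := hG.le
  have b1 := abs_lin_le F.a F.b hs ht
  have b2 := abs_lin_le G.a G.b hs ht
  set l1 := (F.a : ℝ) * s + F.b * t
  set l2 := (G.a : ℝ) * s + G.b * t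
  have r1 := abs_shiftRight_sub_le (F.c * G.c) 64
  have r2 := abs_shiftRight_sub_le (F.c * G.a + F.a * G.c) 64
  have r3 := abs_shiftRight_sub_le (F.c * G.b + F.b * G.c) 64
  have r4 := div_le_cast_div_add_one ((F.a.natAbs + F.b.natAbs) * (G.a.natAbs + G.b.natAbs)
      + F.e * (G.c.natAbs + G.a.natAbs + G.b.natAbs + G.e)
      + G.e * (F.c.natAbs + F.a.natAbs + F.b.natAbs)) 18446744073709551616 (by norm_num)
  simp only [Aff.mul]
  set A := (F.c * G.c) >>> (64 : ℕ)
  set B := (F.c * G.a + F.a * G.c) >>> (64 : ℕ)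
  set C := (F.c * G.b + F.b * G.c) >>> (64 : ℕ)
  set E := ((F.a.natAbs + F.b.natAbs) * (G.a.natAbs + G.b.natAbs)
      + F.e * (G.c.natAbs + G.a.natAbs + G.b.natAbs + G.e)
      + G.e * (F.c.natAbs + F.a.natAbs + F.b.natAbs)) / 18446744073709551616
  have key : f * g * 2 ^ 64 - (A + B * s + C * t)
      = (l1 * l2 + e1 * (G.c + l2 + e2) + e2 * (F.c + l1)) / 2 ^ 64
        - (A - ((F.c * G.c : ℤ) : ℝ) / 2 ^ 64) - (B - ((F.c * G.a + F.a * G.c : ℤ) : ℝ) / 2 ^ 64) * s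
        - (C - ((F.c * G.b + F.b * G.c : ℤ) : ℝ) / 2 ^ 64) * t := by
    have hf : f = (F.c + l1 + e1) / 2 ^ 64 := by rw [he1]; simp only [l1]; field_simp; ring
    have hg : g = (G.c + l2 + e2) / 2 ^ 64 := by rw [he2]; simp only [l2]; field_simp; ring
    rw [hf, hg]
    push_cast
    simp only [l1, l2]
    field_simp
    ring
  rw [key]
  have q1 : |l1 * l2 + e1 * (G.c + l2 + e2) + e2 * (F.c + l1)| ≤
      (((F.a.natAbs + F.b.natAbs) * (G.a.natAbs + G.b.natAbs)
      + F.e * (G.c.natAbs + G.a.natAbs + G.b.natAbs + G.e)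
      + G.e * (F.c.natAbs + F.a.natAbs + F.b.natAbs) : ℕ) : ℝ) := by
    refine (abs_add_le _ _).trans ?_
    rw [Nat.cast_add]
    refine add_le_add ((abs_add_le _ _).trans ?_) ?_
    · rw [Nat.cast_add]
      refine add_le_add ?_ ?_
      · rw [abs_mul, Nat.cast_mul]
        exact mul_le_mul b1 b2 (abs_nonneg _) (Nat.cast_nonneg _)
      · rw [abs_mul, Nat.cast_mul]
        refine mul_le_mul h1 ?_ (abs_nonneg _) (Nat.cast_nonneg _)
        refine (abs_add_le _ _).trans ?_
        rw [Nat.cast_add]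
        refine add_le_add ((abs_add_le _ _).trans ?_) h2
        rw [add_assoc, Nat.cast_add]
        refine add_le_add ?_ b2
        rw [Nat.cast_natAbs, Int.cast_abs]
    · rw [abs_mul, Nat.cast_mul]
      refine mul_le_mul h2 ?_ (abs_nonneg _) (Nat.cast_nonneg _)
      refine (abs_add_le _ _).trans ?_
      rw [add_assoc, Nat.cast_add]
      refine add_le_add ?_ b1
      rw [Nat.cast_natAbs, Int.cast_abs]
  have q2 : |(B - ((F.c * G.a + F.a * G.c : ℤ) : ℝ) / 2 ^ 64) * s| ≤ 1 := by
    rw [abs_mul]; exact mul_le_one₀ r2 (abs_nonneg _) hs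
  have q3 : |(C - ((F.c * G.b + F.b * G.c : ℤ) : ℝ) / 2 ^ 64) * t| ≤ 1 := by
    rw [abs_mul]; exact mul_le_one₀ r3 (abs_nonneg _) ht
  have q4 : |(l1 * l2 + e1 * (G.c + l2 + e2) + e2 * (F.c + l1)) / 2 ^ 64| ≤ (E : ℝ) + 1 := by
    rw [abs_div, abs_of_pos (by positivity : (0 : ℝ) < 2 ^ 64)]
    refine le_trans ?_ r4
    rw [show ((18446744073709551616 : ℕ) : ℝ) = 2 ^ 64 by norm_num]
    gcongr
  push_cast
  rw [abs_le] at *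
  constructor <;> linarith [r1.1, r1.2, q2.1, q2.2, q3.1, q3.2, q4.1, q4.2]

end Aff

/-! ### The exponential of an affine form -/

def hornerExp (x : ℤ) : ℕ → ℤ → ℤ
  | 0, acc => acc
  | i + 1, acc => hornerExp x i
      (18446744073709551616 + ((x * acc) >>> (64 : ℕ)) / ((i + 1 : ℕ) : ℤ))

/-- The error 6 reproduces itself: an incoming 6 shrinks to 3/2 because |x| ≤ 1/4, rounding x costs
2 because |h| ≤ 2, their product costs at most 1/4, and the shift and the integer division cost 1
each. The bound on h persists since |1 + x h / (i+1)| ≤ 3/2. -/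
theorem exists_hornerExp {x : ℝ} (hx : |x| ≤ 1 / 4) {x0 : ℤ} (h0 : |x * 2 ^ 64 - x0| ≤ 1) (n : ℕ)
    (acc : ℤ) (h : ℝ) (hh : |h| ≤ 2) (hacc : |(acc : ℝ) - h * 2 ^ 64| ≤ 6) :
    |(hornerExp x0 n acc : ℝ)
      - (∑ m ∈ Finset.range n, x ^ m / m.factorial + x ^ n / n.factorial * h) * 2 ^ 64| ≤ 6 := by
  induction n generalizing acc h with
  | zero => simpa [hornerExp] using hacc
  | succ i ih =>
    have hi : (1 : ℝ) ≤ i + 1 := by have : (0 : ℝ) ≤ i := Nat.cast_nonneg i; linarith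
    have hipos : (0 : ℝ) < i + 1 := by linarith
    have hxh : |x * h| ≤ 1 / 2 := by
      rw [abs_mul]
      calc |x| * |h| ≤ 1 / 4 * 2 := mul_le_mul hx hh (abs_nonneg _) (by norm_num)
        _ = 1 / 2 := by norm_num
    have hd : |x * h / (i + 1)| ≤ 1 / 2 := by
      rw [abs_div, abs_of_pos hipos]
      exact (div_le_self (abs_nonneg _) hi).trans hxh
    have key := ih (18446744073709551616 + ((x0 * acc) >>> (64 : ℕ)) / ((i + 1 : ℕ) : ℤ))
      (1 + x * h / (i + 1)) ?_ ?_
    · rw [hornerExp]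
      convert key using 3
      rw [Finset.sum_range_succ, Nat.factorial_succ]
      have := Nat.factorial_ne_zero i
      push_cast
      field_simp
      ring
    · rw [abs_le] at *
      constructor <;> linarith [hd.1, hd.2]
    · have r1 := Aff.abs_shiftRight_sub_le (x0 * acc) 64
      set z := (x0 * acc) >>> (64 : ℕ)
      have hdiv : |((z / ((i + 1 : ℕ) : ℤ) : ℤ) : ℝ) - z / (i + 1)| ≤ 1 := by
        have hp : (0 : ℤ) < ((i + 1 : ℕ) : ℤ) := by positivity
        have h1 := Int.emod_nonneg z hp.ne'
        have h2 := Int.emod_lt_of_pos z hp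
        have h3 := Int.mul_ediv_add_emod z ((i + 1 : ℕ) : ℤ)
        have h1' : (0 : ℝ) ≤ ((z % ((i + 1 : ℕ) : ℤ) : ℤ) : ℝ) := by exact_mod_cast h1
        have h2' : ((z % ((i + 1 : ℕ) : ℤ) : ℤ) : ℝ) < i + 1 := by exact_mod_cast h2
        have h3' : ((i : ℝ) + 1) * ((z / ((i + 1 : ℕ) : ℤ) : ℤ) : ℝ)
            + ((z % ((i + 1 : ℕ) : ℤ) : ℤ) : ℝ) = z := by exact_mod_cast h3
        rw [abs_le, ← h3']
        constructor
        · rw [add_div, mul_div_cancel_left₀ _ hipos.ne']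
          have : ((z % ((i + 1 : ℕ) : ℤ) : ℤ) : ℝ) / (i + 1) ≤ 1 := by
            rw [div_le_one hipos]; exact h2'.le
          linarith
        · rw [add_div, mul_div_cancel_left₀ _ hipos.ne']
          have : 0 ≤ ((z % ((i + 1 : ℕ) : ℤ) : ℤ) : ℝ) / (i + 1) := by positivity
          linarith
      have hprod : |((x0 * acc : ℤ) : ℝ) / 2 ^ 64 - x * h * 2 ^ 64| ≤ 4 := by
        have e : ((x0 * acc : ℤ) : ℝ) / 2 ^ 64 - x * h * 2 ^ 64
            = x * (acc - h * 2 ^ 64) - (x * 2 ^ 64 - x0) * h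
              - (x * 2 ^ 64 - x0) * (acc - h * 2 ^ 64) / 2 ^ 64 := by
          push_cast; field_simp; ring
        have a1 : |x * (acc - h * 2 ^ 64)| ≤ 1 / 4 * 6 := by
          rw [abs_mul]; exact mul_le_mul hx hacc (abs_nonneg _) (by norm_num)
        have a2 : |(x * 2 ^ 64 - x0) * h| ≤ 1 * 2 := by
          rw [abs_mul]; exact mul_le_mul h0 hh (abs_nonneg _) (by norm_num)
        have a3 : |(x * 2 ^ 64 - x0) * (acc - h * 2 ^ 64) / 2 ^ 64| ≤ 1 / 4 := by
          rw [abs_div, abs_mul, abs_of_pos (by positivity : (0 : ℝ) < 2 ^ 64)]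
          rw [div_le_iff₀ (by positivity)]
          calc |x * 2 ^ 64 - (x0 : ℝ)| * |(acc : ℝ) - h * 2 ^ 64| ≤ 1 * 6 :=
              mul_le_mul h0 hacc (abs_nonneg _) (by norm_num)
            _ ≤ 1 / 4 * 2 ^ 64 := by norm_num
        rw [e]
        rw [abs_le] at *
        constructor <;> linarith [a1.1, a1.2, a2.1, a2.2, a3.1, a3.2]
      have hz : |(z : ℝ) - x * h * 2 ^ 64| ≤ 5 := by
        rw [abs_le] at *
        constructor <;> linarith [r1.1, r1.2, hprod.1, hprod.2]
      have hz2 : |(z : ℝ) / (i + 1) - x * h / (i + 1) * 2 ^ 64| ≤ 5 := by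
        rw [show (z : ℝ) / (i + 1) - x * h / (i + 1) * 2 ^ 64 = (z - x * h * 2 ^ 64) / (i + 1) by ring,
          abs_div, abs_of_pos hipos]
        exact (div_le_self (abs_nonneg _) hi).trans hz
      push_cast at hdiv ⊢
      rw [abs_le] at *
      constructor <;> linarith [hz2.1, hz2.2, hdiv.1, hdiv.2]


/-- Fixed-point value of `exp (c / 2 ^ 72)` for `|c| ≤ 2 ^ 70`, with error at most `7`. -/
theorem abs_hornerExp_sub_exp_le {x : ℝ} (hx : |x| ≤ 1 / 4) {x0 : ℤ} (h0 : |x * 2 ^ 64 - x0| ≤ 1) :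
    |Real.exp x * 2 ^ 64 - (hornerExp x0 14 18446744073709551616 : ℝ)| ≤ ((7 : ℕ) : ℝ) := by
  have h1 := exists_hornerExp hx h0 14 18446744073709551616 1 (by norm_num) (by norm_num)
  have h2 := Real.exp_bound (x := x) (by linarith) (n := 15) (by norm_num)
  have h3 : |x| ^ 15 ≤ (1 / 4) ^ 15 := by gcongr
  have h4 : |x| ^ 15 * (((15 : ℕ).succ : ℝ) / ((15 : ℕ).factorial * (15 : ℕ))) * 2 ^ 64 ≤ 1 := by
    calc _ ≤ (1 / 4 : ℝ) ^ 15 * (((15 : ℕ).succ : ℝ) / ((15 : ℕ).factorial * (15 : ℕ))) * 2 ^ 64 := by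
          gcongr
      _ ≤ 1 := by norm_num [Nat.factorial]
  rw [mul_one, ← Finset.sum_range_succ (fun m => x ^ m / (m.factorial : ℝ))] at h1
  have h5 : |(Real.exp x - ∑ m ∈ Finset.range (14 + 1), x ^ m / (m.factorial : ℝ)) * 2 ^ 64| ≤ 1 := by
    rw [abs_mul, abs_of_pos (by positivity : (0 : ℝ) < 2 ^ 64)]
    refine le_trans ?_ h4
    gcongr
  have h6 := abs_sub (Real.exp x * 2 ^ 64 - (∑ m ∈ Finset.range (14 + 1), x ^ m / (m.factorial : ℝ)) * 2 ^ 64)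
    ((hornerExp x0 14 18446744073709551616 : ℝ)
      - (∑ m ∈ Finset.range (14 + 1), x ^ m / (m.factorial : ℝ)) * 2 ^ 64)
  rw [sub_mul] at h5
  rw [sub_sub_sub_cancel_right] at h6
  exact h6.trans ((add_le_add h5 h1).trans (by norm_num))

/-- A fixed-point number with an error bound. -/
structure Ball where
  c : ℤ
  e : ℕ

def Ball.Has (E : Ball) (x : ℝ) : Prop := |x * 2 ^ 64 - (E.c : ℝ)| ≤ (E.e : ℝ)

def Ball.sq (E : Ball) : Ball :=
  ⟨(E.c * E.c) >>> (64 : ℕ), E.e * (2 * E.c.natAbs + E.e) / 18446744073709551616 + 2⟩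

theorem Ball.Has.sq {E : Ball} {x : ℝ} (h : E.Has x) : E.sq.Has (x ^ 2) := by
  have r1 := Aff.abs_shiftRight_sub_le (E.c * E.c) 64
  have r2 := Aff.div_le_cast_div_add_one (E.e * (2 * E.c.natAbs + E.e)) 18446744073709551616
    (by norm_num)
  unfold Ball.Has at *
  simp only [Ball.sq]
  set z := (E.c * E.c) >>> (64 : ℕ)
  set w := E.e * (2 * E.c.natAbs + E.e) / 18446744073709551616
  have e1 : |(x * 2 ^ 64 - (E.c : ℝ)) * (2 * E.c + (x * 2 ^ 64 - E.c))| ≤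
      ((E.e * (2 * E.c.natAbs + E.e) : ℕ) : ℝ) := by
    rw [abs_mul, Nat.cast_mul]
    refine mul_le_mul h ((abs_add_le _ _).trans ?_) (abs_nonneg _) (Nat.cast_nonneg _)
    rw [Nat.cast_add]
    refine add_le_add ?_ h
    rw [abs_mul, Nat.cast_mul, Nat.cast_natAbs, Int.cast_abs]
    simp
  have e2 : |(x * 2 ^ 64 - (E.c : ℝ)) * (2 * E.c + (x * 2 ^ 64 - E.c)) / 2 ^ 64| ≤ (w : ℝ) + 1 := by
    rw [abs_div, abs_of_pos (by positivity : (0 : ℝ) < 2 ^ 64)]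
    refine le_trans ?_ r2
    rw [show ((18446744073709551616 : ℕ) : ℝ) = 2 ^ 64 by norm_num]
    gcongr
  have e3 : x ^ 2 * 2 ^ 64 - z = (x * 2 ^ 64 - (E.c : ℝ)) * (2 * E.c + (x * 2 ^ 64 - E.c)) / 2 ^ 64
      - (z - ((E.c * E.c : ℤ) : ℝ) / 2 ^ 64) := by
    push_cast; field_simp; ring
  rw [e3]
  push_cast
  rw [abs_le] at *
  constructor <;> linarith [r1.1, r1.2, e2.1, e2.2]

/-- Argument reduction: shifting by 8 turns c / 2^64 into c / 2^72, which is at most 1/4 in size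
when |c| ≤ 2^70, and eight squarings undo the division by 2^8. -/
def Ball.exp (c : ℤ) : Ball :=
  (Ball.mk (hornerExp (c >>> (8 : ℕ)) 14 18446744073709551616) 7).sq.sq.sq.sq.sq.sq.sq.sq

theorem Ball.exp_has {c : ℤ} (hc : c.natAbs ≤ 1180591620717411303424) :
    (Ball.exp c).Has (Real.exp (c / 2 ^ 64)) := by
  have h0 := Aff.abs_shiftRight_sub_le c 8
  have hx : |(c : ℝ) / 2 ^ 72| ≤ 1 / 4 := by
    rw [abs_div, abs_of_pos (by positivity : (0 : ℝ) < 2 ^ 72), div_le_iff₀ (by positivity)]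
    have : |(c : ℝ)| = (c.natAbs : ℝ) := by rw [Nat.cast_natAbs, Int.cast_abs]
    rw [this]
    have : (c.natAbs : ℝ) ≤ (1180591620717411303424 : ℕ) := by exact_mod_cast hc
    refine this.trans ?_
    norm_num
  have h1 : |(c : ℝ) / 2 ^ 72 * 2 ^ 64 - ((c >>> (8 : ℕ) : ℤ) : ℝ)| ≤ 1 := by
    rw [abs_sub_comm]
    convert h0 using 3
    field_simp
  have h2 : (Ball.mk (hornerExp (c >>> (8 : ℕ)) 14 18446744073709551616) 7).Has
      (Real.exp (c / 2 ^ 72)) := abs_hornerExp_sub_exp_le hx h1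
  have h3 := h2.sq.sq.sq.sq.sq.sq.sq.sq
  have h4 : Real.exp ((c : ℝ) / 2 ^ 64) =
      (((((((Real.exp ((c : ℝ) / 2 ^ 72) ^ 2) ^ 2) ^ 2) ^ 2) ^ 2) ^ 2) ^ 2) ^ 2 := by
    rw [← pow_mul, ← pow_mul, ← pow_mul, ← pow_mul, ← pow_mul, ← pow_mul, ← pow_mul, ← Real.exp_nat_mul]
    congr 1
    field_simp
    norm_num
  rw [h4]
  exact h3

namespace Aff

variable {F G : Aff} {s t f g : ℝ}

def crude (F : Aff) : ℕ := F.c.natAbs + F.a.natAbs + F.b.natAbs + F.e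

theorem Has.abs_le_crude (hF : F.Has s t f) : |f * 2 ^ 64| ≤ (F.crude : ℝ) := by
  have h1 := abs_lin_le F.a F.b hF.hs hF.ht
  have h2 := hF.le
  have h3 : |(F.c : ℝ)| = (F.c.natAbs : ℝ) := by rw [Nat.cast_natAbs, Int.cast_abs]
  have h4 := neg_abs_le (F.c : ℝ)
  have h5 := le_abs_self (F.c : ℝ)
  have h6 := Nat.cast_nonneg (α := ℝ) F.e
  rw [crude, abs_le]
  push_cast at h1 ⊢
  rw [abs_le] at h1 h2
  constructor <;> linarith [h1.1, h1.2, h2.1, h2.2]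

/-- The linear part `(1 + δ) + δ² / 2 ± δ² / 2` of the exponential of a centred form. -/
def expLin (F : Aff) : Aff :=
  let r := F.a.natAbs + F.b.natAbs + F.e
  let h := r * r / 36893488147419103232
  ⟨18446744073709551616 + h, F.a, F.b, F.e + h + 2⟩

/-- The fallback branch uses only e < 3 and the crude size of the form; it exists so that `Has.exp`
needs no side condition. -/
def exp (F : Aff) : Aff :=
  if F.a.natAbs + F.b.natAbs + F.e ≤ 18446744073709551616 ∧ F.c.natAbs ≤ 1180591620717411303424 then
    (expLin F).mul ⟨(Ball.exp F.c).c, 0, 0, (Ball.exp F.c).e⟩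
  else ⟨0, 0, 0, 18446744073709551616 * 3 ^ (F.crude / 18446744073709551616 + 1)⟩

theorem Has.expLin (hF : F.Has s t f)
    (hr : F.a.natAbs + F.b.natAbs + F.e ≤ 18446744073709551616) :
    F.expLin.Has s t (Real.exp (f - F.c / 2 ^ 64)) := by
  refine ⟨hF.hs, hF.ht, ?_⟩
  have hl := abs_lin_le F.a F.b hF.hs hF.ht
  have he := hF.le
  set r := F.a.natAbs + F.b.natAbs + F.e with hrdef
  set δ := f - F.c / 2 ^ 64 with hδ
  have hδr : |δ * 2 ^ 64| ≤ (r : ℝ) := by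
    have : δ * 2 ^ 64 = f * 2 ^ 64 - F.c := by rw [hδ]; ring
    rw [this, hrdef]
    push_cast at *
    rw [abs_le] at *
    constructor <;> linarith [hl.1, hl.2, he.1, he.2]
  have hrr : (r : ℝ) ≤ 2 ^ 64 := by
    have : (r : ℝ) ≤ (18446744073709551616 : ℕ) := by exact_mod_cast hr
    refine this.trans (by norm_num)
  have hδ1 : |δ| ≤ 1 := by
    rw [abs_mul, abs_of_pos (by positivity : (0 : ℝ) < 2 ^ 64)] at hδr
    have : |δ| * 2 ^ 64 ≤ 1 * 2 ^ 64 := by linarith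
    exact le_of_mul_le_mul_right this (by positivity)
  -- Together with the next line, e^δ - 1 - δ lies in [0, δ²]. Shifting the centre by half of the
  -- range halves the error.
  have hq := Real.abs_exp_sub_one_sub_id_le hδ1
  have hq0 := Real.add_one_le_exp δ
  have hsq : δ ^ 2 * 2 ^ 64 ≤ (r : ℝ) * r / 2 ^ 64 := by
    rw [le_div_iff₀ (by positivity)]
    calc δ ^ 2 * 2 ^ 64 * 2 ^ 64 = |δ * 2 ^ 64| * |δ * 2 ^ 64| := by rw [abs_mul_abs_self]; ring
      _ ≤ r * r := mul_le_mul hδr hδr (abs_nonneg _) (Nat.cast_nonneg _)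
  have hh := div_le_cast_div_add_one (r * r) 36893488147419103232 (by norm_num)
  have hh2 : ((r * r / 36893488147419103232 : ℕ) : ℝ) ≤ ((r * r : ℕ) : ℝ) / (36893488147419103232 : ℕ) :=
    Nat.cast_div_le
  simp only [Aff.expLin, ← hrdef]
  set h := r * r / 36893488147419103232
  have e1 : ((36893488147419103232 : ℕ) : ℝ) = 2 * 2 ^ 64 := by norm_num
  rw [e1] at hh hh2
  have e2 : (r : ℝ) * r / 2 ^ 64 = 2 * (((r * r : ℕ) : ℝ) / (2 * 2 ^ 64)) := by
    push_cast; ring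
  rw [e2] at hsq
  have e3 : δ * 2 ^ 64 = f * 2 ^ 64 - F.c := by rw [hδ]; ring
  push_cast
  rw [abs_le] at hq he ⊢
  have u1 : (Real.exp δ - 1 - δ) * 2 ^ 64 ≤ δ ^ 2 * 2 ^ 64 := by gcongr; exact hq.2
  have u2 : 0 ≤ (Real.exp δ - 1 - δ) * 2 ^ 64 := mul_nonneg (by linarith) (by positivity)
  constructor <;> linarith [he.1, he.2]

theorem Has.exp (hF : F.Has s t f) : F.exp.Has s t (Real.exp f) := by
  unfold Aff.exp
  split_ifs with hc
  · have h1 := hF.expLin hc.1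
    have h2 : (Aff.mk (Ball.exp F.c).c 0 0 (Ball.exp F.c).e).Has s t (Real.exp (F.c / 2 ^ 64)) := by
      refine ⟨hF.hs, hF.ht, ?_⟩
      have := Ball.exp_has hc.2
      unfold Ball.Has at this
      simpa using this
    have h3 := h1.mul h2
    rw [← Real.exp_add] at h3
    simpa using h3
  · refine ⟨hF.hs, hF.ht, ?_⟩
    have h1 := hF.abs_le_crude
    have h2 := div_le_cast_div_add_one F.crude 18446744073709551616 (by norm_num)
    have h3 : f ≤ (F.crude / 18446744073709551616 + 1 : ℕ) := by
      push_cast at h2 ⊢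
      refine le_trans ?_ h2
      rw [le_div_iff₀ (by norm_num)]
      have := le_abs_self (f * 2 ^ 64)
      have e : ((2 : ℝ) ^ 64) = 18446744073709551616 := by norm_num
      rw [e] at this h1
      linarith
    have h4 : Real.exp f ≤ 3 ^ (F.crude / 18446744073709551616 + 1) := by
      refine (Real.exp_le_exp.2 h3).trans ?_
      rw [← Real.exp_one_pow]
      exact pow_le_pow_left₀ (Real.exp_pos _).le Real.exp_one_lt_three.le _
    push_cast
    rw [abs_of_nonneg (by have := Real.exp_pos f; simp; positivity)]
    simp only [zero_mul, add_zero, sub_zero]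
    rw [mul_comm]
    norm_num
    exact h4

/-- An affine enclosure of `1 / f`, valid when `1 ≤ f`. -/
def inv (F : Aff) : Aff :=
  -- The numerator is 2^128. The pair c, b is a first-order guess w for the inverse, with no slope
  -- in s because e^u is only ever given a slope in t. Correctness rests on the residual alone: with
  -- r = f w - 1, 1/f - w = -w r / (1 + r), and the thresholds encode |r| ≤ 1/10 and 1 + r ≥ 9/10.
  let c := 340282366920938463463374607431768211456 / F.c
  let b := -((F.b * ((c * c) >>> (64 : ℕ))) >>> (64 : ℕ))
  let W : Aff := ⟨c, 0, b, 0⟩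
  let R := ((F.mul W).addC (-1)).crude
  if R ≤ 1844674407370955161 then
    ⟨c, 0, b, (c.natAbs + b.natAbs) * R / 16602069666338596453 + 1⟩
  else ⟨0, 0, 0, 18446744073709551616⟩

theorem Has.inv (hF : F.Has s t f) (hf : 1 ≤ f) : F.inv.Has s t (1 / f) := by
  have hs := hF.hs
  have ht := hF.ht
  have hf0 : 0 < f := by linarith
  unfold Aff.inv
  set c := 340282366920938463463374607431768211456 / F.c
  set b := -((F.b * ((c * c) >>> (64 : ℕ))) >>> (64 : ℕ))
  simp only
  split_ifs with hR
  · refine ⟨hs, ht, ?_⟩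
    set w : ℝ := (c + b * t) / 2 ^ 64 with hw
    have hW : (Aff.mk c 0 b 0).Has s t w := by
      refine ⟨hs, ht, ?_⟩
      simp [hw]
    have h1 := ((hF.mul hW).addC (-1)).abs_le_crude
    set R := ((F.mul ⟨c, 0, b, 0⟩).addC (-1)).crude
    have hR' : (R : ℝ) ≤ 1844674407370955161 := by exact_mod_cast hR
    have h2 := div_le_cast_div_add_one ((c.natAbs + b.natAbs) * R) 16602069666338596453 (by norm_num)
    set E := (c.natAbs + b.natAbs) * R / 16602069666338596453
    have hwb : |w * 2 ^ 64| ≤ ((c.natAbs + b.natAbs : ℕ) : ℝ) := by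
      have := abs_lin_le (s := 1) (t := t) c b (by simp) ht
      simpa [hw] using this
    set r : ℝ := f * w + ((-1 : ℤ) : ℝ) with hr
    have hr1 : |r| ≤ R / 2 ^ 64 := by
      rw [le_div_iff₀ (by positivity)]
      rwa [abs_mul, abs_of_pos (by positivity : (0 : ℝ) < 2 ^ 64)] at h1
    have hfw : f * w = 1 + r := by rw [hr]; push_cast; ring
    have hr2 : |r| ≤ 1 / 10 := by
      refine hr1.trans ?_
      rw [div_le_iff₀ (by positivity)]
      refine hR'.trans (by norm_num)
    have h1r : 9 / 10 ≤ 1 + r := by have := (abs_le.1 hr2).1; linarith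
    have key : 1 / f - w = -(w * r) / (1 + r) := by
      have : (1 + r) ≠ 0 := by linarith
      have hw' : w = (1 + r) / f := by rw [← hfw]; field_simp
      rw [eq_div_iff this, hw']
      field_simp
      ring
    have hfin : |(1 / f) * 2 ^ 64 - w * 2 ^ 64| ≤ (E : ℝ) + 1 := by
      rw [← sub_mul, key, abs_mul, abs_div, abs_neg, abs_mul, abs_of_pos (by positivity : (0 : ℝ) < 2 ^ 64),
        abs_of_pos (by linarith : 0 < 1 + r)]
      have h3 : |w| * 2 ^ 64 ≤ ((c.natAbs + b.natAbs : ℕ) : ℝ) := by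
        rwa [abs_mul, abs_of_pos (by positivity : (0 : ℝ) < 2 ^ 64)] at hwb
      calc |w| * |r| / (1 + r) * 2 ^ 64 = (|w| * 2 ^ 64) * |r| / (1 + r) := by ring
        _ ≤ ((c.natAbs + b.natAbs : ℕ) : ℝ) * (R / 2 ^ 64) / (9 / 10) :=
            div_le_div₀ (by positivity) (mul_le_mul h3 hr1 (abs_nonneg _) (Nat.cast_nonneg _))
              (by norm_num) h1r
        _ ≤ ((c.natAbs + b.natAbs) * R : ℕ) / (16602069666338596453 : ℕ) := by
            rw [Nat.cast_mul, div_le_div_iff₀ (by norm_num) (by norm_num)]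
            have : (0 : ℝ) ≤ ((c.natAbs + b.natAbs : ℕ) : ℝ) * R := by positivity
            calc ((c.natAbs + b.natAbs : ℕ) : ℝ) * (R / 2 ^ 64) * ((16602069666338596453 : ℕ) : ℝ)
                = ((c.natAbs + b.natAbs : ℕ) : ℝ) * R * (16602069666338596453 / 2 ^ 64) := by
                  push_cast; ring
              _ ≤ ((c.natAbs + b.natAbs : ℕ) : ℝ) * R * (9 / 10) := by
                  refine mul_le_mul_of_nonneg_left ?_ this
                  norm_num
        _ ≤ E + 1 := h2
    have : w * 2 ^ 64 = c + b * t := by rw [hw]; field_simp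
    rw [this] at hfin
    simp only [Int.cast_zero, zero_mul, add_zero, Nat.cast_add, Nat.cast_one]
    exact hfin
  · refine ⟨hs, ht, ?_⟩
    have : 1 / f ≤ 1 := by rw [div_le_one hf0]; exact hf
    have h0 : 0 ≤ 1 / f := by positivity
    simp only [Int.cast_zero, zero_mul, add_zero, sub_zero]
    rw [abs_of_nonneg (by positivity)]
    push_cast
    have e : ((2 : ℝ) ^ 64) = 18446744073709551616 := by norm_num
    rw [e]
    linarith

end Aff

/-! ### Lattice sums along the arc -/

/-- `X q(u)`, with `q(u) = ((m + n)² e^u + (m - n)² e^{-u}) / 2`. -/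
noncomputable def xx (X u : ℝ) (p : ℤ × ℤ) : ℝ :=
  X / 2 * (((p.1 : ℝ) + p.2) ^ 2 * Real.exp u + ((p.1 : ℝ) - p.2) ^ 2 * Real.exp (-u))

/-- The derivative of `xx` in `u`. -/
noncomputable def dd (X u : ℝ) (p : ℤ × ℤ) : ℝ :=
  X / 2 * (((p.1 : ℝ) + p.2) ^ 2 * Real.exp u - ((p.1 : ℝ) - p.2) ^ 2 * Real.exp (-u))

/-- The polynomials with `(d/du)^j ((x - 1) e^{-x}) = pol j x x' e^{-x}` when `x'' = x`. -/
def pol : ℕ → ℝ → ℝ → ℝ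
  | 0, x, _ => x - 1
  | 1, x, d => d * (2 - x)
  | 2, x, d => 2 * x - x ^ 2 + d ^ 2 * (x - 3)
  | 3, x, d => d * (2 - 10 * x + 3 * x ^ 2 + d ^ 2 * (4 - x))
  | 4, x, d => 2 * x - 10 * x ^ 2 + 3 * x ^ 3 + d ^ 2 * (-12 + 28 * x - 6 * x ^ 2 + d ^ 2 * (x - 5))
  | 5, x, d => d * (2 - 46 * x + 75 * x ^ 2 - 15 * x ^ 3
      + d ^ 2 * (40 - 60 * x + 10 * x ^ 2 + d ^ 2 * (6 - x)))
  | 6, x, d => 2 * x - 46 * x ^ 2 + 75 * x ^ 3 - 15 * x ^ 4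
      + d ^ 2 * (-48 + 316 * x - 300 * x ^ 2 + 45 * x ^ 3
        + d ^ 2 * (-100 + 110 * x - 15 * x ^ 2 + d ^ 2 * (x - 7)))
  | _, _, _ => 0

/-- The `j`-th derivative in `u` of `∑ (x - 1) e^{-x}`, `x = xx X u p`. -/
noncomputable def G (j : ℕ) (X u : ℝ) : ℝ :=
  ∑' p : ℤ × ℤ, pol j (xx X u p) (dd X u p) * Real.exp (-xx X u p)

theorem hasDerivAt_xx (X u : ℝ) (p : ℤ × ℤ) : HasDerivAt (fun u => xx X u p) (dd X u p) u := by
  unfold xx dd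
  have h1 := (Real.hasDerivAt_exp u).const_mul (((p.1 : ℝ) + p.2) ^ 2)
  have h2 := ((hasDerivAt_neg u).exp).const_mul (((p.1 : ℝ) - p.2) ^ 2)
  exact ((h1.add h2).const_mul (X / 2)).congr_deriv (by ring)

theorem hasDerivAt_dd (X u : ℝ) (p : ℤ × ℤ) : HasDerivAt (fun u => dd X u p) (xx X u p) u := by
  unfold xx dd
  have h1 := (Real.hasDerivAt_exp u).const_mul (((p.1 : ℝ) + p.2) ^ 2)
  have h2 := ((hasDerivAt_neg u).exp).const_mul (((p.1 : ℝ) - p.2) ^ 2)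
  exact ((h1.sub h2).const_mul (X / 2)).congr_deriv (by ring)

theorem hasDerivAt_pol {x d : ℝ → ℝ} {u : ℝ} (hx : HasDerivAt x (d u) u) (hd : HasDerivAt d (x u) u)
    {j : ℕ} (hj : j < 6) :
    HasDerivAt (fun v => pol j (x v) (d v) * Real.exp (-x v))
      (pol (j + 1) (x u) (d u) * Real.exp (-x u)) u := by
  have he := hx.neg.exp
  interval_cases j
  · exact ((hx.sub_const 1).mul he).congr_deriv (by simp [pol]; ring)
  · exact ((hd.mul (hx.const_sub 2)).mul he).congr_deriv (by simp [pol]; ring)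
  · exact ((((hx.const_mul 2).sub (hx.pow 2)).add ((hd.pow 2).mul (hx.sub_const 3))).mul
      he).congr_deriv (by simp [pol]; ring)
  · exact ((hd.mul ((((hx.const_mul 10).const_sub 2).add ((hx.pow 2).const_mul 3)).add
      ((hd.pow 2).mul (hx.const_sub 4)))).mul he).congr_deriv (by simp [pol]; ring)
  · exact (((((hx.const_mul 2).sub ((hx.pow 2).const_mul 10)).add ((hx.pow 3).const_mul 3)).add
      ((hd.pow 2).mul ((((hx.const_mul 28).const_add (-12)).sub ((hx.pow 2).const_mul 6)).add
        ((hd.pow 2).mul (hx.sub_const 5))))).mul he).congr_deriv (by simp [pol]; ring)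
  · exact ((hd.mul (((((hx.const_mul 46).const_sub 2).add ((hx.pow 2).const_mul 75)).sub
      ((hx.pow 3).const_mul 15)).add ((hd.pow 2).mul ((((hx.const_mul 60).const_sub 40).add
        ((hx.pow 2).const_mul 10)).add ((hd.pow 2).mul (hx.const_sub 6)))))).mul
          he).congr_deriv (by simp [pol]; ring)

/-! ### Summability -/

theorem summable_exp_neg_sq {c : ℝ} (hc : 0 < c) :
    Summable fun p : ℤ × ℤ => Real.exp (-(c * ((p.1 : ℝ) ^ 2 + (p.2 : ℝ) ^ 2))) := by
  have h0 : Summable fun n : ℕ => Real.exp (-(c * (n : ℝ) ^ 2)) := by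
    have h := (Real.summable_exp_nat_mul_iff (a := -c)).2 (by linarith)
    refine Summable.of_nonneg_of_le (fun n => (Real.exp_pos _).le) (fun n => ?_) h
    rw [Real.exp_le_exp]
    rcases Nat.eq_zero_or_pos n with rfl | hn
    · simp
    · have : (1 : ℝ) ≤ n := by exact_mod_cast hn
      nlinarith [mul_nonneg hc.le (mul_nonneg (by linarith : (0 : ℝ) ≤ n) (by linarith : (0 : ℝ) ≤ n - 1))]
  have h1 : Summable fun n : ℤ => Real.exp (-(c * (n : ℝ) ^ 2)) := by
    rw [summable_int_iff_summable_nat_and_neg]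
    refine ⟨by simpa using h0, by simpa using h0⟩
  refine (h1.mul_of_nonneg h1 (fun _ => (Real.exp_pos _).le) (fun _ => (Real.exp_pos _).le)).congr
    fun p => ?_
  rw [← Real.exp_add]
  congr 1
  ring

/-- `xx` is a sum of two nonnegative terms and `dd` is their difference. This confines all pairs (x,
d) to the cone on which the polynomial bounds are stated. -/
theorem abs_dd_le {X : ℝ} (hX : 0 ≤ X) (u : ℝ) (p : ℤ × ℤ) : |dd X u p| ≤ xx X u p := by
  have h1 := Real.exp_pos u
  have h2 := Real.exp_pos (-u)
  have h3 : 0 ≤ X / 2 * (((p.1 : ℝ) + p.2) ^ 2 * Real.exp u) := by positivity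
  have h4 : 0 ≤ X / 2 * (((p.1 : ℝ) - p.2) ^ 2 * Real.exp (-u)) := by positivity
  unfold dd xx
  rw [abs_le]
  constructor <;> nlinarith

theorem xx_ge {X u r : ℝ} (hX : 0 ≤ X) (hu : |u| ≤ r) (p : ℤ × ℤ) :
    X * Real.exp (-r) * ((p.1 : ℝ) ^ 2 + (p.2 : ℝ) ^ 2) ≤ xx X u p := by
  have h1 : Real.exp (-r) ≤ Real.exp u := Real.exp_le_exp.2 (by linarith [(abs_le.1 hu).1])
  have h2 : Real.exp (-r) ≤ Real.exp (-u) := Real.exp_le_exp.2 (by linarith [(abs_le.1 hu).2])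
  unfold xx
  have h3 := mul_le_mul_of_nonneg_left h1 (sq_nonneg ((p.1 : ℝ) + p.2))
  have h4 := mul_le_mul_of_nonneg_left h2 (sq_nonneg ((p.1 : ℝ) - p.2))
  have := mul_le_mul_of_nonneg_left (add_le_add h3 h4) (by positivity : 0 ≤ X / 2)
  refine le_trans (le_of_eq ?_) this
  ring

/-- Functions of `(x, d)` that are dominated by `e^{x/2}` on the cone `|d| ≤ x`. -/
def HalfBdd (f : ℝ → ℝ → ℝ) : Prop :=
  ∃ C : ℝ, 0 ≤ C ∧ ∀ x d : ℝ, |d| ≤ x → |f x d| ≤ C * Real.exp (x / 2)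

theorem halfBdd_of_pow {f : ℝ → ℝ → ℝ} (A : ℝ) (n : ℕ)
    (h : ∀ x d : ℝ, |d| ≤ x → |f x d| ≤ A * (1 + x) ^ n) : HalfBdd f := by
  have hA : 0 ≤ A := by
    have := (abs_nonneg _).trans (h 0 0 (by simp))
    simpa using this
  refine ⟨A * (n.factorial * 2 ^ n * Real.exp (1 / 2)), by positivity, fun x d hd => (h x d hd).trans ?_⟩
  have hx : 0 ≤ x := (abs_nonneg _).trans hd
  rw [mul_assoc]
  refine mul_le_mul_of_nonneg_left ?_ hA
  have := Real.pow_div_factorial_le_exp ((1 + x) / 2) (by positivity) n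
  rw [div_pow, div_div, div_le_iff₀ (by positivity), show (1 + x) / 2 = 1 / 2 + x / 2 by ring,
    Real.exp_add] at this
  linarith

/-- Polynomially bounded functions on the cone `|d| ≤ x`. -/
def PolyBdd (f : ℝ → ℝ → ℝ) : Prop :=
  ∃ (A : ℝ) (n : ℕ), ∀ x d : ℝ, |d| ≤ x → |f x d| ≤ A * (1 + x) ^ n

theorem PolyBdd.halfBdd {f : ℝ → ℝ → ℝ} (h : PolyBdd f) : HalfBdd f := by
  obtain ⟨A, n, h⟩ := h
  exact halfBdd_of_pow A n h

theorem polyBdd_const (c : ℝ) : PolyBdd fun _ _ => c := ⟨|c|, 0, fun x d _ => by simp⟩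

theorem polyBdd_fst : PolyBdd fun x _ => x :=
  ⟨1, 1, fun x d h => by
    have hx : 0 ≤ x := (abs_nonneg _).trans h
    rw [abs_of_nonneg hx]; linarith⟩

theorem polyBdd_snd : PolyBdd fun _ d => d :=
  ⟨1, 1, fun x d h => by linarith⟩

theorem PolyBdd.mul {f g : ℝ → ℝ → ℝ} (hf : PolyBdd f) (hg : PolyBdd g) :
    PolyBdd fun x d => f x d * g x d := by
  obtain ⟨A, n, hA⟩ := hf
  obtain ⟨B, m, hB⟩ := hg
  refine ⟨A * B, n + m, fun x d h => ?_⟩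
  rw [abs_mul, pow_add, mul_mul_mul_comm]
  exact mul_le_mul (hA x d h) (hB x d h) (abs_nonneg _) ((abs_nonneg _).trans (hA x d h))

theorem PolyBdd.add {f g : ℝ → ℝ → ℝ} (hf : PolyBdd f) (hg : PolyBdd g) :
    PolyBdd fun x d => f x d + g x d := by
  obtain ⟨A, n, hA⟩ := hf
  obtain ⟨B, m, hB⟩ := hg
  refine ⟨|A| + |B|, n + m, fun x d h => (abs_add_le _ _).trans ?_⟩
  have hx : 0 ≤ x := (abs_nonneg _).trans h
  have h1 : (1 + x) ^ n ≤ (1 + x) ^ (n + m) := pow_le_pow_right₀ (by linarith) (by omega)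
  have h2 : (1 + x) ^ m ≤ (1 + x) ^ (n + m) := pow_le_pow_right₀ (by linarith) (by omega)
  rw [add_mul]
  refine add_le_add ((hA x d h).trans ?_) ((hB x d h).trans ?_)
  · exact mul_le_mul (le_abs_self A) h1 (by positivity) (abs_nonneg _)
  · exact mul_le_mul (le_abs_self B) h2 (by positivity) (abs_nonneg _)

theorem PolyBdd.sub {f g : ℝ → ℝ → ℝ} (hf : PolyBdd f) (hg : PolyBdd g) :
    PolyBdd fun x d => f x d - g x d := by
  have := hf.add ((polyBdd_const (-1)).mul hg)
  simpa [sub_eq_add_neg] using this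

theorem PolyBdd.pow {f : ℝ → ℝ → ℝ} (hf : PolyBdd f) (n : ℕ) : PolyBdd fun x d => f x d ^ n := by
  induction n with
  | zero => simpa using polyBdd_const 1
  | succ n ih => simpa [pow_succ] using ih.mul hf

theorem polyBdd_pol (j : ℕ) : PolyBdd (pol j) := by
  have c := polyBdd_const
  have x := polyBdd_fst
  have d := polyBdd_snd
  match j with
  | 0 => exact (x.sub (c 1))
  | 1 => exact (d.mul ((c 2).sub x))
  | 2 => exact ((((c 2).mul x).sub (x.pow 2)).add ((d.pow 2).mul (x.sub (c 3))))
  | 3 => exact (d.mul ((((c 2).sub ((c 10).mul x)).add ((c 3).mul (x.pow 2))).add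
      ((d.pow 2).mul ((c 4).sub x))))
  | 4 => exact (((((c 2).mul x).sub ((c 10).mul (x.pow 2))).add ((c 3).mul (x.pow 3))).add
      ((d.pow 2).mul ((((c (-12)).add ((c 28).mul x)).sub ((c 6).mul (x.pow 2))).add
        ((d.pow 2).mul (x.sub (c 5))))))
  | 5 => exact (d.mul (((((c 2).sub ((c 46).mul x)).add ((c 75).mul (x.pow 2))).sub
      ((c 15).mul (x.pow 3))).add ((d.pow 2).mul ((((c 40).sub ((c 60).mul x)).add
        ((c 10).mul (x.pow 2))).add ((d.pow 2).mul ((c 6).sub x))))))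
  | 6 => exact ((((((c 2).mul x).sub ((c 46).mul (x.pow 2))).add ((c 75).mul (x.pow 3))).sub
      ((c 15).mul (x.pow 4))).add ((d.pow 2).mul (((((c (-48)).add ((c 316).mul x)).sub
        ((c 300).mul (x.pow 2))).add ((c 45).mul (x.pow 3))).add ((d.pow 2).mul
          ((((c (-100)).add ((c 110).mul x)).sub ((c 15).mul (x.pow 2))).add
            ((d.pow 2).mul (x.sub (c 7))))))))
  | (n + 7) => exact (c 0)

/-- Half of the decay e^{-x} pays for f; the other half is a Gaussian uniform in X ≥ X₀ and |u| ≤ r.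
One majorant thus serves differentiation in u and in X. -/
theorem exists_bound_of_halfBdd {f : ℝ → ℝ → ℝ} (hf : HalfBdd f) {X₀ : ℝ} (hX₀ : 0 < X₀) (r : ℝ) :
    ∃ B : ℤ × ℤ → ℝ, Summable B ∧ ∀ X u : ℝ, X₀ ≤ X → |u| ≤ r → ∀ p,
      |f (xx X u p) (dd X u p) * Real.exp (-xx X u p)| ≤ B p := by
  obtain ⟨C, hC, hf⟩ := hf
  have hc : 0 < X₀ * Real.exp (-r) / 2 := by have := Real.exp_pos (-r); positivity
  refine ⟨_, (summable_exp_neg_sq hc).mul_left C, fun X u hX hu p => ?_⟩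
  have hX0 : 0 ≤ X := hX₀.le.trans hX
  rw [abs_mul, abs_of_pos (Real.exp_pos _)]
  calc |f (xx X u p) (dd X u p)| * Real.exp (-xx X u p)
      ≤ C * Real.exp (xx X u p / 2) * Real.exp (-xx X u p) :=
        mul_le_mul_of_nonneg_right (hf _ _ (abs_dd_le hX0 u p)) (Real.exp_pos _).le
    _ = C * Real.exp (-(xx X u p / 2)) := by
        rw [mul_assoc, ← Real.exp_add]; congr 2; ring
    _ ≤ _ := by
        refine mul_le_mul_of_nonneg_left (Real.exp_le_exp.2 ?_) hC
        have h1 := xx_ge hX0 hu p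
        have h2 : X₀ * Real.exp (-r) * ((p.1 : ℝ) ^ 2 + (p.2 : ℝ) ^ 2) ≤
            X * Real.exp (-r) * ((p.1 : ℝ) ^ 2 + (p.2 : ℝ) ^ 2) := by
          have := Real.exp_pos (-r)
          gcongr
        linarith

theorem summable_of_halfBdd {f : ℝ → ℝ → ℝ} (hf : HalfBdd f) {X : ℝ} (hX : 0 < X) (u : ℝ) :
    Summable fun p : ℤ × ℤ => f (xx X u p) (dd X u p) * Real.exp (-xx X u p) := by
  obtain ⟨B, hB, h⟩ := exists_bound_of_halfBdd hf hX |u|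
  exact Summable.of_norm_bounded hB fun p => h X u le_rfl le_rfl p

theorem hasDerivAt_G {j : ℕ} (hj : j < 6) {X : ℝ} (hX : 0 < X) (u : ℝ) :
    HasDerivAt (G j X) (G (j + 1) X u) u := by
  obtain ⟨B, hB, h⟩ := exists_bound_of_halfBdd (polyBdd_pol (j + 1)).halfBdd hX (|u| + 1)
  refine hasDerivAt_tsum_of_isPreconnected (t := Metric.ball u 1) hB Metric.isOpen_ball
    (convex_ball u 1).isPreconnected
    (fun p v _ => hasDerivAt_pol (hasDerivAt_xx X v p) (hasDerivAt_dd X v p) hj)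
    (fun p v hv => h X v le_rfl ?_ p) (Metric.mem_ball_self one_pos)
    (summable_of_halfBdd (polyBdd_pol j).halfBdd hX u) (Metric.mem_ball_self one_pos)
  rw [Metric.mem_ball, Real.dist_eq] at hv
  calc |v| = |(v - u) + u| := by ring_nf
    _ ≤ |v - u| + |u| := abs_add_le _ _
    _ ≤ |u| + 1 := by linarith

theorem xx_eq_mul (X u : ℝ) (p : ℤ × ℤ) : xx X u p = X * xx 1 u p := by
  unfold xx; ring

theorem hasDerivAt_xx_left (X u : ℝ) (p : ℤ × ℤ) :
    HasDerivAt (fun X => xx X u p) (xx 1 u p) X := by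
  have : (fun X => xx X u p) = fun X => X * xx 1 u p := funext fun X => xx_eq_mul X u p
  rw [this]
  simpa using (hasDerivAt_id X).mul_const (xx 1 u p)

/-- Differentiation under the sum in the scale `X`. -/
theorem hasDerivAt_tsum_left {f f' : ℝ → ℝ} (hf : PolyBdd fun x _ => f x)
    (hf' : PolyBdd fun x _ => f' x)
    (hd : ∀ x, HasDerivAt (fun x => f x * Real.exp (-x)) (f' x * Real.exp (-x)) x)
    {X : ℝ} (hX : 0 < X) (u : ℝ) :
    HasDerivAt (fun X => ∑' p : ℤ × ℤ, f (xx X u p) * Real.exp (-xx X u p))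
      (1 / X * ∑' p : ℤ × ℤ, xx X u p * f' (xx X u p) * Real.exp (-xx X u p)) X := by
  obtain ⟨B, hB, h⟩ := exists_bound_of_halfBdd (polyBdd_fst.mul hf').halfBdd (half_pos hX) |u|
  have key := hasDerivAt_tsum_of_isPreconnected (t := Set.Ioi (X / 2)) (hB.mul_left (2 / X)) isOpen_Ioi
    isPreconnected_Ioi
    (g := fun p X => f (xx X u p) * Real.exp (-xx X u p))
    (g' := fun p X => f' (xx X u p) * Real.exp (-xx X u p) * xx 1 u p)
    (fun p Y _ => HasDerivAt.comp (h₂ := fun x => f x * Real.exp (-x)) Y (hd (xx Y u p)) (hasDerivAt_xx_left Y u p))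
    (fun p Y hY => ?_) (Set.mem_Ioi.2 (half_lt_self hX))
    (summable_of_halfBdd hf.halfBdd hX u) (Set.mem_Ioi.2 (half_lt_self hX))
  · refine key.congr_deriv ?_
    rw [← tsum_mul_left]
    refine tsum_congr fun p => ?_
    rw [xx_eq_mul X u p]
    field_simp
  · have hY0 : 0 < Y := (half_pos hX).trans hY
    have h1 := h Y u (le_of_lt hY) le_rfl p
    have e : f' (xx Y u p) * Real.exp (-xx Y u p) * xx 1 u p
        = 1 / Y * (xx Y u p * f' (xx Y u p) * Real.exp (-xx Y u p)) := by
      rw [xx_eq_mul Y u p]; field_simp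
    rw [e, Real.norm_eq_abs, abs_mul, abs_of_pos (by positivity : 0 < 1 / Y)]
    refine mul_le_mul ?_ h1 (abs_nonneg _) (by positivity)
    rw [div_le_div_iff₀ hY0 hX]
    have : X / 2 < Y := hY
    linarith

/-! ### Symmetries -/

theorem xx_neg (X u : ℝ) (p : ℤ × ℤ) : xx X (-u) p = xx X u (p.1, -p.2) := by
  unfold xx; push_cast; rw [neg_neg]; ring

theorem dd_neg (X u : ℝ) (p : ℤ × ℤ) : dd X (-u) p = -dd X u (p.1, -p.2) := by
  unfold dd; push_cast; rw [neg_neg]; ring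

theorem pol_neg {j : ℕ} (hj : Odd j) (x d : ℝ) : pol j x (-d) = -pol j x d := by
  match j with
  | 0 => exact absurd hj (by decide)
  | 1 => simp only [pol]; ring
  | 2 => exact absurd hj (by decide)
  | 3 => simp only [pol]; ring
  | 4 => exact absurd hj (by decide)
  | 5 => simp only [pol]; ring
  | 6 => exact absurd hj (by decide)
  | (n + 7) => simp [pol]

/-- The reflection n ↦ -n replaces u by -u. At u = 0 it fixes `xx` and changes the sign of `dd`, in
which the odd polynomials are odd. -/
theorem G_odd_zero {j : ℕ} (hj : Odd j) (X : ℝ) : G j X 0 = 0 := by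
  have h : G j X 0 = -G j X 0 := by
    conv_lhs => rw [G, ← (Equiv.prodCongr (Equiv.refl ℤ) (Equiv.neg ℤ)).tsum_eq]
    rw [G, ← tsum_neg]
    refine tsum_congr fun p => ?_
    have h1 := xx_neg X 0 p
    have h2 := dd_neg X 0 p
    rw [neg_zero] at h1 h2
    simp only [Equiv.prodCongr_apply, Prod.map, Equiv.refl_apply, Equiv.neg_apply]
    rw [← h1, show dd X 0 (p.1, -p.2) = -dd X 0 p by rw [h2, neg_neg], pol_neg hj]
    ring
  linarith

/-- The parameter of the hexagonal lattice. -/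
noncomputable def uHex : ℝ := Real.log 3 / 2

theorem exp_uHex : Real.exp uHex = √3 := by
  rw [uHex, eq_comm, Real.sqrt_eq_iff_eq_sq (by norm_num) (Real.exp_pos _).le, ← Real.exp_nat_mul]
  push_cast
  rw [mul_div_cancel₀ _ (by norm_num : (2 : ℝ) ≠ 0), Real.exp_log (by norm_num)]

/-! ### The hexagonal lattice is critical -/

theorem exp_neg_uHex : Real.exp (-uHex) = √3 / 3 := by
  rw [Real.exp_neg, exp_uHex]
  have : √3 ≠ 0 := by positivity
  field_simp
  norm_num

theorem uHex_pos : 0 < uHex := by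
  unfold uHex
  have := Real.log_pos (by norm_num : (1 : ℝ) < 3)
  linarith

theorem xx_uHex (X : ℝ) (p : ℤ × ℤ) :
    xx X uHex p = 2 * X * √3 / 3 * ((p.1 : ℝ) ^ 2 + p.1 * p.2 + (p.2 : ℝ) ^ 2) := by
  rw [xx, exp_uHex, exp_neg_uHex]; ring

theorem dd_uHex (X : ℝ) (p : ℤ × ℤ) :
    dd X uHex p = X * √3 / 3 * ((p.1 : ℝ) ^ 2 + 4 * p.1 * p.2 + (p.2 : ℝ) ^ 2) := by
  rw [dd, exp_uHex, exp_neg_uHex]; ring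

/-- The rotation of order six of the hexagonal lattice. -/
def rotHex : ℤ × ℤ ≃ ℤ × ℤ where
  toFun p := (-p.2, p.1 + p.2)
  invFun p := (p.1 + p.2, -p.1)
  left_inv p := by ext <;> simp
  right_inv p := by ext <;> simp

/-- The rotation of order six preserves x, while the three values of d along p, rot p, rot² p add up
to zero. Since `pol 1` is linear in d, averaging over these rotations kills the sum. -/
theorem G_one_uHex {X : ℝ} (hX : 0 < X) : G 1 X uHex = 0 := by
  have hx : ∀ p, xx X uHex (rotHex p) = xx X uHex p := fun p => by
    rw [xx_uHex, xx_uHex]; simp only [rotHex, Equiv.coe_fn_mk]; push_cast; ring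
  have hd : ∀ p, dd X uHex p + dd X uHex (rotHex p) + dd X uHex (rotHex (rotHex p)) = 0 := fun p => by
    rw [dd_uHex, dd_uHex, dd_uHex]; simp only [rotHex, Equiv.coe_fn_mk]; push_cast; ring
  have hs := summable_of_halfBdd (polyBdd_pol 1).halfBdd hX uHex
  set f : ℤ × ℤ → ℝ := fun p => pol 1 (xx X uHex p) (dd X uHex p) * Real.exp (-xx X uHex p) with hf
  have hs1 : Summable fun p => f (rotHex p) := hs.comp_injective rotHex.injective
  have hs2 : Summable fun p => f (rotHex (rotHex p)) := hs1.comp_injective rotHex.injective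
  have e1 : ∑' p, f (rotHex p) = G 1 X uHex := rotHex.tsum_eq f
  have e2 : ∑' p, f (rotHex (rotHex p)) = G 1 X uHex :=
    (rotHex.tsum_eq fun p => f (rotHex p)).trans e1
  have h3 : ∑' p, (f p + f (rotHex p) + f (rotHex (rotHex p))) = 0 := by
    rw [← tsum_zero (α := ℝ) (β := ℤ × ℤ)]
    refine tsum_congr fun p => ?_
    simp only [hf, hx, pol]
    linear_combination (2 - xx X uHex p) * Real.exp (-xx X uHex p) * hd p
  rw [(hs.add hs1).tsum_add hs2, hs.tsum_add hs1, e1, e2] at h3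
  have : ∑' p, f p = G 1 X uHex := rfl
  linarith

/-! ### The functional equation of the theta series -/

theorem xx_eq_cosh (t u : ℝ) (p : ℤ × ℤ) : xx t u p
    = t * (Real.cosh u * (p.1 : ℝ) ^ 2 + 2 * Real.sinh u * p.1 * p.2 + Real.cosh u * (p.2 : ℝ) ^ 2) := by
  rw [xx, Real.cosh_eq, Real.sinh_eq]; ring

theorem polyBdd_one : PolyBdd fun _ _ => (1 : ℝ) := polyBdd_const 1

theorem summable_theta {t : ℝ} (ht : 0 < t) (u : ℝ) :
    Summable fun p : ℤ × ℤ => Real.exp (-xx t u p) := by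
  simpa using summable_of_halfBdd polyBdd_one.halfBdd ht u

/-- Poisson summation is applied in one coordinate and then in the other. Because cosh² - sinh² = 1,
the dual form is the original one after exchanging the coordinates and changing one sign; the two
root factors (α w)^{1/2} and (α / w)^{1/2} multiply to α. -/
theorem theta_functional {α : ℝ} (hα : 0 < α) (u : ℝ) :
    ∑' p : ℤ × ℤ, Real.exp (-xx (Real.pi * α) u p)
      = 1 / α * ∑' p : ℤ × ℤ, Real.exp (-xx (Real.pi / α) u p) := by
  have hπ := Real.pi_pos
  set w := Real.cosh u with hw
  set σ := Real.sinh u with hσ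
  have hw0 : 0 < w := Real.cosh_pos u
  have hws : w ^ 2 - σ ^ 2 = 1 := Real.cosh_sq_sub_sinh_sq u
  have hwc : (w : ℂ) ≠ 0 := by exact_mod_cast hw0.ne'
  have hαc : (α : ℂ) ≠ 0 := by exact_mod_cast hα.ne'
  have hwsc : (w : ℂ) ^ 2 - (σ : ℂ) ^ 2 = 1 := by exact_mod_cast hws
  -- The half-transformed summand: dual in the second coordinate, still original in the first.
  let T : ℤ × ℤ → ℂ := fun p => Complex.exp (-(Real.pi * α / w * (p.1 : ℂ) ^ 2)
    - Real.pi / (α * w) * (p.2 : ℂ) ^ 2 + 2 * Real.pi * Complex.I * (σ / w) * p.1 * p.2)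
  have hT : Summable T := by
    set c := min (Real.pi * α / w) (Real.pi / (α * w)) with hc
    have hc0 : 0 < c := lt_min (by positivity) (by positivity)
    refine Summable.of_norm_bounded (summable_exp_neg_sq hc0) fun p => ?_
    have hre : (-(Real.pi * α / w * (p.1 : ℂ) ^ 2)
      - Real.pi / (α * w) * (p.2 : ℂ) ^ 2 + 2 * Real.pi * Complex.I * (σ / w) * p.1 * p.2 : ℂ)
      = ((-(Real.pi * α / w * (p.1 : ℝ) ^ 2) - Real.pi / (α * w) * (p.2 : ℝ) ^ 2 : ℝ) : ℂ)
        + ((2 * Real.pi * (σ / w) * p.1 * p.2 : ℝ) : ℂ) * Complex.I := by push_cast; ring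
    simp only [T]
    rw [hre, Complex.norm_exp, Complex.add_re, Complex.ofReal_re, Complex.re_ofReal_mul, Complex.I_re,
      mul_zero, add_zero, Real.exp_le_exp]
    have h1 := mul_le_mul_of_nonneg_right (min_le_left (Real.pi * α / w) (Real.pi / (α * w)))
      (sq_nonneg (p.1 : ℝ))
    have h2 := mul_le_mul_of_nonneg_right (min_le_right (Real.pi * α / w) (Real.pi / (α * w)))
      (sq_nonneg (p.2 : ℝ))
    rw [← hc] at h1 h2
    linarith
  have hL : ∀ {t : ℝ}, 0 < t → Summable fun p : ℤ × ℤ => ((Real.exp (-xx t u p) : ℝ) : ℂ) :=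
    fun ht => Complex.ofRealCLM.summable (summable_theta ht u)
  have step1 : ∑' p : ℤ × ℤ, ((Real.exp (-xx (Real.pi * α) u p) : ℝ) : ℂ)
      = 1 / ((α * w : ℝ) : ℂ) ^ (1 / 2 : ℂ) * ∑' p, T p := by
    rw [(hL (mul_pos hπ hα)).tsum_prod, hT.tsum_prod, ← tsum_mul_left]
    refine tsum_congr fun m => ?_
    have h := Complex.tsum_exp_neg_quadratic (a := ((α * w : ℝ) : ℂ))
      (by rw [Complex.ofReal_re]; positivity) (((-(α * σ * m) : ℝ)) : ℂ)
    have e1 : ∀ n : ℤ, ((Real.exp (-xx (Real.pi * α) u (m, n)) : ℝ) : ℂ)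
        = Complex.exp (-(Real.pi * α * w * (m : ℂ) ^ 2)) *
          Complex.exp (-Real.pi * ((α * w : ℝ) : ℂ) * n ^ 2
            + 2 * Real.pi * ((-(α * σ * m) : ℝ) : ℂ) * n) := fun n => by
      rw [← Complex.exp_add, Complex.ofReal_exp, xx_eq_cosh, ← hw, ← hσ]
      congr 1
      push_cast
      ring
    simp_rw [e1]
    rw [tsum_mul_left, h, mul_left_comm, ← tsum_mul_left]
    congr 1
    refine tsum_congr fun k => ?_
    simp only [T]
    rw [← Complex.exp_add]
    congr 1
    push_cast
    field_simp
    ring_nf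
    simp only [Complex.I_sq]
    linear_combination (-(α : ℂ) ^ 2 * m ^ 2) * hwsc
  have step2 : ∑' p, T p = 1 / ((α / w : ℝ) : ℂ) ^ (1 / 2 : ℂ)
      * ∑' p : ℤ × ℤ, ((Real.exp (-xx (Real.pi / α) u p) : ℝ) : ℂ) := by
    have hsum := hL (div_pos hπ hα)
    rw [← (Equiv.prodCongr (Equiv.refl ℤ) (Equiv.neg ℤ)).tsum_eq
      (fun p : ℤ × ℤ => ((Real.exp (-xx (Real.pi / α) u p) : ℝ) : ℂ))]
    have hsum' := hsum.comp_injective (Equiv.prodCongr (Equiv.refl ℤ) (Equiv.neg ℤ)).injective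
    rw [← (Equiv.prodComm ℤ ℤ).tsum_eq T]
    have hT' := hT.comp_injective (Equiv.prodComm ℤ ℤ).injective
    simp only [Function.comp_def] at hsum' hT'
    rw [hT'.tsum_prod, hsum'.tsum_prod, ← tsum_mul_left]
    refine tsum_congr fun k => ?_
    have h := Complex.tsum_exp_neg_quadratic (a := ((α / w : ℝ) : ℂ))
      (by rw [Complex.ofReal_re]; positivity) (Complex.I * (σ / w) * k)
    have e1 : ∀ m : ℤ, T ((Equiv.prodComm ℤ ℤ) (k, m))
        = Complex.exp (-(Real.pi / (α * w) * (k : ℂ) ^ 2)) *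
          Complex.exp (-Real.pi * ((α / w : ℝ) : ℂ) * m ^ 2
            + 2 * Real.pi * (Complex.I * (σ / w) * k) * m) := fun m => by
      simp only [T, Equiv.prodComm_apply, Prod.swap]
      rw [← Complex.exp_add]
      congr 1
      push_cast
      ring
    simp_rw [e1]
    rw [tsum_mul_left, h, mul_left_comm, ← tsum_mul_left]
    congr 1
    refine tsum_congr fun j => ?_
    simp only [Equiv.prodCongr_apply, Prod.map, Equiv.refl_apply, Equiv.neg_apply]
    rw [← Complex.exp_add, Complex.ofReal_exp, xx_eq_cosh, ← hw, ← hσ]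
    congr 1
    push_cast
    rw [show (j : ℂ) + Complex.I * (Complex.I * (σ / w) * k) = j - σ / w * k by
      linear_combination ((σ : ℂ) / w * k) * Complex.I_sq]
    field_simp
    ring_nf
    linear_combination ((k : ℂ) ^ 2) * hwsc
  have hroot : 1 / ((α * w : ℝ) : ℂ) ^ (1 / 2 : ℂ) * (1 / ((α / w : ℝ) : ℂ) ^ (1 / 2 : ℂ)) = 1 / α := by
    rw [div_mul_div_comm, one_mul, show (1 / 2 : ℂ) = ((1 / 2 : ℝ) : ℂ) by push_cast; rfl,
      ← Complex.ofReal_cpow (by positivity), ← Complex.ofReal_cpow (by positivity),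
      ← Complex.ofReal_mul, ← Real.mul_rpow (by positivity) (by positivity),
      show α * w * (α / w) = α ^ 2 by field_simp, ← Real.sqrt_eq_rpow, Real.sqrt_sq hα.le]
  have hfin : ∑' p : ℤ × ℤ, ((Real.exp (-xx (Real.pi * α) u p) : ℝ) : ℂ)
      = 1 / α * ∑' p : ℤ × ℤ, ((Real.exp (-xx (Real.pi / α) u p) : ℝ) : ℂ) := by
    rw [step1, step2, ← mul_assoc, hroot]
  rw [← Complex.ofReal_tsum, ← Complex.ofReal_tsum] at hfin
  exact_mod_cast hfin

theorem hasDerivAt_theta {t : ℝ} (ht : 0 < t) (u : ℝ) :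
    HasDerivAt (fun t => ∑' p : ℤ × ℤ, Real.exp (-xx t u p))
      (-(1 / t * ∑' p : ℤ × ℤ, xx t u p * Real.exp (-xx t u p))) t := by
  have h := hasDerivAt_tsum_left (f := fun _ => 1) (f' := fun _ => -1) (polyBdd_const 1)
    (polyBdd_const (-1)) (fun x => by simpa using (hasDerivAt_neg x).exp) ht u
  simp only [one_mul, mul_neg, mul_one, neg_mul, tsum_neg] at h
  exact h

theorem G_zero_eq {t : ℝ} (ht : 0 < t) (u : ℝ) :
    G 0 t u = ∑' p : ℤ × ℤ, xx t u p * Real.exp (-xx t u p)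
      - ∑' p : ℤ × ℤ, Real.exp (-xx t u p) := by
  rw [← (summable_of_halfBdd polyBdd_fst.halfBdd ht u).tsum_sub (summable_theta ht u), G]
  refine tsum_congr fun p => ?_
  simp only [pol]; ring

/-- The α-derivative of `theta_functional`. On the dual side the prefactor 1/α and the inner scale
π/α contribute the two parts of x - 1. -/
theorem tsum_xx_exp_eq_G {α : ℝ} (hα : 0 < α) (u : ℝ) :
    ∑' p : ℤ × ℤ, xx (Real.pi * α) u p * Real.exp (-xx (Real.pi * α) u p)
      = -(1 / α * G 0 (Real.pi / α) u) := by
  have hπ := Real.pi_pos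
  have h1 := HasDerivAt.comp α (hasDerivAt_theta (mul_pos hπ hα) u)
    ((hasDerivAt_id α).const_mul Real.pi)
  have hi : HasDerivAt (fun a : ℝ => 1 / a) (-(1 / α ^ 2)) α := by
    simpa [one_div] using hasDerivAt_inv hα.ne'
  have hp : HasDerivAt (fun a : ℝ => Real.pi / a) (Real.pi * -(1 / α ^ 2)) α := by
    simpa [div_eq_mul_inv] using hi.const_mul Real.pi
  have h2 := hi.mul (HasDerivAt.comp α (hasDerivAt_theta (div_pos hπ hα) u) hp)
  have heq : (fun a => ∑' p : ℤ × ℤ, Real.exp (-xx (Real.pi * a) u p)) =ᶠ[nhds α]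
      fun a => 1 / a * ∑' p : ℤ × ℤ, Real.exp (-xx (Real.pi / a) u p) := by
    filter_upwards [lt_mem_nhds hα] with a ha using theta_functional ha u
  have h3 := (h1.congr_of_eventuallyEq heq.symm).unique h2
  simp only [Function.comp_apply] at h3
  rw [G_zero_eq (div_pos hπ hα)]
  field_simp at h3 ⊢
  linarith

/-! ### The arc -/

theorem quadForm_eq (z : UpperHalfPlane) (p : ℤ × ℤ) {c s : ℝ}
    (hz : (z : ℂ) = (c : ℂ) + s * Complex.I) (h1 : c ^ 2 + s ^ 2 = 1) :
    quadForm z p = ((p.1 : ℝ) ^ 2 + 2 * p.1 * p.2 * c + (p.2 : ℝ) ^ 2) / s := by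
  have him : z.im = s := by
    rw [← UpperHalfPlane.coe_im, hz]; simp
  rw [quadForm, him, hz, ← Complex.normSq_eq_norm_sq, Complex.normSq_apply]
  simp
  congr 1
  linear_combination (p.1 : ℝ) ^ 2 * h1

/-- On the unit circle (1 + c)/s and (1 - c)/s are reciprocal, so they are e^u and e^{-u}; the form
is diagonal in m + n and m - n. -/
theorem quadForm_eq_xx (z : UpperHalfPlane) (p : ℤ × ℤ) {c s : ℝ} (hc : -1 < c) (hs : 0 < s)
    (hz : (z : ℂ) = (c : ℂ) + s * Complex.I) (h1 : c ^ 2 + s ^ 2 = 1) :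
    quadForm z p = xx 1 (Real.log ((1 + c) / s)) p := by
  have hc' : 0 < 1 + c := by linarith
  have hpos : 0 < (1 + c) / s := by positivity
  rw [quadForm_eq z p hz h1, xx, Real.exp_neg, Real.exp_log hpos]
  field_simp
  linear_combination (-((p.1 : ℝ) - p.2) ^ 2) * h1

theorem M_eq_G {α : ℝ} (hα : 0 < α) {z : UpperHalfPlane} {u : ℝ}
    (h : ∀ p, quadForm z p = xx 1 u p) :
    M α z = -(1 / (Real.pi * α ^ 2) * G 0 (Real.pi / α) u) := by
  have h1 := tsum_xx_exp_eq_G hα u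
  have hπ := Real.pi_pos
  have h2 : Real.pi * α * M α z = ∑' p : ℤ × ℤ, xx (Real.pi * α) u p * Real.exp (-xx (Real.pi * α) u p) := by
    rw [M, ← tsum_mul_left]
    refine tsum_congr fun p => ?_
    rw [h, xx_eq_mul (Real.pi * α) u p]
    ring
  rw [h1] at h2
  field_simp at h2 ⊢
  exact h2

theorem coe_eq_cos_add_sin {z : UpperHalfPlane} {θ : ℝ} (h : (z : ℂ) = Complex.exp ((θ : ℂ) * Complex.I)) :
    (z : ℂ) = (Real.cos θ : ℝ) + (Real.sin θ : ℝ) * Complex.I := by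
  rw [h, Complex.exp_mul_I]; push_cast; rfl

theorem hexPoint_coe : (hexPoint : ℂ) = Complex.exp (((Real.pi / 3 : ℝ) : ℂ) * Complex.I) := rfl

theorem I_coe : (UpperHalfPlane.I : ℂ) = Complex.exp (((Real.pi / 2 : ℝ) : ℂ) * Complex.I) := by
  push_cast
  rw [Complex.exp_pi_div_two_mul_I]

theorem hexPoint_mem_arcB : hexPoint ∈ arcB :=
  ⟨Real.pi / 3, ⟨le_rfl, by linarith [Real.pi_pos]⟩, hexPoint_coe⟩

theorem I_mem_arcB : UpperHalfPlane.I ∈ arcB :=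
  ⟨Real.pi / 2, ⟨by linarith [Real.pi_pos], le_rfl⟩, I_coe⟩

theorem quadForm_I (p : ℤ × ℤ) : quadForm UpperHalfPlane.I p = xx 1 0 p := by
  rw [quadForm_eq UpperHalfPlane.I p (c := 0) (s := 1) (by simp) (by norm_num), xx]
  simp; ring

theorem quadForm_hexPoint (p : ℤ × ℤ) : quadForm hexPoint p = xx 1 uHex p := by
  have h := coe_eq_cos_add_sin hexPoint_coe
  rw [quadForm_eq hexPoint p h (Real.cos_sq_add_sin_sq _), xx_uHex, Real.cos_pi_div_three,
    Real.sin_pi_div_three]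
  have h3 : √3 * √3 = 3 := Real.mul_self_sqrt (by norm_num)
  have h0 : √3 ≠ 0 := by positivity
  rw [div_eq_iff (by positivity)]
  linear_combination (-((p.1 : ℝ) ^ 2 + p.1 * p.2 + (p.2 : ℝ) ^ 2) / 3) * h3

/-- The parameter of a point of the arc. -/
theorem exists_param {z : UpperHalfPlane} (hz : z ∈ arcB) :
    ∃ u ∈ Set.Icc 0 uHex, (∀ p, quadForm z p = xx 1 u p) ∧ (u = 0 → z = UpperHalfPlane.I) ∧
      (u = uHex → z = hexPoint) := by
  obtain ⟨θ, ⟨h1, h2⟩, hz⟩ := hz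
  have hπ := Real.pi_pos
  set c := Real.cos θ with hc
  set s := Real.sin θ with hs
  have hcs : c ^ 2 + s ^ 2 = 1 := Real.cos_sq_add_sin_sq θ
  have hs0 : 0 < s := Real.sin_pos_of_pos_of_lt_pi (by linarith) (by linarith)
  have hs1 : s ≤ 1 := Real.sin_le_one θ
  have hc0 : 0 ≤ c := Real.cos_nonneg_of_mem_Icc ⟨by linarith, h2⟩
  have hc1 : c ≤ 1 / 2 := by
    rw [← Real.cos_pi_div_three]
    exact Real.cos_le_cos_of_nonneg_of_le_pi (by linarith) (by linarith) h1
  have hpos : 0 < (1 + c) / s := by positivity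
  have h3 : √3 * √3 = 3 := Real.mul_self_sqrt (by norm_num)
  have h30 : 0 < √3 := by positivity
  have hz' := coe_eq_cos_add_sin hz
  have hinj : ∀ θ' ∈ Set.Icc (0 : ℝ) Real.pi, Real.cos θ = Real.cos θ' → θ = θ' := fun θ' h' h =>
    Real.injOn_cos ⟨by linarith, by linarith⟩ h' h
  refine ⟨Real.log ((1 + c) / s), ⟨?_, ?_⟩, fun p => quadForm_eq_xx z p (by linarith) hs0 hz' hcs,
    fun h => ?_, fun h => ?_⟩
  · exact Real.log_nonneg (by rw [le_div_iff₀ hs0]; linarith)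
  · rw [← Real.exp_le_exp, Real.exp_log hpos, exp_uHex, div_le_iff₀ hs0]
    refine (sq_le_sq₀ (by linarith) (by positivity)).1 ?_
    rw [mul_pow, Real.sq_sqrt (by norm_num)]
    nlinarith
  · have h4 : (1 + c) / s = 1 := by
      rw [← Real.exp_log hpos, h, Real.exp_zero]
    rw [div_eq_one_iff_eq hs0.ne'] at h4
    have h5 : c = 0 := by linarith
    have := hinj (Real.pi / 2) ⟨by linarith, by linarith⟩ (by rw [← hc, h5, Real.cos_pi_div_two])
    apply UpperHalfPlane.ext
    rw [hz, this, I_coe]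
  · have h4 : (1 + c) / s = √3 := by
      rw [← Real.exp_log hpos, h, exp_uHex]
    rw [div_eq_iff hs0.ne'] at h4
    have h5 : c = 1 / 2 := by
      have : (1 + c) ^ 2 = 3 * s ^ 2 := by rw [h4, mul_pow, Real.sq_sqrt (by norm_num)]
      have h6 : (1 + c) * (c - 1 / 2) = 0 := by linear_combination this / 4 + 3 / 4 * hcs
      rcases mul_eq_zero.1 h6 with h | h <;> linarith
    have := hinj (Real.pi / 3) ⟨by linarith, by linarith⟩ (by rw [← hc, h5, Real.cos_pi_div_three])
    apply UpperHalfPlane.ext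
    rw [hz, this, hexPoint_coe]

/-! ### Functions whose derivatives have a prescribed sign pattern -/

theorem exists_slope {f f' : ℝ → ℝ} (hf : ∀ u, HasDerivAt f (f' u) u) {a b : ℝ} (hab : a < b) :
    ∃ c ∈ Set.Ioo a b, f' c * (b - a) = f b - f a := by
  obtain ⟨c, hc, h⟩ := exists_hasDerivAt_eq_slope f f' hab
    (fun x _ => (hf x).continuousAt.continuousWithinAt) (fun x _ => hf x)
  exact ⟨c, hc, by rw [h, div_mul_cancel₀ _ (sub_pos.2 hab).ne']⟩

theorem exists_deriv_nonneg {f f' : ℝ → ℝ} (hf : ∀ u, HasDerivAt f (f' u) u) {a b : ℝ} (hab : a < b)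
    (h : f a ≤ f b) : ∃ c ∈ Set.Ioo a b, 0 ≤ f' c := by
  obtain ⟨c, hc, hs⟩ := exists_slope hf hab
  exact ⟨c, hc, nonneg_of_mul_nonneg_left (by linarith : 0 ≤ f' c * (b - a)) (sub_pos.2 hab)⟩

theorem exists_deriv_nonpos {f f' : ℝ → ℝ} (hf : ∀ u, HasDerivAt f (f' u) u) {a b : ℝ} (hab : a < b)
    (h : f b ≤ f a) : ∃ c ∈ Set.Ioo a b, f' c ≤ 0 := by
  obtain ⟨c, hc, hs⟩ := exists_deriv_nonneg (f := fun u => -f u) (f' := fun u => -f' u)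
    (fun u => (hf u).neg) hab (neg_le_neg h)
  exact ⟨c, hc, by linarith⟩

variable {f₀ f₁ f₂ f₃ f₄ f₅ f₆ : ℝ → ℝ} {h : ℝ}

/-- If `f₀''` cannot have a local minimum and `f₀'` vanishes at both ends, then interior values of
`f₀` stay below the larger end value. -/
theorem lt_max_of_not_dip (h01 : ∀ u, HasDerivAt f₀ (f₁ u) u) (h12 : ∀ u, HasDerivAt f₁ (f₂ u) u)
    (h23 : ∀ u, HasDerivAt f₂ (f₃ u) u) (z0 : f₁ 0 = 0) (zh : f₁ h = 0)
    (hR : ∀ r₁ r₂, 0 < r₁ → r₁ < r₂ → r₂ < h → f₃ r₁ ≤ 0 → 0 ≤ f₃ r₂ → False)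
    {c : ℝ} (hc0 : 0 < c) (hch : c < h) : f₀ c < max (f₀ 0) (f₀ h) := by
  by_contra! hcon
  -- f₁ has weak signs +, - at a < c < b and vanishes at both ends, so f₂ has weak signs +, -, + at
  -- s₁ < s₂ < s₃, hence f₃ is ≤ 0 and then ≥ 0.
  obtain ⟨a, ha, ha'⟩ := exists_deriv_nonneg h01 hc0 ((le_max_left _ _).trans hcon)
  obtain ⟨b, hb, hb'⟩ := exists_deriv_nonpos h01 hch ((le_max_right _ _).trans hcon)
  obtain ⟨s₁, hs₁, h1⟩ := exists_deriv_nonneg h12 ha.1 (z0.trans_le ha')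
  obtain ⟨s₂, hs₂, h2⟩ := exists_deriv_nonpos h12 (ha.2.trans hb.1) (hb'.trans ha')
  obtain ⟨s₃, hs₃, h3⟩ := exists_deriv_nonneg h12 hb.2 (zh ▸ hb')
  obtain ⟨r₁, hr₁, k1⟩ := exists_deriv_nonpos h23 (hs₁.2.trans hs₂.1) (h2.trans h1)
  obtain ⟨r₂, hr₂, k2⟩ := exists_deriv_nonneg h23 (hs₂.2.trans hs₃.1) (h2.trans h3)
  exact hR r₁ r₂ (hs₁.1.trans hr₁.1) (hr₁.2.trans hr₂.1) (hr₂.2.trans hs₃.2) k1 k2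

theorem neg_of_deriv_neg {f f' : ℝ → ℝ} (hf : ∀ u, HasDerivAt f (f' u) u) (z : f 0 = 0) {b : ℝ}
    (hneg : ∀ u, 0 ≤ u → u ≤ b → f' u < 0) {u : ℝ} (h0 : 0 < u) (hu : u ≤ b) : f u < 0 := by
  by_contra! hcon
  obtain ⟨c, hc, hc'⟩ := exists_deriv_nonneg hf h0 (z.trans_le hcon)
  exact absurd (hneg c hc.1.le (hc.2.le.trans hu)) (not_lt.2 hc')

theorem pos_of_deriv_pos {f f' : ℝ → ℝ} (hf : ∀ u, HasDerivAt f (f' u) u) (z : f 0 = 0) {b : ℝ}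
    (hpos : ∀ u, 0 ≤ u → u ≤ b → 0 < f' u) {u : ℝ} (h0 : 0 < u) (hu : u ≤ b) : 0 < f u := by
  have := neg_of_deriv_neg (f := fun u => -f u) (f' := fun u => -f' u) (fun u => (hf u).neg)
    (by simp [z]) (fun u h1 h2 => neg_neg_of_pos (hpos u h1 h2)) h0 hu
  linarith

/-- The third derivative is negative. -/
theorem lt_max_of_third_neg (h01 : ∀ u, HasDerivAt f₀ (f₁ u) u) (h12 : ∀ u, HasDerivAt f₁ (f₂ u) u)
    (h23 : ∀ u, HasDerivAt f₂ (f₃ u) u) (h34 : ∀ u, HasDerivAt f₃ (f₄ u) u)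
    (z0 : f₁ 0 = 0) (zh : f₁ h = 0) (z3 : f₃ 0 = 0) {b : ℝ}
    (n4 : ∀ u, 0 ≤ u → u ≤ b → f₄ u < 0) (n3 : ∀ u, b ≤ u → u ≤ h → f₃ u < 0)
    {c : ℝ} (hc0 : 0 < c) (hch : c < h) : f₀ c < max (f₀ 0) (f₀ h) := by
  refine lt_max_of_not_dip h01 h12 h23 z0 zh (fun r₁ r₂ h0 h1 h2 _ k2 => ?_) hc0 hch
  rcases le_total r₂ b with hb | hb
  · exact absurd (neg_of_deriv_neg h34 z3 n4 (h0.trans h1) hb) (not_lt.2 k2)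
  · exact absurd (n3 r₂ hb h2.le) (not_lt.2 k2)

/-- The third derivative changes sign once, from plus to minus. -/
theorem lt_max_of_fourth_anti (h01 : ∀ u, HasDerivAt f₀ (f₁ u) u) (h12 : ∀ u, HasDerivAt f₁ (f₂ u) u)
    (h23 : ∀ u, HasDerivAt f₂ (f₃ u) u) (h34 : ∀ u, HasDerivAt f₃ (f₄ u) u)
    (h45 : ∀ u, HasDerivAt f₄ (f₅ u) u) (h56 : ∀ u, HasDerivAt f₅ (f₆ u) u)
    (z0 : f₁ 0 = 0) (zh : f₁ h = 0) (z3 : f₃ 0 = 0) (z5 : f₅ 0 = 0) {b₁ b₂ : ℝ}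
    (n6 : ∀ u, 0 ≤ u → u ≤ b₁ → f₆ u < 0) (n5 : ∀ u, b₁ ≤ u → u ≤ b₂ → f₅ u < 0)
    (n4 : ∀ u, b₂ ≤ u → u ≤ h → f₄ u < 0)
    {c : ℝ} (hc0 : 0 < c) (hch : c < h) : f₀ c < max (f₀ 0) (f₀ h) := by
  refine lt_max_of_not_dip h01 h12 h23 z0 zh (fun r₁ r₂ h0 h1 h2 k1 k2 => ?_) hc0 hch
  -- With f₃(0) = 0 the dip forces f₄ ≤ 0 at t₁ and f₄ ≥ 0 at t₂ > t₁. The second is impossible past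
  -- b₂; before b₂ it needs f₅ ≥ 0 at a positive point, while f₅ is negative there, integrated from
  -- f₅(0) = 0 up to b₁ and by assumption beyond.
  obtain ⟨t₁, ht₁, l1⟩ := exists_deriv_nonpos h34 h0 (z3.symm ▸ k1)
  obtain ⟨t₂, ht₂, l2⟩ := exists_deriv_nonneg h34 h1 (k1.trans k2)
  rcases le_total b₂ t₂ with hb | hb
  · exact absurd (n4 t₂ hb (ht₂.2.trans h2).le) (not_lt.2 l2)
  · obtain ⟨v, hv, hv'⟩ := exists_deriv_nonneg h45 (ht₁.2.trans ht₂.1) (l1.trans l2)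
    have hv0 : 0 < v := ht₁.1.trans hv.1
    rcases le_total v b₁ with hb' | hb'
    · exact absurd (neg_of_deriv_neg h56 z5 n6 hv0 hb') (not_lt.2 hv')
    · exact absurd (n5 v hb' (hv.2.le.trans hb)) (not_lt.2 hv')

/-- The third derivative is positive. -/
theorem lt_left_of_third_pos (h01 : ∀ u, HasDerivAt f₀ (f₁ u) u) (h12 : ∀ u, HasDerivAt f₁ (f₂ u) u)
    (h23 : ∀ u, HasDerivAt f₂ (f₃ u) u) (h34 : ∀ u, HasDerivAt f₃ (f₄ u) u)
    (z0 : f₁ 0 = 0) (zh : f₁ h = 0) (z3 : f₃ 0 = 0) {b : ℝ}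
    (n4 : ∀ u, 0 ≤ u → u ≤ b → 0 < f₄ u) (n3 : ∀ u, b ≤ u → u ≤ h → 0 < f₃ u)
    {c : ℝ} (hc0 : 0 < c) (hch : c ≤ h) : f₀ c < f₀ 0 := by
  by_contra! hcon
  -- A nonnegative f₁ between two zeros makes f₂ rise and then fall, so f₃ ≤ 0 at some positive
  -- point. No comparison with the right end is used, so c = h is allowed.
  obtain ⟨a, ha, ha'⟩ := exists_deriv_nonneg h01 hc0 hcon
  obtain ⟨s₁, hs₁, h1⟩ := exists_deriv_nonneg h12 ha.1 (z0.trans_le ha')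
  obtain ⟨s₂, hs₂, h2⟩ := exists_deriv_nonpos h12 (ha.2.trans_le hch) (zh.trans_le ha')
  obtain ⟨r, hr, k⟩ := exists_deriv_nonpos h23 (hs₁.2.trans hs₂.1) (h2.trans h1)
  have hr0 : 0 < r := hs₁.1.trans hr.1
  rcases le_total r b with hb | hb
  · exact absurd (pos_of_deriv_pos h34 z3 n4 hr0 hb) (not_lt.2 k)
  · exact absurd (n3 r hb (hr.2.le.trans hs₂.2.le)) (not_lt.2 k)

/-! ### Bounds for the tails of the lattice sums -/

theorem hasSum_pow_natAbs {r : ℝ} (h0 : 0 ≤ r) (h1 : r < 1) :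
    HasSum (fun n : ℤ => r ^ n.natAbs) ((1 + r) / (1 - r)) := by
  have h := hasSum_geometric_of_lt_one h0 h1
  have h' : HasSum (fun n : ℕ => r ^ (n + 1)) (r * (1 - r)⁻¹) := by
    simpa [pow_succ'] using h.mul_left r
  have := HasSum.of_nat_of_neg_add_one (f := fun n : ℤ => r ^ n.natAbs) (by simpa using h)
    (by
      refine h'.congr_fun fun n => ?_
      congr 1)
  convert this using 1
  field_simp

/-- The square `[-(R - 1), R - 1]²`. -/
noncomputable def square (R : ℕ) : Finset (ℤ × ℤ) :=
  Finset.Icc (1 - (R : ℤ)) (R - 1) ×ˢ Finset.Icc (1 - (R : ℤ)) (R - 1)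

theorem le_natAbs_of_notMem_square {R : ℕ} {p : ℤ × ℤ} (hp : p ∉ square R) :
    R ≤ p.1.natAbs ∨ R ≤ p.2.natAbs := by
  simp only [square, Finset.mem_product, Finset.mem_Icc] at hp
  omega

theorem exp_neg_mul_sq_le {b : ℝ} (hb : 0 ≤ b) (n : ℤ) :
    Real.exp (-(b * (n : ℝ) ^ 2)) ≤ Real.exp (-b) ^ n.natAbs := by
  rw [← Real.exp_nat_mul, Real.exp_le_exp]
  have h : ((n.natAbs : ℤ) : ℝ) ≤ ((n ^ 2 : ℤ) : ℝ) := by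
    have : (n.natAbs : ℤ) ≤ n ^ 2 := by
      rw [← Int.natAbs_sq]
      exact_mod_cast Nat.le_self_pow two_ne_zero _
    exact_mod_cast this
  push_cast at h ⊢
  rw [Nat.cast_natAbs, Int.cast_abs]
  nlinarith

/-- With |n| = R + k one has n² ≥ R² + 2 R k. The two shifted powers serve the two signs of n;
keeping both makes the majorant a sum of geometric series over all integers. -/
theorem exp_neg_mul_sq_le_far {b : ℝ} (hb : 0 ≤ b) {R : ℕ} {n : ℤ} (hn : R ≤ n.natAbs) :
    Real.exp (-(b * (n : ℝ) ^ 2)) ≤ Real.exp (-(b * (R : ℝ) ^ 2)) *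
      (Real.exp (-(2 * R * b)) ^ (n - R).natAbs + Real.exp (-(2 * R * b)) ^ (n + R).natAbs) := by
  have key : ∀ k : ℤ, 0 ≤ k → (n : ℝ) ^ 2 = ((R : ℝ) + k) ^ 2 →
      Real.exp (-(b * (n : ℝ) ^ 2)) ≤
        Real.exp (-(b * (R : ℝ) ^ 2)) * Real.exp (-(2 * R * b)) ^ k.natAbs := by
    intro k hk h
    rw [← Real.exp_nat_mul, ← Real.exp_add, Real.exp_le_exp, h, Nat.cast_natAbs, Int.cast_abs,
      abs_of_nonneg (by exact_mod_cast hk)]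
    nlinarith [mul_nonneg hb (sq_nonneg (k : ℝ))]
  have hpos := fun k : ℕ => pow_nonneg (Real.exp_pos (-(2 * R * b))).le k
  rw [mul_add]
  have he := (Real.exp_pos (-(b * (R : ℝ) ^ 2))).le
  rcases le_total 0 n with h0 | h0
  · have := key (n - R) (by omega) (by push_cast; ring)
    linarith [mul_nonneg he (hpos (n + R).natAbs)]
  · have := key (-(n + R)) (by omega) (by push_cast; ring)
    rw [Int.natAbs_neg] at this
    linarith [mul_nonneg he (hpos (n - R).natAbs)]

theorem exp_neg_one_le : Real.exp (-1 : ℝ) ≤ 0.37 := by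
  rw [Real.exp_neg, inv_le_comm₀ (Real.exp_pos _) (by norm_num)]
  linarith [Real.exp_one_gt_d9]

theorem exp_neg_five_fourths_le : Real.exp (-(5 / 4) : ℝ) ≤ 0.3 := by
  have h1 : Real.exp (-(1 / 4) : ℝ) ≤ 4 / 5 := by
    rw [Real.exp_neg, inv_le_comm₀ (Real.exp_pos _) (by norm_num)]
    linarith [Real.add_one_le_exp (1 / 4 : ℝ)]
  rw [show (-(5 / 4) : ℝ) = -1 + -(1 / 4) by norm_num, Real.exp_add]
  have := mul_le_mul exp_neg_one_le h1 (Real.exp_pos _).le (by norm_num)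
  linarith

theorem hasSum_pow_natAbs_shift {r ρ : ℝ} (hr0 : 0 ≤ r) (hr1 : r < 1) (h0 : 0 ≤ ρ) (h1 : ρ < 1)
    (R : ℤ) :
    HasSum (fun p : ℤ × ℤ => (ρ ^ (p.1 - R).natAbs + ρ ^ (p.1 + R).natAbs) * r ^ p.2.natAbs)
      (2 * ((1 + ρ) / (1 - ρ)) * ((1 + r) / (1 - r))) := by
  have s1 := hasSum_pow_natAbs hr0 hr1
  have s2 := hasSum_pow_natAbs h0 h1
  have s3 : ∀ k : ℤ, HasSum (fun n : ℤ => ρ ^ (n + k).natAbs) ((1 + ρ) / (1 - ρ)) := fun k =>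
    ((Equiv.addRight k).hasSum_iff (f := fun n : ℤ => ρ ^ n.natAbs)).2 s2
  have s5 : HasSum (fun n : ℤ => ρ ^ (n - R).natAbs + ρ ^ (n + R).natAbs)
      ((1 + ρ) / (1 - ρ) + (1 + ρ) / (1 - ρ)) := (s3 (-R)).add (s3 R)
  rw [two_mul ((1 + ρ) / (1 - ρ))]
  have s6 := s5.mul s1 (s5.summable.mul_of_nonneg s1.summable
    (fun n => add_nonneg (pow_nonneg h0 _) (pow_nonneg h0 _)) (fun n => pow_nonneg hr0 _))
  exact s6

/-- A summable majorant of `exp (-b (m² + n²))` outside of a square. -/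
noncomputable def farMajorant (b : ℝ) (R : ℕ) (p : ℤ × ℤ) : ℝ :=
  Real.exp (-(b * (R : ℝ) ^ 2)) *
    ((Real.exp (-(2 * R * b)) ^ (p.1 - R).natAbs + Real.exp (-(2 * R * b)) ^ (p.1 + R).natAbs)
        * Real.exp (-b) ^ p.2.natAbs
      + (Real.exp (-(2 * R * b)) ^ (p.2 - R).natAbs + Real.exp (-(2 * R * b)) ^ (p.2 + R).natAbs)
        * Real.exp (-b) ^ p.1.natAbs)

theorem farMajorant_nonneg (b : ℝ) (R : ℕ) (p : ℤ × ℤ) : 0 ≤ farMajorant b R p := by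
  unfold farMajorant
  have h1 := fun k : ℕ => pow_nonneg (Real.exp_pos (-(2 * R * b))).le k
  have h2 := fun k : ℕ => pow_nonneg (Real.exp_pos (-b)).le k
  exact mul_nonneg (Real.exp_pos _).le (add_nonneg (mul_nonneg (add_nonneg (h1 _) (h1 _)) (h2 _))
    (mul_nonneg (add_nonneg (h1 _) (h1 _)) (h2 _)))

theorem exists_hasSum_farMajorant {b : ℝ} (hb : 5 / 4 ≤ b) {R : ℕ} (hR : 2 ≤ R) :
    ∃ s, HasSum (farMajorant b R) s ∧ s ≤ 8 * Real.exp (-(b * (R : ℝ) ^ 2)) := by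
  have hb0 : 0 ≤ b := by linarith
  have hR' : (2 : ℝ) ≤ R := by exact_mod_cast hR
  have hr0 : 0 < Real.exp (-b) := Real.exp_pos _
  have hρ0 : 0 < Real.exp (-(2 * R * b)) := Real.exp_pos _
  have hr1 : Real.exp (-b) ≤ 0.3 :=
    (Real.exp_le_exp.2 (by linarith)).trans exp_neg_five_fourths_le
  have hρ1 : Real.exp (-(2 * R * b)) ≤ 0.01 := by
    have h1 : Real.exp (-(2 * R * b)) ≤ Real.exp (-1) ^ 5 := by
      rw [← Real.exp_nat_mul, Real.exp_le_exp]; push_cast; nlinarith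
    have h2 := pow_le_pow_left₀ (Real.exp_pos _).le exp_neg_one_le 5
    norm_num at h2 ⊢
    linarith
  unfold farMajorant
  generalize Real.exp (-b) = r at *
  generalize Real.exp (-(2 * R * b)) = ρ at *
  have m1 := hasSum_pow_natAbs_shift hr0.le (by linarith) hρ0.le (by linarith) (R : ℤ)
  have m2 := (Equiv.prodComm ℤ ℤ).hasSum_iff.2 m1
  have e1 : (1 + r) / (1 - r) ≤ 1.858 := by rw [div_le_iff₀ (by linarith)]; linarith
  have e2 : (1 + ρ) / (1 - ρ) ≤ 1.0203 := by rw [div_le_iff₀ (by linarith)]; linarith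
  have e3 : (1 + ρ) / (1 - ρ) * ((1 + r) / (1 - r)) ≤ 1.0203 * 1.858 :=
    mul_le_mul e2 e1 (div_nonneg (by linarith) (by linarith)) (by norm_num)
  refine ⟨_, (m1.add m2).mul_left (Real.exp (-(b * (R : ℝ) ^ 2))), ?_⟩
  rw [mul_comm]
  exact mul_le_mul_of_nonneg_right (by linarith) (Real.exp_pos _).le

theorem exp_le_farMajorant {b : ℝ} (hb : 0 ≤ b) {R : ℕ} {p : ℤ × ℤ} (hp : p ∉ square R) :
    Real.exp (-(b * ((p.1 : ℝ) ^ 2 + (p.2 : ℝ) ^ 2))) ≤ farMajorant b R p := by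
  have a1 := exp_neg_mul_sq_le hb p.1
  have a2 := exp_neg_mul_sq_le hb p.2
  have p1 : ∀ n : ℤ, 0 ≤ Real.exp (-b) ^ n.natAbs := fun n => pow_nonneg (Real.exp_pos _).le _
  have p2 : ∀ n : ℤ, 0 ≤ Real.exp (-(b * (R : ℝ) ^ 2)) *
      (Real.exp (-(2 * R * b)) ^ (n - R).natAbs + Real.exp (-(2 * R * b)) ^ (n + R).natAbs) := fun n =>
    mul_nonneg (Real.exp_pos _).le (add_nonneg (pow_nonneg (Real.exp_pos _).le _)
      (pow_nonneg (Real.exp_pos _).le _))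
  rw [show -(b * ((p.1 : ℝ) ^ 2 + (p.2 : ℝ) ^ 2)) = -(b * (p.1 : ℝ) ^ 2) + -(b * (p.2 : ℝ) ^ 2) by ring,
    Real.exp_add, farMajorant, mul_add, ← mul_assoc, ← mul_assoc]
  rcases le_natAbs_of_notMem_square hp with h | h
  · have := mul_le_mul (exp_neg_mul_sq_le_far hb h) a2 (Real.exp_pos _).le (p2 p.1)
    exact this.trans (le_add_of_nonneg_right (mul_nonneg (p2 _) (p1 _)))
  · have := mul_le_mul (exp_neg_mul_sq_le_far hb h) a1 (Real.exp_pos _).le (p2 p.2)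
    rw [mul_comm]
    exact this.trans (le_add_of_nonneg_left (mul_nonneg (p2 _) (p1 _)))

/-- Two kinds of omitted vectors: finitely many inside the square, each charged the flat cost C, and
those outside it, charged to the Gaussian majorant. -/
theorem abs_tsum_sub_sum_le {f : ℤ × ℤ → ℝ} (hf : Summable f) {R : ℕ} (hR : 2 ≤ R) {b C C' : ℝ}
    (hb : 5 / 4 ≤ b) (hC' : 0 ≤ C') {S : Finset (ℤ × ℤ)}
    (h1 : ∀ p ∉ S, |f p| ≤ C)
    (h2 : ∀ p ∉ square R, |f p| ≤ C' * Real.exp (-(b * ((p.1 : ℝ) ^ 2 + (p.2 : ℝ) ^ 2)))) :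
    |∑' p, f p - ∑ p ∈ S, f p| ≤
      C * ((square R \ S).card : ℝ) + C' * (8 * Real.exp (-(b * (R : ℝ) ^ 2))) := by
  obtain ⟨s, hD, hs⟩ := exists_hasSum_farMajorant hb hR
  set D := farMajorant b R
  have hD0 : ∀ p, 0 ≤ D p := farMajorant_nonneg b R
  have hDle : ∀ p ∉ square R, Real.exp (-(b * ((p.1 : ℝ) ^ 2 + (p.2 : ℝ) ^ 2))) ≤ D p :=
    fun p hp => exp_le_farMajorant (by linarith) hp
  let g : ℤ × ℤ → ℝ := fun p => if p ∈ S then f p else 0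
  have hg : HasSum g (∑ p ∈ S, f p) := by
    have : HasSum g (∑ p ∈ S, g p) := hasSum_sum_of_ne_finset_zero (fun p hp => if_neg hp)
    rwa [Finset.sum_congr rfl (fun p hp => if_pos hp)] at this
  let k : ℤ × ℤ → ℝ := fun p => if p ∈ square R \ S then C else 0
  have hk : HasSum k (C * ((square R \ S).card : ℝ)) := by
    have : HasSum k (∑ p ∈ square R \ S, k p) := hasSum_sum_of_ne_finset_zero (fun p hp => if_neg hp)
    rw [Finset.sum_congr rfl (fun p hp => if_pos hp), Finset.sum_const, nsmul_eq_mul, mul_comm] at this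
    exact this
  have hsub := hf.hasSum.sub hg
  rw [← hsub.tsum_eq]
  have := tsum_of_norm_bounded (hk.add (hD.mul_left C')) (fun p => ?_) (f := fun p => f p - g p)
  · rw [Real.norm_eq_abs] at this
    refine this.trans (add_le_add le_rfl (mul_le_mul_of_nonneg_left hs hC'))
  · simp only [g, k, Real.norm_eq_abs]
    by_cases hp : p ∈ S
    · simp only [hp, if_true, sub_self, abs_zero, Finset.mem_sdiff, not_true, and_false, if_false,
        zero_add]
      exact mul_nonneg hC' (hD0 p)
    · by_cases hq : p ∈ square R
      · simp only [hp, if_false, sub_zero, Finset.mem_sdiff, hq, not_false_iff, and_self, if_true]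
        exact (h1 p hp).trans (le_add_of_nonneg_right (mul_nonneg hC' (hD0 p)))
      · simp only [hp, if_false, sub_zero, Finset.mem_sdiff, hq, false_and, zero_add]
        exact (h2 p hq).trans (mul_le_mul_of_nonneg_left (hDle p hq) hC')

/-- The vectors of norm less than `8` that dominate the sums. -/
def core : Finset (ℤ × ℤ) :=
  {(0, 0), (1, 0), (-1, 0), (0, 1), (0, -1), (1, 1), (-1, -1), (1, -1), (-1, 1), (2, 0), (-2, 0), (0, 2),
    (0, -2), (2, -1), (-2, 1), (1, -2), (-1, 2), (2, 1), (-2, -1), (1, 2), (-1, -2), (2, -2), (-2, 2)}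

theorem core_subset : core ⊆ square 4 := by decide

theorem card_square_sdiff_core : (square 4 \ core).card = 26 := by decide

/-- Each of the five cases forces (m+n)² y + (m-n)² / y ≥ 16 for 1 ≤ y ≤ √3, which is how
`eight_le_xx` uses them. -/
theorem sq_cases_of_notMem_core {p : ℤ × ℤ} (hp : p ∉ core) :
    16 ≤ (p.1 + p.2) ^ 2 ∨ (9 ≤ (p.1 + p.2) ^ 2 ∧ 9 ≤ (p.1 - p.2) ^ 2) ∨
      (4 ≤ (p.1 + p.2) ^ 2 ∧ 16 ≤ (p.1 - p.2) ^ 2) ∨ (1 ≤ (p.1 + p.2) ^ 2 ∧ 25 ≤ (p.1 - p.2) ^ 2) ∨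
      36 ≤ (p.1 - p.2) ^ 2 := by
  by_contra! h
  obtain ⟨h1, h2, h3, h4, h5⟩ := h
  obtain ⟨m, n⟩ := p
  simp only at h1 h2 h3 h4 h5
  have hk := abs_lt_of_sq_lt_sq (by linarith : (m + n) ^ 2 < 4 ^ 2) (by norm_num)
  have hl := abs_lt_of_sq_lt_sq (by linarith : (m - n) ^ 2 < 6 ^ 2) (by norm_num)
  rw [abs_lt] at hk hl
  have hm : m ∈ Finset.Icc (-4 : ℤ) 4 := Finset.mem_Icc.2 (by omega)
  have hn : n ∈ Finset.Icc (-4 : ℤ) 4 := Finset.mem_Icc.2 (by omega)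
  have key : ∀ m ∈ Finset.Icc (-4 : ℤ) 4, ∀ n ∈ Finset.Icc (-4 : ℤ) 4, (m, n) ∉ core →
      (m + n) ^ 2 < 16 → (9 ≤ (m + n) ^ 2 → (m - n) ^ 2 < 9) → (4 ≤ (m + n) ^ 2 → (m - n) ^ 2 < 16) →
      (1 ≤ (m + n) ^ 2 → (m - n) ^ 2 < 25) → ¬ (m - n) ^ 2 < 36 := by decide
  exact key m hm n hn hp h1 h2 h3 h4 h5

theorem eight_le_xx {u : ℝ} (hu : u ∈ Set.Icc 0 uHex) {p : ℤ × ℤ} (hp : p ∉ core) : 8 ≤ xx 1 u p := by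
  have h0 : 0 < Real.exp u := Real.exp_pos u
  have h1 : 1 ≤ Real.exp u := Real.one_le_exp hu.1
  have h2 : Real.exp u ≤ 1.7321 := by
    refine (Real.exp_le_exp.2 hu.2).trans ?_
    rw [exp_uHex]
    exact Real.sqrt_le_iff.2 ⟨by norm_num, by norm_num⟩
  set y := Real.exp u with hy
  have hxx : xx 1 u p = (((p.1 : ℝ) + p.2) ^ 2 * y ^ 2 + ((p.1 : ℝ) - p.2) ^ 2) / (2 * y) := by
    rw [xx, Real.exp_neg, ← hy]; field_simp
  rw [hxx, le_div_iff₀ (by positivity)]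
  set K := ((p.1 : ℝ) + p.2) ^ 2 with hK
  set L := ((p.1 : ℝ) - p.2) ^ 2 with hL
  have hK0 : 0 ≤ K := sq_nonneg _
  have hL0 : 0 ≤ L := sq_nonneg _
  have cK : ∀ a : ℕ, (a : ℤ) ≤ (p.1 + p.2) ^ 2 → (a : ℝ) ≤ K := fun a h => by rw [hK]; exact_mod_cast h
  have cL : ∀ a : ℕ, (a : ℤ) ≤ (p.1 - p.2) ^ 2 → (a : ℝ) ≤ L := fun a h => by rw [hL]; exact_mod_cast h
  have m : ∀ a : ℝ, a ≤ K → a * y ^ 2 ≤ K * y ^ 2 := fun a h =>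
    mul_le_mul_of_nonneg_right h (sq_nonneg y)
  rcases sq_cases_of_notMem_core hp with h | ⟨h, h'⟩ | ⟨h, h'⟩ | ⟨h, h'⟩ | h
  · have := m _ (cK 16 h); push_cast at this; nlinarith
  · have := m _ (cK 9 h); have := cL 9 h'; push_cast at *; nlinarith [sq_nonneg (y - 1)]
  · have := m _ (cK 4 h); have := cL 16 h'; push_cast at *; nlinarith [sq_nonneg (y - 2)]
  · have := m _ (cK 1 h); have := cL 25 h'; push_cast at *; nlinarith
  · have := cL 36 h; push_cast at *; nlinarith [mul_nonneg hK0 (sq_nonneg y)]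

theorem sq_add_sq_le_xx {u : ℝ} (hu : u ∈ Set.Icc 0 uHex) {X : ℝ} (hX : 0 ≤ X) (p : ℤ × ℤ) :
    X / 1.7321 * ((p.1 : ℝ) ^ 2 + (p.2 : ℝ) ^ 2) ≤ xx X u p := by
  refine le_trans ?_ (xx_ge (r := uHex) hX (abs_le.2 ⟨by linarith [hu.1, uHex_pos], hu.2⟩) p)
  refine mul_le_mul_of_nonneg_right ?_ (by positivity)
  rw [exp_neg_uHex]
  have h3 : √3 ≤ 1.7321 := Real.sqrt_le_iff.2 ⟨by norm_num, by norm_num⟩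
  have h4 : √3 * √3 = 3 := Real.mul_self_sqrt (by norm_num)
  rw [div_le_iff₀ (by norm_num)]
  have : 1 ≤ √3 / 3 * 1.7321 := by nlinarith [Real.sqrt_nonneg 3]
  nlinarith

/-- (x/T)^n ≤ e^{n(x-T)/T} ≤ e^{0.3(x-T)}: the power consumes three tenths of the decay beyond T and
leaves seven tenths for summation. -/
theorem pow_mul_exp_neg_le {x T : ℝ} {n : ℕ} (hT : 0 < T) (hn : (n : ℝ) ≤ 0.3 * T) (hx : T ≤ x) :
    x ^ n * Real.exp (-x) ≤ T ^ n * Real.exp (-T) * Real.exp (-(0.7 * (x - T))) := by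
  have hx0 : 0 < x := hT.trans_le hx
  have h1 : (x / T) ^ n ≤ Real.exp (0.3 * (x - T)) := by
    have h2 : x / T ≤ Real.exp (x / T - 1) := by linarith [Real.add_one_le_exp (x / T - 1)]
    refine (pow_le_pow_left₀ (by positivity) h2 n).trans ?_
    rw [← Real.exp_nat_mul, Real.exp_le_exp]
    have h3 : x / T - 1 = (x - T) / T := by field_simp
    rw [h3]
    have h4 : 0 ≤ (x - T) / T := div_nonneg (by linarith) hT.le
    calc (n : ℝ) * ((x - T) / T) ≤ 0.3 * T * ((x - T) / T) := mul_le_mul_of_nonneg_right hn h4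
      _ = 0.3 * (x - T) := by field_simp
  rw [div_pow, div_le_iff₀ (by positivity)] at h1
  calc x ^ n * Real.exp (-x) ≤ Real.exp (0.3 * (x - T)) * T ^ n * Real.exp (-x) :=
        mul_le_mul_of_nonneg_right h1 (Real.exp_pos _).le
    _ = _ := by
      rw [show Real.exp (0.3 * (x - T)) * T ^ n * Real.exp (-x)
        = T ^ n * (Real.exp (0.3 * (x - T)) * Real.exp (-x)) by ring, mul_assoc, ← Real.exp_add,
        ← Real.exp_add]
      congr 2
      ring

/-- Every omitted vector has x ≥ 8X ≥ T. The factor 27 is the 26 vectors of the 7 × 7 square outside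
`core`, plus one more unit that covers everything outside the square. -/
theorem abs_tsum_sub_core_le {f : ℝ → ℝ → ℝ} (hf : PolyBdd f) {n : ℕ} (hn : n ≤ 7) {c : ℝ} (hc : 0 ≤ c)
    (hle : ∀ x d : ℝ, 25 ≤ x → |d| ≤ x → |f x d| ≤ c * x ^ n) {T X u : ℝ} (hT : 25 ≤ T)
    (hTX : T ≤ 8 * X) (hu : u ∈ Set.Icc 0 uHex) (hX : 3.14 ≤ X) :
    |∑' p : ℤ × ℤ, f (xx X u p) (dd X u p) * Real.exp (-xx X u p)
      - ∑ p ∈ core, f (xx X u p) (dd X u p) * Real.exp (-xx X u p)|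
      ≤ 27 * c * T ^ n * Real.exp (-T) := by
  have hX0 : 0 < X := by linarith
  have hsum := summable_of_halfBdd hf.halfBdd hX0 u
  have hn' : (n : ℝ) ≤ 0.3 * T := by
    have : (n : ℝ) ≤ 7 := by exact_mod_cast hn
    linarith
  set B := c * (T ^ n * Real.exp (-T)) with hB
  have hB0 : 0 ≤ B := by positivity
  have main : ∀ p, T ≤ xx X u p → |f (xx X u p) (dd X u p) * Real.exp (-xx X u p)| ≤
      B * Real.exp (-(0.7 * (xx X u p - T))) := fun p hp => by
    rw [abs_mul, abs_of_pos (Real.exp_pos _)]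
    have h1 := hle _ _ (hT.trans hp) (abs_dd_le hX0.le u p)
    have h2 := pow_mul_exp_neg_le (by linarith) hn' hp
    calc _ ≤ c * xx X u p ^ n * Real.exp (-xx X u p) :=
          mul_le_mul_of_nonneg_right h1 (Real.exp_pos _).le
      _ = c * (xx X u p ^ n * Real.exp (-xx X u p)) := by ring
      _ ≤ c * (T ^ n * Real.exp (-T) * Real.exp (-(0.7 * (xx X u p - T)))) :=
          mul_le_mul_of_nonneg_left h2 hc
      _ = _ := by rw [hB]; ring
  have hTx : ∀ p ∉ core, T ≤ xx X u p := fun p hp => by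
    rw [xx_eq_mul]
    nlinarith [eight_le_xx hu hp]
  have e1 : Real.exp (0.7 * 8 * 3.14 - 5 / 4 * 16) ≤ 1 / 8 := by
    have h1 : Real.exp (0.7 * 8 * 3.14 - 5 / 4 * 16) ≤ Real.exp (-(5 / 4) - 1) := by
      rw [Real.exp_le_exp]; norm_num
    refine h1.trans ?_
    rw [sub_eq_add_neg, Real.exp_add]
    have := mul_le_mul exp_neg_five_fourths_le exp_neg_one_le (Real.exp_pos _).le (by norm_num)
    linarith
  have h := abs_tsum_sub_sum_le hsum (R := 4) (by norm_num) (b := 5 / 4) (C := B)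
    (C' := B * Real.exp (0.7 * 8 * 3.14)) le_rfl (by positivity) (S := core) (fun p hp => ?_)
    (fun p hp => ?_)
  · rw [card_square_sdiff_core] at h
    refine h.trans ?_
    push_cast
    have e2 : Real.exp (0.7 * 8 * 3.14) * Real.exp (-(5 / 4 * 4 ^ 2))
        = Real.exp (0.7 * 8 * 3.14 - 5 / 4 * 16) := by
      rw [← Real.exp_add]; norm_num
    have e3 : B * Real.exp (0.7 * 8 * 3.14) * (8 * Real.exp (-(5 / 4 * 4 ^ 2))) ≤ B := by
      rw [show B * Real.exp (0.7 * 8 * 3.14) * (8 * Real.exp (-(5 / 4 * 4 ^ 2)))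
        = B * (8 * (Real.exp (0.7 * 8 * 3.14) * Real.exp (-(5 / 4 * 4 ^ 2)))) by ring, e2]
      nlinarith
    have e4 : 27 * c * T ^ n * Real.exp (-T) = 27 * B := by rw [hB]; ring
    rw [e4]
    linarith
  · refine (main p (hTx p hp)).trans (mul_le_of_le_one_right hB0 (Real.exp_le_one_iff.2 ?_))
    linarith [hTx p hp]
  · have hp' : p ∉ core := fun h => hp (core_subset h)
    refine (main p (hTx p hp')).trans ?_
    rw [mul_assoc B]
    refine mul_le_mul_of_nonneg_left ?_ hB0
    rw [← Real.exp_add, Real.exp_le_exp]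
    have h1 := sq_add_sq_le_xx hu zero_le_one p
    have h2 := eight_le_xx hu hp'
    rw [xx_eq_mul]
    -- The remaining rate 0.7, the least scale 3.14 and the least eigenvalue 1/√3 combine to the
    -- rate 5/4 required by the Gaussian tail bound.
    have h3 : 1 / 1.7321 * ((p.1 : ℝ) ^ 2 + (p.2 : ℝ) ^ 2) * (0.7 * 3.14) ≥
        5 / 4 * ((p.1 : ℝ) ^ 2 + (p.2 : ℝ) ^ 2) := by
      have : 0 ≤ (p.1 : ℝ) ^ 2 + (p.2 : ℝ) ^ 2 := by positivity
      norm_num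
      nlinarith
    nlinarith

theorem abs_add_mul_le {a b a' b' D M : ℝ} (ha : |a| ≤ a') (hb : |b| ≤ b') (hD : 0 ≤ D) (hM : D ≤ M) :
    |a + D * b| ≤ a' + M * b' := by
  refine (abs_add_le _ _).trans (add_le_add ha ?_)
  rw [abs_mul, abs_of_nonneg hD]
  exact mul_le_mul hM hb (abs_nonneg _) (hD.trans hM)

/-- The constants in the bounds of `pol j` for large arguments. -/
noncomputable def polConst : ℕ → ℝ
  | 3 => 1.3
  | 4 => 1.5
  | 5 => 1.77
  | 6 => 2.16
  | _ => 1

theorem abs_pol_le {j : ℕ} (hj : 3 ≤ j) (hj' : j ≤ 6) {x d : ℝ} (hx : 25 ≤ x) (hd : |d| ≤ x) :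
    |pol j x d| ≤ polConst j * x ^ (j + 1) := by
  have hx0 : 0 ≤ x := by linarith
  have hD : d ^ 2 ≤ x ^ 2 := sq_le_sq' (by linarith [(abs_le.1 hd).1]) (abs_le.1 hd).2
  have hD0 := sq_nonneg d
  have p2 : 0 ≤ x ^ 2 := by positivity
  have p3 : 0 ≤ x ^ 3 := by positivity
  have p4 : 0 ≤ x ^ 4 := by positivity
  -- After all signs are made positive and d² is replaced by x², each difference of bounds is a
  -- polynomial in t with nonnegative coefficients.
  obtain ⟨t, ht, rfl⟩ : ∃ t, 0 ≤ t ∧ x = 25 + t := ⟨x - 25, by linarith, by ring⟩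
  set x := 25 + t with hxt
  interval_cases j
  · have b0 : |2 - 10 * x + 3 * x ^ 2| ≤ 2 + 10 * x + 3 * x ^ 2 := abs_le.2 (by constructor <;> linarith)
    have b1 : |4 - x| ≤ 4 + x := abs_le.2 (by constructor <;> linarith)
    have h := mul_le_mul hd (abs_add_mul_le b0 b1 hD0 hD) (abs_nonneg _) hx0
    rw [← abs_mul] at h
    refine h.trans (sub_nonneg.1 ?_)
    rw [polConst, hxt]
    ring_nf
    positivity
  · have b0 : |2 * x - 10 * x ^ 2 + 3 * x ^ 3| ≤ 2 * x + 10 * x ^ 2 + 3 * x ^ 3 :=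
      abs_le.2 (by constructor <;> linarith)
    have b1 : |-12 + 28 * x - 6 * x ^ 2| ≤ 12 + 28 * x + 6 * x ^ 2 := abs_le.2 (by constructor <;> linarith)
    have b2 : |x - 5| ≤ x + 5 := abs_le.2 (by constructor <;> linarith)
    refine (abs_add_mul_le b0 (abs_add_mul_le b1 b2 hD0 hD) hD0 hD).trans (sub_nonneg.1 ?_)
    rw [polConst, hxt]
    ring_nf
    positivity
  · have b0 : |2 - 46 * x + 75 * x ^ 2 - 15 * x ^ 3| ≤ 2 + 46 * x + 75 * x ^ 2 + 15 * x ^ 3 :=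
      abs_le.2 (by constructor <;> linarith)
    have b1 : |40 - 60 * x + 10 * x ^ 2| ≤ 40 + 60 * x + 10 * x ^ 2 := abs_le.2 (by constructor <;> linarith)
    have b2 : |6 - x| ≤ 6 + x := abs_le.2 (by constructor <;> linarith)
    have h := mul_le_mul hd (abs_add_mul_le b0 (abs_add_mul_le b1 b2 hD0 hD) hD0 hD) (abs_nonneg _) hx0
    rw [← abs_mul] at h
    refine h.trans (sub_nonneg.1 ?_)
    rw [polConst, hxt]
    ring_nf
    positivity
  · have b0 : |2 * x - 46 * x ^ 2 + 75 * x ^ 3 - 15 * x ^ 4|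
        ≤ 2 * x + 46 * x ^ 2 + 75 * x ^ 3 + 15 * x ^ 4 := abs_le.2 (by constructor <;> linarith)
    have b1 : |-48 + 316 * x - 300 * x ^ 2 + 45 * x ^ 3| ≤ 48 + 316 * x + 300 * x ^ 2 + 45 * x ^ 3 :=
      abs_le.2 (by constructor <;> linarith)
    have b2 : |-100 + 110 * x - 15 * x ^ 2| ≤ 100 + 110 * x + 15 * x ^ 2 :=
      abs_le.2 (by constructor <;> linarith)
    have b3 : |x - 7| ≤ x + 7 := abs_le.2 (by constructor <;> linarith)
    refine (abs_add_mul_le b0 (abs_add_mul_le b1 (abs_add_mul_le b2 b3 hD0 hD) hD0 hD) hD0 hD).trans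
      (sub_nonneg.1 ?_)
    rw [polConst, hxt]
    ring_nf
    positivity

theorem abs_G_sub_core_le {j : ℕ} (hj : 3 ≤ j) (hj' : j ≤ 6) {T X u : ℝ} (hT : 25 ≤ T)
    (hTX : T ≤ 8 * X) (hu : u ∈ Set.Icc 0 uHex) (hX : 3.14 ≤ X) :
    |G j X u - ∑ p ∈ core, pol j (xx X u p) (dd X u p) * Real.exp (-xx X u p)|
      ≤ 27 * polConst j * T ^ (j + 1) * Real.exp (-T) :=
  abs_tsum_sub_core_le (polyBdd_pol j) (by omega)
    (by interval_cases j <;> norm_num [polConst]) (fun x d hx hd => abs_pol_le hj hj' hx hd) hT hTX hu hX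

/-! ### Verified evaluation of the dominating part of the sums -/

namespace Aff

/-- Enclosure of `pol j x d`, given enclosures of `x`, `d` and `d²`. -/
def pol (j : ℕ) (x d D : Aff) : Aff :=
  match j with
  | 3 => d.mul (((((x.smul 3).addC (-10)).mul x).addC 2).add (D.mul (x.neg.addC 4)))
  | 4 => (((((x.smul 3).addC (-10)).mul x).addC 2).mul x).add
      (D.mul (((((x.smul (-6)).addC 28).mul x).addC (-12)).add (D.mul (x.addC (-5)))))
  | 5 => d.mul (((((((x.smul (-15)).addC 75).mul x).addC (-46)).mul x).addC 2).add
      (D.mul (((((x.smul 10).addC (-60)).mul x).addC 40).add (D.mul (x.neg.addC 6)))))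
  -- The default branch is j = 6, the only index left under 3 ≤ j ≤ 6.
  | _ => (((((((x.smul (-15)).addC 75).mul x).addC (-46)).mul x).addC 2).mul x).add
      (D.mul (((((((x.smul 45).addC (-300)).mul x).addC 316).mul x).addC (-48)).add
        (D.mul (((((x.smul (-15)).addC 110).mul x).addC (-100)).add (D.mul (x.addC (-7)))))))

/-- Enclosure of `pol j x x`. -/
def polDiag (j : ℕ) (x : Aff) : Aff :=
  match j with
  | 3 => ((((((x.neg.addC 7).mul x).addC (-10)).mul x).addC 2).mul x)
  | 4 => ((((((((x.addC (-11)).mul x).addC 31).mul x).addC (-22)).mul x).addC 2).mul x)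
  | 5 => ((((((((((x.neg.addC 16).mul x).addC (-75)).mul x).addC 115).mul x).addC (-46)).mul x).addC
      2).mul x)
  | _ => ((((((((((((x.addC (-22)).mul x).addC 155).mul x).addC (-415)).mul x).addC 391).mul
      x).addC (-94)).mul x).addC 2).mul x)

/-- Enclosure of the sum of the terms of `core`, given enclosures of `X / 2` and `e^u`. -/
def coreSum (j : ℕ) (H y : Aff) : Aff :=
  -- A vector with k = (m+n)² and l = (m-n)² has x = kP + lQ and d = kP - lQ, so every weight is a
  -- monomial in e^{-P} and e^{-Q}. Classes with k and l nonzero have four members; those on an axis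
  -- have two, with d = ±x, whence the sign (-1)^j.
  let P := H.mul y
  let Q := H.mul y.inv
  let A := P.neg.exp
  let B := Q.neg.exp
  let A2 := A.mul A
  let B2 := B.mul B
  let A4 := A2.mul A2
  let B4 := B2.mul B2
  let A8 := A4.mul A4
  let B8 := B4.mul B4
  let AB := A.mul B
  let term : ℤ → ℤ → Aff → Aff := fun k l W =>
    let d := (P.smul k).sub (Q.smul l)
    ((pol j ((P.smul k).add (Q.smul l)) d (d.mul d)).mul W).smul 4
  let diag : Aff → Aff → ℤ → Aff := fun x W s => ((polDiag j x).mul W).smul (2 * s)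
  ((((((term 1 1 AB).add (diag (P.smul 4) A4 1)).add (diag (Q.smul 4) B4 ((-1) ^ j))).add
    (term 4 4 (A4.mul B4))).add (term 1 9 (AB.mul B8))).add (term 9 1 (AB.mul A8))).add
      (diag (Q.smul 16) (B8.mul B8) ((-1) ^ j))

variable {F G x d D : Aff} {s t f g a b : ℝ}

theorem Has.congr (h : F.Has s t f) (e : f = g) : F.Has s t g := e ▸ h

theorem Has.pol {j : ℕ} (hj : 3 ≤ j) (hj' : j ≤ 6) (hx : x.Has s t a) (hd : d.Has s t b)
    (hD : D.Has s t (b * b)) : (Aff.pol j x d D).Has s t (LatticePhase.pol j a b) := by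
  interval_cases j
  · exact (hd.mul (((((hx.smul 3).addC (-10)).mul hx).addC 2).add (hD.mul (hx.neg.addC 4)))).congr
      (by simp only [LatticePhase.pol]; push_cast; ring)
  · exact ((((((hx.smul 3).addC (-10)).mul hx).addC 2).mul hx).add
      (hD.mul (((((hx.smul (-6)).addC 28).mul hx).addC (-12)).add (hD.mul (hx.addC (-5)))))).congr
      (by simp only [LatticePhase.pol]; push_cast; ring)
  · exact (hd.mul (((((((hx.smul (-15)).addC 75).mul hx).addC (-46)).mul hx).addC 2).add
      (hD.mul (((((hx.smul 10).addC (-60)).mul hx).addC 40).add (hD.mul (hx.neg.addC 6)))))).congr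
      (by simp only [LatticePhase.pol]; push_cast; ring)
  · exact ((((((((hx.smul (-15)).addC 75).mul hx).addC (-46)).mul hx).addC 2).mul hx).add
      (hD.mul (((((((hx.smul 45).addC (-300)).mul hx).addC 316).mul hx).addC (-48)).add
        (hD.mul (((((hx.smul (-15)).addC 110).mul hx).addC (-100)).add
          (hD.mul (hx.addC (-7)))))))).congr
      (by simp only [LatticePhase.pol]; push_cast; ring)

theorem Has.polDiag {j : ℕ} (hj : 3 ≤ j) (hj' : j ≤ 6) (hx : x.Has s t a) :
    (Aff.polDiag j x).Has s t (LatticePhase.pol j a a) := by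
  interval_cases j
  · exact ((((((hx.neg.addC 7).mul hx).addC (-10)).mul hx).addC 2).mul hx).congr
      (by simp only [LatticePhase.pol]; push_cast; ring)
  · exact ((((((((hx.addC (-11)).mul hx).addC 31).mul hx).addC (-22)).mul hx).addC 2).mul hx).congr
      (by simp only [LatticePhase.pol]; push_cast; ring)
  · exact ((((((((((hx.neg.addC 16).mul hx).addC (-75)).mul hx).addC 115).mul hx).addC (-46)).mul
      hx).addC 2).mul hx).congr (by simp only [LatticePhase.pol]; push_cast; ring)
  · exact ((((((((((((hx.addC (-22)).mul hx).addC 155).mul hx).addC (-415)).mul hx).addC 391).mul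
      hx).addC (-94)).mul hx).addC 2).mul hx).congr (by simp only [LatticePhase.pol]; push_cast; ring)

end Aff

theorem pol_diag_neg {j : ℕ} (hj : 3 ≤ j) (hj' : j ≤ 6) (x : ℝ) :
    pol j x (-x) = (((-1) ^ j : ℤ) : ℝ) * pol j x x := by
  interval_cases j <;> simp only [pol] <;> push_cast <;> ring

theorem sum_core (F : ℝ → ℝ → ℝ) :
    ∑ p ∈ core, F (((p.1 : ℝ) + p.2) ^ 2) (((p.1 : ℝ) - p.2) ^ 2)
      = F 0 0 + 4 * F 1 1 + 2 * F 4 0 + 2 * F 0 4 + 4 * F 4 4 + 4 * F 1 9 + 4 * F 9 1 + 2 * F 0 16 := by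
  rw [core]
  repeat rw [Finset.sum_insert (by decide)]
  rw [Finset.sum_singleton]
  norm_num
  ring

/-- The sum over `core` in terms of `H = X / 2` and `y = e^u`. -/
noncomputable def coreReal (j : ℕ) (H y : ℝ) : ℝ :=
  ∑ p ∈ core, pol j (H * y * ((p.1 : ℝ) + p.2) ^ 2 + H * (1 / y) * ((p.1 : ℝ) - p.2) ^ 2)
    (H * y * ((p.1 : ℝ) + p.2) ^ 2 - H * (1 / y) * ((p.1 : ℝ) - p.2) ^ 2)
      * Real.exp (-(H * y * ((p.1 : ℝ) + p.2) ^ 2 + H * (1 / y) * ((p.1 : ℝ) - p.2) ^ 2))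

theorem sum_core_eq_coreReal (j : ℕ) (X u : ℝ) :
    ∑ p ∈ core, pol j (xx X u p) (dd X u p) * Real.exp (-xx X u p) = coreReal j (X / 2) (Real.exp u) := by
  refine Finset.sum_congr rfl fun p _ => ?_
  have h1 : xx X u p = X / 2 * Real.exp u * ((p.1 : ℝ) + p.2) ^ 2
      + X / 2 * (1 / Real.exp u) * ((p.1 : ℝ) - p.2) ^ 2 := by
    rw [xx, Real.exp_neg]; ring
  have h2 : dd X u p = X / 2 * Real.exp u * ((p.1 : ℝ) + p.2) ^ 2
      - X / 2 * (1 / Real.exp u) * ((p.1 : ℝ) - p.2) ^ 2 := by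
    rw [dd, Real.exp_neg]; ring
  rw [h1, h2]

theorem Aff.Has.coreSum {j : ℕ} (hj : 3 ≤ j) (hj' : j ≤ 6) {FH Fy : Aff} {s t H y : ℝ}
    (hH : FH.Has s t H) (hy : Fy.Has s t y) (h1 : 1 ≤ y) :
    (Aff.coreSum j FH Fy).Has s t (coreReal j H y) := by
  have hP := hH.mul hy
  have hQ := hH.mul (hy.inv h1)
  set P := H * y
  set Q := H * (1 / y)
  have hA := hP.neg.exp
  have hB := hQ.neg.exp
  have hA2 := hA.mul hA
  have hB2 := hB.mul hB
  have hA4 := hA2.mul hA2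
  have hB4 := hB2.mul hB2
  have hA8 := hA4.mul hA4
  have hB8 := hB4.mul hB4
  have hAB := hA.mul hB
  have term : ∀ (k l : ℤ) (W : Aff) (w : ℝ), W.Has s t w → w = Real.exp (-(P * k + Q * l)) →
      (((Aff.pol j (((FH.mul Fy).smul k).add ((FH.mul Fy.inv).smul l))
        (((FH.mul Fy).smul k).sub ((FH.mul Fy.inv).smul l))
        ((((FH.mul Fy).smul k).sub ((FH.mul Fy.inv).smul l)).mul
          (((FH.mul Fy).smul k).sub ((FH.mul Fy.inv).smul l)))).mul W).smul 4).Has s t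
        (4 * (LatticePhase.pol j (P * k + Q * l) (P * k - Q * l) * Real.exp (-(P * k + Q * l)))) := by
    intro k l W w hW hw
    have hd := (hP.smul k).sub (hQ.smul l)
    have := (((Aff.Has.pol hj hj' ((hP.smul k).add (hQ.smul l)) hd (hd.mul hd)).mul hW).smul 4)
    refine this.congr ?_
    rw [hw, mul_comm P, mul_comm Q]
    push_cast
    ring
  have diag : ∀ (F W : Aff) (x w : ℝ) (c : ℤ), F.Has s t x → W.Has s t w → w = Real.exp (-x) →
      (((Aff.polDiag j F).mul W).smul (2 * c)).Has s t (2 * (c * LatticePhase.pol j x x * Real.exp (-x))) := by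
    intro F W x w c hF hW hw
    refine (((hF.polDiag hj hj').mul hW).smul (2 * c)).congr ?_
    rw [hw]
    push_cast
    ring
  have p2 : ∀ x : ℝ, Real.exp x * Real.exp x = Real.exp (2 * x) := fun x => by
    rw [← Real.exp_add]; ring_nf
  have h11 := term 1 1 _ _ hAB (by rw [← Real.exp_add]; congr 1; push_cast; ring)
  have h40 := diag _ _ _ _ 1 (hP.smul 4) hA4 (by rw [p2, p2]; congr 1; push_cast; ring)
  have h04 := diag _ _ _ _ ((-1) ^ j) (hQ.smul 4) hB4 (by rw [p2, p2]; congr 1; push_cast; ring)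
  have h44 := term 4 4 _ _ (hA4.mul hB4)
    (by rw [p2, p2, p2, p2, ← Real.exp_add]; congr 1; push_cast; ring)
  have h19 := term 1 9 _ _ (hAB.mul hB8)
    (by rw [p2, p2, p2, ← Real.exp_add, ← Real.exp_add]; congr 1; push_cast; ring)
  have h91 := term 9 1 _ _ (hAB.mul hA8)
    (by rw [p2, p2, p2, ← Real.exp_add, ← Real.exp_add]; congr 1; push_cast; ring)
  have h016 := diag _ _ _ _ ((-1) ^ j) (hQ.smul 16) (hB8.mul hB8)
    (by rw [p2, p2, p2, p2]; congr 1; push_cast; ring)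
  refine ((((((h11.add h40).add h04).add h44).add h19).add h91).add h016).congr ?_
  have hs := sum_core fun K L => LatticePhase.pol j (P * K + Q * L) (P * K - Q * L)
    * Real.exp (-(P * K + Q * L))
  have h0 : LatticePhase.pol j 0 0 = 0 := by interval_cases j <;> simp [LatticePhase.pol]
  have e04 := pol_diag_neg hj hj' (Q * 4)
  have e016 := pol_diag_neg hj hj' (Q * 16)
  rw [coreReal]
  refine Eq.trans ?_ hs.symm
  simp only [mul_zero, zero_add, add_zero, sub_zero, zero_sub, neg_zero, h0, zero_mul]
  rw [e04, e016]
  push_cast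
  simp only [mul_one, one_mul, mul_comm (4 : ℝ) P, mul_comm (4 : ℝ) Q, mul_comm (16 : ℝ) Q]

/-- Binary subdivisions of a rectangle. -/
inductive Grid
  | leaf
  | left (l r : Grid)
  | right (l r : Grid)

/-- Checks that the sum over `core`, multiplied by `σ`, is less than `-r / 2 ^ 64` on the rectangle with
centre `(h, y) / 2 ^ 20` and half sides `(dh, dy) / 2 ^ 20`. -/
def Grid.check (j : ℕ) (σ : ℤ) (r : ℕ) : Grid → ℤ → ℕ → ℤ → ℕ → Bool
  | leaf, h, dh, y, dy =>
    let F := (Aff.coreSum j ⟨h * 17592186044416, dh * 17592186044416, 0, 0⟩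
      ⟨y * 17592186044416, 0, dy * 17592186044416, 0⟩).smul σ
    decide (F.c + (F.a.natAbs + F.b.natAbs + F.e + r : ℕ) < 0)
  | left a b, h, dh, y, dy =>
    -- Half sides are rounded up, so the two pieces still cover the interval when its half side is
    -- odd.
    a.check j σ r (h - ((dh + 1) / 2 : ℕ)) ((dh + 1) / 2) y dy &&
      b.check j σ r (h + ((dh + 1) / 2 : ℕ)) ((dh + 1) / 2) y dy
  | right a b, h, dh, y, dy =>
    a.check j σ r h dh (y - ((dy + 1) / 2 : ℕ)) ((dy + 1) / 2) &&
      b.check j σ r h dh (y + ((dy + 1) / 2 : ℕ)) ((dy + 1) / 2)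

theorem exists_param_of_abs_le {x c : ℝ} {d : ℕ} (h : |x - c| ≤ d) :
    ∃ s : ℝ, |s| ≤ 1 ∧ x = c + d * s := by
  rcases Nat.eq_zero_or_pos d with rfl | hd
  · refine ⟨0, by simp, ?_⟩
    have : x - c = 0 := abs_nonpos_iff.1 (by simpa using h)
    simp; linarith
  · have hd' : (0 : ℝ) < d := by exact_mod_cast hd
    refine ⟨(x - c) / d, ?_, by field_simp; ring⟩
    rw [abs_div, abs_of_pos hd', div_le_one hd']
    exact h

theorem abs_split {x c : ℝ} {d : ℕ} (h : |x - c| ≤ d) :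
    |x - (c - ((d + 1) / 2 : ℕ))| ≤ ((d + 1) / 2 : ℕ) ∨ |x - (c + ((d + 1) / 2 : ℕ))| ≤ ((d + 1) / 2 : ℕ) := by
  have h2 : (d : ℝ) ≤ 2 * ((d + 1) / 2 : ℕ) := by
    have : d ≤ 2 * ((d + 1) / 2) := by omega
    exact_mod_cast this
  rw [abs_le] at h
  rcases le_total x c with hx | hx
  · left; rw [abs_le]; constructor <;> linarith
  · right; rw [abs_le]; constructor <;> linarith

theorem Grid.check_sound {j : ℕ} (hj : 3 ≤ j) (hj' : j ≤ 6) {σ : ℤ} {r : ℕ} (g : Grid) {h y : ℤ}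
    {dh dy : ℕ} (hc : g.check j σ r h dh y dy = true) {H Y : ℝ} (hH : |H * 2 ^ 20 - h| ≤ ((dh : ℕ) : ℝ))
    (hY : |Y * 2 ^ 20 - y| ≤ ((dy : ℕ) : ℝ)) (h1 : 1 ≤ Y) : σ * coreReal j H Y < -(r / 2 ^ 64) := by
  induction g generalizing h y dh dy with
  | leaf =>
    obtain ⟨s, hs, es⟩ := exists_param_of_abs_le hH
    obtain ⟨t, ht, et⟩ := exists_param_of_abs_le hY
    have a1 : (Aff.mk (h * 17592186044416) (dh * 17592186044416) 0 0).Has s t H := by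
      refine ⟨hs, ht, ?_⟩
      push_cast
      rw [show H * 2 ^ 64 - (h * 17592186044416 + dh * 17592186044416 * s + 0 * t)
        = (H * 2 ^ 20 - (h + dh * s)) * 2 ^ 44 by ring, es]
      simp
    have a2 : (Aff.mk (y * 17592186044416) 0 (dy * 17592186044416) 0).Has s t Y := by
      refine ⟨hs, ht, ?_⟩
      push_cast
      rw [show Y * 2 ^ 64 - (y * 17592186044416 + 0 * s + dy * 17592186044416 * t)
        = (Y * 2 ^ 20 - (y + dy * t)) * 2 ^ 44 by ring, et]
      simp
    have a3 := (Aff.Has.coreSum hj hj' a1 a2 h1).smul σ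
    simp only [Grid.check, decide_eq_true_eq] at hc
    set F := (Aff.coreSum j ⟨h * 17592186044416, dh * 17592186044416, 0, 0⟩
      ⟨y * 17592186044416, 0, dy * 17592186044416, 0⟩).smul σ
    have hc' : ((F.c + ((F.a.natAbs + F.b.natAbs + F.e + r : ℕ) : ℤ) : ℤ) : ℝ) < 0 := by exact_mod_cast hc
    have hl := abs_le.1 (Aff.abs_lin_le F.a F.b hs ht)
    have he := abs_le.1 a3.le
    rw [Int.cast_add, Int.cast_natCast] at hc'
    simp only [Nat.cast_add] at hc' hl
    have : σ * coreReal j H Y * 2 ^ 64 < -r := by linarith [hl.2, he.2]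
    rw [← neg_div, lt_div_iff₀ (by positivity)]
    exact this
  | left a b iha ihb =>
    simp only [Grid.check, Bool.and_eq_true] at hc
    rcases abs_split hH with h' | h'
    · exact iha hc.1 (by push_cast at h' ⊢; exact h') hY
    · exact ihb hc.2 (by push_cast at h' ⊢; exact h') hY
  | right a b iha ihb =>
    simp only [Grid.check, Bool.and_eq_true] at hc
    rcases abs_split hY with h' | h'
    · exact iha hc.1 hH (by push_cast at h' ⊢; exact h')
    · exact ihb hc.2 hH (by push_cast at h' ⊢; exact h')

theorem exp_neg_nat_le (T : ℕ) : Real.exp (-(T : ℝ)) ≤ (1 / 2.7182818283) ^ T := by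
  have h : Real.exp (-(T : ℝ)) = Real.exp (-1) ^ T := by rw [← Real.exp_nat_mul]; ring_nf
  rw [h]
  refine pow_le_pow_left₀ (Real.exp_pos _).le ?_ T
  rw [Real.exp_neg, one_div]
  exact inv_anti₀ (by norm_num) Real.exp_one_gt_d9.le

/-- r is the tail bound in units of 2^{-64}, so a negative finite sum with margin r gives the sign
of the full series. T is an integer because e^{-T} is bounded by a power of a rational. -/
theorem sign_of_check {j : ℕ} (hj : 3 ≤ j) (hj' : j ≤ 6) {σ : ℤ} (hσ : |σ| = 1) {r : ℕ} {g : Grid} {h y : ℤ}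
    {dh dy : ℕ} (hc : g.check j σ r h dh y dy = true) {T : ℕ} (hT : 25 ≤ T)
    (hr : 27 * polConst j * (T : ℝ) ^ (j + 1) * (1 / 2.7182818283) ^ T ≤ r / 2 ^ 64)
    {X u : ℝ} (hX : 3.14 ≤ X) (hTX : (T : ℝ) ≤ 8 * X) (hu : u ∈ Set.Icc 0 uHex)
    (hH : |X / 2 * 2 ^ 20 - h| ≤ ((dh : ℕ) : ℝ)) (hY : |Real.exp u * 2 ^ 20 - y| ≤ ((dy : ℕ) : ℝ)) : σ * G j X u < 0 := by
  have h1 := g.check_sound hj hj' hc hH hY (Real.one_le_exp hu.1)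
  have h2 := abs_G_sub_core_le hj hj' (T := T) (by exact_mod_cast hT) hTX hu hX
  rw [sum_core_eq_coreReal] at h2
  have h3 : 27 * polConst j * (T : ℝ) ^ (j + 1) * Real.exp (-T) ≤ r / 2 ^ 64 := by
    refine le_trans (mul_le_mul_of_nonneg_left (exp_neg_nat_le T) ?_) hr
    have : 0 ≤ polConst j := by interval_cases j <;> norm_num [polConst]
    positivity
  have h4 : |(σ : ℝ)| = 1 := by exact_mod_cast hσ
  have h5 : |(σ : ℝ) * (G j X u - coreReal j (X / 2) (Real.exp u))| ≤ r / 2 ^ 64 := by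
    rw [abs_mul, h4, one_mul]; exact h2.trans h3
  have := (abs_le.1 h5).2
  rw [mul_sub] at this
  linarith

/-! ### Signs of the derivatives -/

theorem sign_of_check_range {j : ℕ} (hj : 3 ≤ j) (hj' : j ≤ 6) {σ : ℤ} (hσ : |σ| = 1) {r : ℕ} {g : Grid}
    {h y : ℤ} {dh dy : ℕ} (hc : g.check j σ r h dh y dy = true) {T : ℕ} (hT : 25 ≤ T)
    (hr : 27 * polConst j * (T : ℝ) ^ (j + 1) * (1 / 2.7182818283) ^ T ≤ r / 2 ^ 64)
    {x₀ x₁ y₀ y₁ : ℝ} (hx : 3.14 ≤ x₀ ∧ (T : ℝ) ≤ 8 * x₀ ∧ ((h : ℝ) - dh) ≤ x₀ / 2 * 2 ^ 20 ∧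
      x₁ / 2 * 2 ^ 20 ≤ h + dh ∧ ((y : ℝ) - dy) ≤ y₀ * 2 ^ 20 ∧ y₁ * 2 ^ 20 ≤ y + dy)
    {X u : ℝ} (h0 : x₀ ≤ X) (h1 : X ≤ x₁) (hu : u ∈ Set.Icc 0 uHex) (h2 : y₀ ≤ Real.exp u)
    (h3 : Real.exp u ≤ y₁) : σ * G j X u < 0 := by
  obtain ⟨k1, k2, k3, k4, k5, k6⟩ := hx
  refine sign_of_check hj hj' hσ hc hT hr (k1.trans h0) (by linarith) hu ?_ ?_
  · rw [abs_le]; constructor <;> linarith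
  · rw [abs_le]; constructor <;> linarith

theorem G_four_neg_of_le_3_268_exp_le_1_28 {X u : ℝ} (h0 : 3.1415 ≤ X) (h1 : X ≤ 3.268) (hu : u ∈ Set.Icc 0 uHex)
    (h2 : 1 ≤ Real.exp u) (h3 : Real.exp u ≤ 1.28) : ((1 : ℤ) : ℝ) * G 4 X u < 0 :=
  sign_of_check_range (r := 110000000000000000) (T := 25) (h := 1680212) (dh := 33162) (y := 1195377) (dy := 146801)
    (g := .right (.right (.right .leaf .leaf) (.right .leaf .leaf)) (.right (.right .leaf .leaf) (.right .leaf .leaf))) (by decide) (by decide)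
    (by decide) (by decide +kernel) (by decide) (by norm_num [polConst]) (by norm_num) h0 h1 hu h2 h3

theorem G_three_neg_of_le_3_268_hex {X u : ℝ} (h0 : 3.1415 ≤ X) (h1 : X ≤ 3.268) (hu : u ∈ Set.Icc 0 uHex)
    (h2 : 1.28 ≤ Real.exp u) (h3 : Real.exp u ≤ 1.7320509) : ((1 : ℤ) : ℝ) * G 3 X u < 0 :=
  sign_of_check_range (r := 3700000000000000) (T := 25) (h := 1680212) (dh := 33162) (y := 1579182) (dy := 237006)
    (g := .right (.right (.right .leaf .leaf) (.right .leaf .leaf)) (.right .leaf .leaf)) (by decide) (by decide)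
    (by decide) (by decide +kernel) (by decide) (by norm_num [polConst]) (by norm_num) h0 h1 hu h2 h3

theorem G_four_neg_of_le_3_35_hex {X u : ℝ} (h0 : 3.268 ≤ X) (h1 : X ≤ 3.35) (hu : u ∈ Set.Icc 0 uHex)
    (h2 : 1 ≤ Real.exp u) (h3 : Real.exp u ≤ 1.7320509) : ((1 : ℤ) : ℝ) * G 4 X u < 0 :=
  sign_of_check_range (r := 47000000000000000) (T := 26) (h := 1734869) (dh := 21496) (y := 1432381) (dy := 383807)
    (g := .right (.right (.right (.right (.right .leaf .leaf) (.right .leaf .leaf)) (.right (.right .leaf .leaf) (.right .leaf .leaf))) (.right (.right (.right .leaf .leaf) (.right .leaf .leaf)) (.right (.right .leaf .leaf) (.right .leaf .leaf)))) (.right (.right (.right .leaf .leaf) (.right .leaf (.right .leaf .leaf))) (.right (.right (.right .leaf .leaf) (.right .leaf .leaf)) (.right (.right (.right .leaf .leaf) (.right .leaf .leaf)) (.left (.right .leaf (.right .leaf .leaf)) .leaf))))) (by decide) (by decide)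
    (by decide) (by decide +kernel) (by decide) (by norm_num [polConst]) (by norm_num) h0 h1 hu h2 h3

theorem G_six_neg_of_le_3_393_exp_le_1_08 {X u : ℝ} (h0 : 3.35 ≤ X) (h1 : X ≤ 3.393) (hu : u ∈ Set.Icc 0 uHex)
    (h2 : 1 ≤ Real.exp u) (h3 : Real.exp u ≤ 1.08) : ((1 : ℤ) : ℝ) * G 6 X u < 0 :=
  sign_of_check_range (r := 46000000000000000000) (T := 26) (h := 1767637) (dh := 11273) (y := 1090519) (dy := 41944)
    (g := .right (.right .leaf .leaf) (.right .leaf .leaf)) (by decide) (by decide)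
    (by decide) (by decide +kernel) (by decide) (by norm_num [polConst]) (by norm_num) h0 h1 hu h2 h3

theorem G_five_neg_of_le_3_393_exp_le_1_28 {X u : ℝ} (h0 : 3.35 ≤ X) (h1 : X ≤ 3.393) (hu : u ∈ Set.Icc 0 uHex)
    (h2 : 1.08 ≤ Real.exp u) (h3 : Real.exp u ≤ 1.28) : ((1 : ℤ) : ℝ) * G 5 X u < 0 :=
  sign_of_check_range (r := 1500000000000000000) (T := 26) (h := 1767637) (dh := 11273) (y := 1237320) (dy := 104858)
    (g := .right (.right (.right (.right .leaf .leaf) (.right .leaf .leaf)) (.right .leaf .leaf)) (.right (.right .leaf .leaf) (.right .leaf .leaf))) (by decide) (by decide)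
    (by decide) (by decide +kernel) (by decide) (by norm_num [polConst]) (by norm_num) h0 h1 hu h2 h3

theorem G_four_neg_of_le_3_393_hex {X u : ℝ} (h0 : 3.35 ≤ X) (h1 : X ≤ 3.393) (hu : u ∈ Set.Icc 0 uHex)
    (h2 : 1.28 ≤ Real.exp u) (h3 : Real.exp u ≤ 1.7320509) : ((1 : ℤ) : ℝ) * G 4 X u < 0 :=
  sign_of_check_range (r := 47000000000000000) (T := 26) (h := 1767637) (dh := 11273) (y := 1579182) (dy := 237006)
    (g := .right (.right (.right (.right .leaf .leaf) (.right .leaf .leaf)) (.right .leaf .leaf)) (.right (.right .leaf .leaf) (.right .leaf .leaf))) (by decide) (by decide)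
    (by decide) (by decide +kernel) (by decide) (by norm_num [polConst]) (by norm_num) h0 h1 hu h2 h3

theorem G_six_neg_of_le_3_519_exp_le_1_1 {X u : ℝ} (h0 : 3.393 ≤ X) (h1 : X ≤ 3.519) (hu : u ∈ Set.Icc 0 uHex)
    (h2 : 1 ≤ Real.exp u) (h3 : Real.exp u ≤ 1.1) : ((1 : ℤ) : ℝ) * G 6 X u < 0 :=
  sign_of_check_range (r := 46000000000000000000) (T := 26) (h := 1811939) (dh := 33031) (y := 1101005) (dy := 52429)
    (g := .right (.right (.right .leaf .leaf) (.right .leaf .leaf)) (.right (.right .leaf .leaf) (.right .leaf .leaf))) (by decide) (by decide)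
    (by decide) (by decide +kernel) (by decide) (by norm_num [polConst]) (by norm_num) h0 h1 hu h2 h3

theorem G_five_neg_of_le_3_519_exp_le_1_42 {X u : ℝ} (h0 : 3.393 ≤ X) (h1 : X ≤ 3.519) (hu : u ∈ Set.Icc 0 uHex)
    (h2 : 1.1 ≤ Real.exp u) (h3 : Real.exp u ≤ 1.42) : ((1 : ℤ) : ℝ) * G 5 X u < 0 :=
  sign_of_check_range (r := 1500000000000000000) (T := 26) (h := 1811939) (dh := 33031) (y := 1321205) (dy := 167773)
    (g := .right (.right (.right (.right (.right .leaf .leaf) (.right .leaf .leaf)) (.right .leaf .leaf)) (.right (.right .leaf .leaf) (.right .leaf .leaf))) (.right (.right (.right .leaf .leaf) (.right .leaf .leaf)) (.right (.right .leaf .leaf) (.right .leaf .leaf)))) (by decide) (by decide)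
    (by decide) (by decide +kernel) (by decide) (by norm_num [polConst]) (by norm_num) h0 h1 hu h2 h3

theorem G_four_neg_of_le_3_519_hex {X u : ℝ} (h0 : 3.393 ≤ X) (h1 : X ≤ 3.519) (hu : u ∈ Set.Icc 0 uHex)
    (h2 : 1.42 ≤ Real.exp u) (h3 : Real.exp u ≤ 1.7320509) : ((1 : ℤ) : ℝ) * G 4 X u < 0 :=
  sign_of_check_range (r := 47000000000000000) (T := 26) (h := 1811939) (dh := 33031) (y := 1652582) (dy := 163606)
    (g := .right (.right (.right (.right .leaf .leaf) (.right .leaf .leaf)) (.right .leaf .leaf)) (.right (.right .leaf .leaf) (.right .leaf .leaf))) (by decide) (by decide)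
    (by decide) (by decide +kernel) (by decide) (by norm_num [polConst]) (by norm_num) h0 h1 hu h2 h3

theorem G_six_neg_of_le_3_77_exp_le_1_1 {X u : ℝ} (h0 : 3.519 ≤ X) (h1 : X ≤ 3.77) (hu : u ∈ Set.Icc 0 uHex)
    (h2 : 1 ≤ Real.exp u) (h3 : Real.exp u ≤ 1.1) : ((1 : ℤ) : ℝ) * G 6 X u < 0 :=
  sign_of_check_range (r := 46000000000000000000) (T := 26) (h := 1910767) (dh := 65799) (y := 1101005) (dy := 52429)
    (g := .right (.left (.right .leaf .leaf) .leaf) (.left (.right .leaf .leaf) .leaf)) (by decide) (by decide)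
    (by decide) (by decide +kernel) (by decide) (by norm_num [polConst]) (by norm_num) h0 h1 hu h2 h3

theorem G_five_neg_of_le_3_77_exp_le_1_57 {X u : ℝ} (h0 : 3.519 ≤ X) (h1 : X ≤ 3.77) (hu : u ∈ Set.Icc 0 uHex)
    (h2 : 1.1 ≤ Real.exp u) (h3 : Real.exp u ≤ 1.57) : ((1 : ℤ) : ℝ) * G 5 X u < 0 :=
  sign_of_check_range (r := 1500000000000000000) (T := 26) (h := 1910767) (dh := 65799) (y := 1399849) (dy := 246416)
    (g := .right (.right (.right (.left (.right .leaf .leaf) (.right .leaf .leaf)) (.left (.right .leaf .leaf) .leaf)) (.right (.left .leaf .leaf) (.right .leaf .leaf))) (.right (.right (.right .leaf .leaf) (.right .leaf .leaf)) (.right (.left .leaf .leaf) (.left .leaf .leaf)))) (by decide) (by decide)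
    (by decide) (by decide +kernel) (by decide) (by norm_num [polConst]) (by norm_num) h0 h1 hu h2 h3

theorem G_four_neg_of_le_3_77_hex {X u : ℝ} (h0 : 3.519 ≤ X) (h1 : X ≤ 3.77) (hu : u ∈ Set.Icc 0 uHex)
    (h2 : 1.57 ≤ Real.exp u) (h3 : Real.exp u ≤ 1.7320509) : ((1 : ℤ) : ℝ) * G 4 X u < 0 :=
  sign_of_check_range (r := 47000000000000000) (T := 26) (h := 1910767) (dh := 65799) (y := 1731225) (dy := 84963)
    (g := .right (.left (.right .leaf .leaf) .leaf) (.right .leaf .leaf)) (by decide) (by decide)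
    (by decide) (by decide +kernel) (by decide) (by norm_num [polConst]) (by norm_num) h0 h1 hu h2 h3

theorem G_four_pos_of_le_4_7125_exp_le_1_28 {X u : ℝ} (h0 : 3.77 ≤ X) (h1 : X ≤ 4.7125) (hu : u ∈ Set.Icc 0 uHex)
    (h2 : 1 ≤ Real.exp u) (h3 : Real.exp u ≤ 1.28) : (((-1) : ℤ) : ℝ) * G 4 X u < 0 :=
  sign_of_check_range (r := 1800000000000000) (T := 30) (h := 2223636) (dh := 247072) (y := 1195377) (dy := 146801)
    (g := .right (.left (.right (.left .leaf .leaf) (.left .leaf .leaf)) (.right (.right .leaf .leaf) (.right .leaf .leaf))) (.left (.right (.left (.right .leaf .leaf) .leaf) (.left (.right .leaf .leaf) .leaf)) (.right (.right .leaf .leaf) (.right .leaf .leaf)))) (by decide) (by decide)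
    (by decide) (by decide +kernel) (by decide) (by norm_num [polConst]) (by norm_num) h0 h1 hu h2 h3

theorem G_three_pos_of_le_4_7125_hex {X u : ℝ} (h0 : 3.77 ≤ X) (h1 : X ≤ 4.7125) (hu : u ∈ Set.Icc 0 uHex)
    (h2 : 1.28 ≤ Real.exp u) (h3 : Real.exp u ≤ 1.7320509) : (((-1) : ℤ) : ℝ) * G 3 X u < 0 :=
  sign_of_check_range (r := 51000000000000) (T := 30) (h := 2223636) (dh := 247072) (y := 1579182) (dy := 237006)
    (g := .right (.left (.right (.left (.right .leaf .leaf) .leaf) (.left .leaf .leaf)) (.right (.right .leaf .leaf) (.right .leaf .leaf))) (.left (.right (.left .leaf .leaf) (.left (.right .leaf .leaf) .leaf)) (.right .leaf (.right .leaf .leaf)))) (by decide) (by decide)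
    (by decide) (by decide +kernel) (by decide) (by norm_num [polConst]) (by norm_num) h0 h1 hu h2 h3

theorem G_four_pos_of_le_6_exp_le_1_28 {X u : ℝ} (h0 : 4.7125 ≤ X) (h1 : X ≤ 6) (hu : u ∈ Set.Icc 0 uHex)
    (h2 : 1 ≤ Real.exp u) (h3 : Real.exp u ≤ 1.28) : (((-1) : ℤ) : ℝ) * G 4 X u < 0 :=
  sign_of_check_range (r := 1800000000000000) (T := 30) (h := 2808217) (dh := 337511) (y := 1195377) (dy := 146801)
    (g := .right (.left (.right (.left .leaf .leaf) (.left .leaf .leaf)) (.right (.right .leaf .leaf) (.right .leaf .leaf))) (.left (.right (.left .leaf .leaf) (.left .leaf .leaf)) (.right (.right .leaf .leaf) (.right .leaf .leaf)))) (by decide) (by decide)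
    (by decide) (by decide +kernel) (by decide) (by norm_num [polConst]) (by norm_num) h0 h1 hu h2 h3

theorem G_three_pos_of_le_6_hex {X u : ℝ} (h0 : 4.7125 ≤ X) (h1 : X ≤ 6) (hu : u ∈ Set.Icc 0 uHex)
    (h2 : 1.28 ≤ Real.exp u) (h3 : Real.exp u ≤ 1.7320509) : (((-1) : ℤ) : ℝ) * G 3 X u < 0 :=
  sign_of_check_range (r := 51000000000000) (T := 30) (h := 2808217) (dh := 337511) (y := 1579182) (dy := 237006)
    (g := .right (.left (.right (.right .leaf .leaf) (.right .leaf .leaf)) (.right (.right .leaf .leaf) (.right .leaf .leaf))) (.left (.right (.right .leaf .leaf) (.right .leaf .leaf)) (.right (.right .leaf .leaf) .leaf))) (by decide) (by decide)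
    (by decide) (by decide +kernel) (by decide) (by norm_num [polConst]) (by norm_num) h0 h1 hu h2 h3

/-! ### The profile along the arc for moderate scales -/

theorem exp_le_of_le_log {b u : ℝ} (hb : 0 < b) (h : u ≤ Real.log b) : Real.exp u ≤ b :=
  (Real.le_log_iff_exp_le hb).1 h

theorem le_exp_of_log_le {b u : ℝ} (hb : 0 < b) (h : Real.log b ≤ u) : b ≤ Real.exp u :=
  (Real.log_le_iff_le_exp hb).1 h

theorem log_le_uHex {b : ℝ} (hb : 0 < b) (h : b ≤ 1.7) : Real.log b ≤ uHex := by
  rw [Real.log_le_iff_le_exp hb, exp_uHex]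
  exact h.trans (Real.le_sqrt_of_sq_le (by norm_num))

theorem exp_le_of_le_uHex {u : ℝ} (h : u ≤ uHex) : Real.exp u ≤ 1.7320509 := by
  refine (Real.exp_le_exp.2 h).trans ?_
  rw [exp_uHex]
  exact Real.sqrt_le_iff.2 ⟨by norm_num, by norm_num⟩

theorem neg_of_one_mul {a : ℝ} (h : ((1 : ℤ) : ℝ) * a < 0) : a < 0 := by simpa using h

theorem pos_of_neg_one_mul {a : ℝ} (h : ((-1 : ℤ) : ℝ) * a < 0) : 0 < a := by simpa using h

/-- Up to X = 3.35 the third derivative is negative on the interior. From there on it is only shown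
to have no change from minus to plus, which needs derivatives four to six. -/
theorem G_lt_max {X : ℝ} (hX : 3.1415 ≤ X) (hX' : X ≤ 3.77) {c : ℝ} (hc0 : 0 < c) (hc : c < uHex) :
    G 0 X c < max (G 0 X 0) (G 0 X uHex) := by
  have hX0 : 0 < X := by linarith
  have d := fun (j : ℕ) (hj : j < 6) => hasDerivAt_G hj hX0
  have z1 := G_odd_zero (j := 1) (by decide) X
  have z3 := G_odd_zero (j := 3) (by decide) X
  have z5 := G_odd_zero (j := 5) (by decide) X
  have zh := G_one_uHex hX0
  have one := fun {u : ℝ} (h : 0 ≤ u) => Real.one_le_exp h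
  -- The certificates have thresholds in e^u, the shape lemma in u; the bound 1.7 < √3 keeps the
  -- logarithms inside the arc.
  have three : ∀ {b₁ b₂ : ℝ}, 1 ≤ b₁ → b₁ ≤ b₂ → b₂ ≤ 1.7 →
      (∀ u ∈ Set.Icc 0 uHex, Real.exp u ≤ b₁ → G 6 X u < 0) →
      (∀ u ∈ Set.Icc 0 uHex, b₁ ≤ Real.exp u → Real.exp u ≤ b₂ → G 5 X u < 0) →
      (∀ u ∈ Set.Icc 0 uHex, b₂ ≤ Real.exp u → G 4 X u < 0) →
      G 0 X c < max (G 0 X 0) (G 0 X uHex) := by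
    intro b₁ b₂ h1 h2 h3 k6 k5 k4
    have p1 : 0 < b₁ := by linarith
    have p2 : 0 < b₂ := by linarith
    have l1 := log_le_uHex p1 (h2.trans h3)
    have l2 := log_le_uHex p2 h3
    exact lt_max_of_fourth_anti (d 0 (by norm_num)) (d 1 (by norm_num)) (d 2 (by norm_num))
      (d 3 (by norm_num)) (d 4 (by norm_num)) (d 5 (by norm_num)) z1 zh z3 z5
      (b₁ := Real.log b₁) (b₂ := Real.log b₂)
      (fun u hu hu' => k6 u ⟨hu, hu'.trans l1⟩ (exp_le_of_le_log p1 hu'))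
      (fun u hu hu' => k5 u ⟨(Real.log_nonneg h1).trans hu, hu'.trans l2⟩ (le_exp_of_log_le p1 hu)
        (exp_le_of_le_log p2 hu'))
      (fun u hu hu' => k4 u ⟨(Real.log_nonneg (h1.trans h2)).trans hu, hu'⟩ (le_exp_of_log_le p2 hu))
      hc0 hc
  rcases le_total X 3.268 with h1 | h1
  · have l1 := log_le_uHex (b := 1.28) (by norm_num) (by norm_num)
    exact lt_max_of_third_neg (d 0 (by norm_num)) (d 1 (by norm_num)) (d 2 (by norm_num))
      (d 3 (by norm_num)) z1 zh z3 (b := Real.log 1.28)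
      (fun u hu hu' => neg_of_one_mul (G_four_neg_of_le_3_268_exp_le_1_28 hX h1 ⟨hu, hu'.trans l1⟩ (one hu)
        (exp_le_of_le_log (by norm_num) hu')))
      (fun u hu hu' => neg_of_one_mul (G_three_neg_of_le_3_268_hex hX h1
        ⟨(Real.log_nonneg (by norm_num)).trans hu, hu'⟩ (le_exp_of_log_le (by norm_num) hu)
        (exp_le_of_le_uHex hu'))) hc0 hc
  rcases le_total X 3.35 with h2 | h2
  -- The fourth derivative is negative on the whole arc, so b = `uHex` and the condition on the
  -- third derivative concerns the end point only.
  · have n4 : ∀ u, 0 ≤ u → u ≤ uHex → G 4 X u < 0 := fun u hu hu' =>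
      neg_of_one_mul (G_four_neg_of_le_3_35_hex h1 h2 ⟨hu, hu'⟩ (one hu) (exp_le_of_le_uHex hu'))
    exact lt_max_of_third_neg (d 0 (by norm_num)) (d 1 (by norm_num)) (d 2 (by norm_num))
      (d 3 (by norm_num)) z1 zh z3 n4
      (fun u hu hu' => neg_of_deriv_neg (d 3 (by norm_num)) z3 n4 (uHex_pos.trans_le hu) hu') hc0 hc
  rcases le_total X 3.393 with h3 | h3
  · exact three (b₁ := 1.08) (b₂ := 1.28) (by norm_num) (by norm_num) (by norm_num)
      (fun u hu k => neg_of_one_mul (G_six_neg_of_le_3_393_exp_le_1_08 h2 h3 hu (one hu.1) k))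
      (fun u hu k k' => neg_of_one_mul (G_five_neg_of_le_3_393_exp_le_1_28 h2 h3 hu k k'))
      (fun u hu k => neg_of_one_mul (G_four_neg_of_le_3_393_hex h2 h3 hu k (exp_le_of_le_uHex hu.2)))
  rcases le_total X 3.519 with h4 | h4
  · exact three (b₁ := 1.1) (b₂ := 1.42) (by norm_num) (by norm_num) (by norm_num)
      (fun u hu k => neg_of_one_mul (G_six_neg_of_le_3_519_exp_le_1_1 h3 h4 hu (one hu.1) k))
      (fun u hu k k' => neg_of_one_mul (G_five_neg_of_le_3_519_exp_le_1_42 h3 h4 hu k k'))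
      (fun u hu k => neg_of_one_mul (G_four_neg_of_le_3_519_hex h3 h4 hu k (exp_le_of_le_uHex hu.2)))
  · exact three (b₁ := 1.1) (b₂ := 1.57) (by norm_num) (by norm_num) (by norm_num)
      (fun u hu k => neg_of_one_mul (G_six_neg_of_le_3_77_exp_le_1_1 h4 hX' hu (one hu.1) k))
      (fun u hu k k' => neg_of_one_mul (G_five_neg_of_le_3_77_exp_le_1_57 h4 hX' hu k k'))
      (fun u hu k => neg_of_one_mul (G_four_neg_of_le_3_77_hex h4 hX' hu k (exp_le_of_le_uHex hu.2)))

/-- The third derivative is positive for u > 0: by integrating the fourth from u = 0 while e^u ≤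
1.28, and by direct enclosure beyond. -/
theorem G_lt_left_of_le {X : ℝ} (hX : 3.77 ≤ X) (hX' : X ≤ 6) {c : ℝ} (hc0 : 0 < c) (hc : c ≤ uHex) :
    G 0 X c < G 0 X 0 := by
  have hX0 : 0 < X := by linarith
  have d := fun (j : ℕ) (hj : j < 6) => hasDerivAt_G hj hX0
  have z1 := G_odd_zero (j := 1) (by decide) X
  have z3 := G_odd_zero (j := 3) (by decide) X
  have l1 := log_le_uHex (b := 1.28) (by norm_num) (by norm_num)
  have one := fun {u : ℝ} (h : 0 ≤ u) => Real.one_le_exp h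
  refine lt_left_of_third_pos (d 0 (by norm_num)) (d 1 (by norm_num)) (d 2 (by norm_num))
      (d 3 (by norm_num)) z1 (G_one_uHex hX0) z3 (b := Real.log 1.28) (fun u hu hu' => ?_)
      (fun u hu hu' => ?_) hc0 hc
  · have k := exp_le_of_le_log (by norm_num) hu'
    rcases le_total X 4.7125 with h | h
    · exact pos_of_neg_one_mul (G_four_pos_of_le_4_7125_exp_le_1_28 hX h ⟨hu, hu'.trans l1⟩ (one hu) k)
    · exact pos_of_neg_one_mul (G_four_pos_of_le_6_exp_le_1_28 h hX' ⟨hu, hu'.trans l1⟩ (one hu) k)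
  · have k := le_exp_of_log_le (by norm_num) hu
    have hu0 : 0 ≤ u := (Real.log_nonneg (by norm_num)).trans hu
    rcases le_total X 4.7125 with h | h
    · exact pos_of_neg_one_mul (G_three_pos_of_le_4_7125_hex hX h ⟨hu0, hu'⟩ k (exp_le_of_le_uHex hu'))
    · exact pos_of_neg_one_mul (G_three_pos_of_le_6_hex h hX' ⟨hu0, hu'⟩ k (exp_le_of_le_uHex hu'))

/-! ### The profile along the arc for large scales -/

theorem exp_neg_le_inv_sum {x : ℝ} (hx : 0 ≤ x) (n : ℕ) (hn : 0 < n) :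
    Real.exp (-x) ≤ (∑ i ∈ Finset.range n, x ^ i / i.factorial)⁻¹ := by
  rw [Real.exp_neg]
  refine inv_anti₀ ?_ (Real.sum_le_exp_of_nonneg hx n)
  obtain ⟨m, rfl⟩ := Nat.exists_eq_succ_of_ne_zero hn.ne'
  rw [Finset.sum_range_succ']
  have : 0 ≤ ∑ i ∈ Finset.range m, x ^ (i + 1) / (i + 1).factorial :=
    Finset.sum_nonneg fun i _ => by positivity
  simp only [pow_zero, Nat.factorial_zero, Nat.cast_one, div_one]
  linarith

theorem sub_one_mul_exp_anti {x z : ℝ} (hz : 2 ≤ z) (h : z ≤ x) :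
    (x - 1) * Real.exp (-x) ≤ (z - 1) * Real.exp (-z) := by
  have h1 : x - 1 ≤ (z - 1) * Real.exp (x - z) := by
    nlinarith [Real.add_one_le_exp (x - z)]
  calc (x - 1) * Real.exp (-x) ≤ (z - 1) * Real.exp (x - z) * Real.exp (-x) :=
        mul_le_mul_of_nonneg_right h1 (Real.exp_pos _).le
    _ = _ := by rw [mul_assoc, ← Real.exp_add]; congr 2; ring

theorem pow_three_mul_exp_anti {x z : ℝ} (hz : 3 ≤ z) (h : z ≤ x) :
    x ^ 3 * Real.exp (-x) ≤ z ^ 3 * Real.exp (-z) := by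
  have hz0 : 0 < z := by linarith
  have h1 : x / z ≤ Real.exp ((x - z) / 3) := by
    have : x / z ≤ (x - z) / 3 + 1 := by
      rw [div_le_iff₀ hz0]; nlinarith
    exact this.trans (Real.add_one_le_exp _)
  have h2 := pow_le_pow_left₀ (div_nonneg (hz0.le.trans h) hz0.le) h1 3
  rw [← Real.exp_nat_mul, div_pow, div_le_iff₀ (by positivity)] at h2
  calc x ^ 3 * Real.exp (-x) ≤ Real.exp ((3 : ℕ) * ((x - z) / 3)) * z ^ 3 * Real.exp (-x) :=
        mul_le_mul_of_nonneg_right h2 (Real.exp_pos _).le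
    _ = z ^ 3 * (Real.exp ((3 : ℕ) * ((x - z) / 3)) * Real.exp (-x)) := by ring
    _ = _ := by rw [← Real.exp_add]; congr 2; push_cast; ring

theorem coreReal_eq (j : ℕ) (H y : ℝ) :
    coreReal j H y = pol j 0 0 + 4 * (pol j (H * y + H * (1 / y)) (H * y - H * (1 / y))
        * Real.exp (-(H * y + H * (1 / y))))
      + 2 * (pol j (H * y * 4) (H * y * 4) * Real.exp (-(H * y * 4)))
      + 2 * (pol j (H * (1 / y) * 4) (-(H * (1 / y) * 4)) * Real.exp (-(H * (1 / y) * 4)))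
      + 4 * (pol j (H * y * 4 + H * (1 / y) * 4) (H * y * 4 - H * (1 / y) * 4)
        * Real.exp (-(H * y * 4 + H * (1 / y) * 4)))
      + 4 * (pol j (H * y + H * (1 / y) * 9) (H * y - H * (1 / y) * 9)
        * Real.exp (-(H * y + H * (1 / y) * 9)))
      + 4 * (pol j (H * y * 9 + H * (1 / y)) (H * y * 9 - H * (1 / y))
        * Real.exp (-(H * y * 9 + H * (1 / y))))
      + 2 * (pol j (H * (1 / y) * 16) (-(H * (1 / y) * 16)) * Real.exp (-(H * (1 / y) * 16))) := by
  have hs := sum_core fun K L => pol j (H * y * K + H * (1 / y) * L) (H * y * K - H * (1 / y) * L)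
    * Real.exp (-(H * y * K + H * (1 / y) * L))
  rw [coreReal]
  refine hs.trans ?_
  simp only [mul_zero, mul_one, zero_add, add_zero, sub_zero, zero_sub, neg_zero, Real.exp_zero]

theorem abs_pol_two_le {x d : ℝ} (hx : 4 ≤ x) (hd : |d| ≤ x) : |pol 2 x d| ≤ x ^ 3 := by
  have hD : d ^ 2 ≤ x ^ 2 := sq_le_sq' (by linarith [(abs_le.1 hd).1]) (abs_le.1 hd).2
  have hD0 := sq_nonneg d
  have h1 : d ^ 2 * (x - 3) ≤ x ^ 2 * (x - 3) := mul_le_mul_of_nonneg_right hD (by linarith)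
  have h2 : 0 ≤ d ^ 2 * (x - 3) := mul_nonneg hD0 (by linarith)
  simp only [pol]
  rw [abs_le]
  constructor <;> nlinarith [mul_nonneg (by linarith : 0 ≤ x) (by linarith : 0 ≤ x - 4), sq_nonneg x]

theorem abs_G_zero_sub_coreReal_le {X u : ℝ} (hX : 4 ≤ X) (hu : u ∈ Set.Icc 0 uHex) :
    |G 0 X u - coreReal 0 (X / 2) (Real.exp u)| ≤ 216 * X * Real.exp (-(8 * X)) := by
  have h := abs_tsum_sub_core_le (polyBdd_pol 0) (n := 1) (c := 1) (by norm_num) zero_le_one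
    (fun x d hx _ => by simp only [pol]; rw [abs_le]; constructor <;> linarith) (T := 8 * X) (by linarith)
    le_rfl hu (by linarith)
  rw [sum_core_eq_coreReal] at h
  refine h.trans (le_of_eq ?_)
  ring

theorem abs_G_two_sub_coreReal_le {X u : ℝ} (hX : 4 ≤ X) (hu : u ∈ Set.Icc 0 uHex) :
    |G 2 X u - coreReal 2 (X / 2) (Real.exp u)| ≤ 27 * ((8 * X) ^ 3 * Real.exp (-(8 * X))) := by
  have h := abs_tsum_sub_core_le (polyBdd_pol 2) (n := 3) (c := 1) (by norm_num) zero_le_one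
    (fun x d hx hd => by rw [one_mul]; exact abs_pol_two_le (by linarith) hd) (T := 8 * X) (by linarith)
    le_rfl hu (by linarith)
  rw [sum_core_eq_coreReal] at h
  refine h.trans (le_of_eq ?_)
  ring

theorem exp_six_le : Real.exp (-6 : ℝ) ≤ 0.00248 := by
  have := exp_neg_nat_le 6
  norm_num at this ⊢
  linarith

/-- `e^{-a X}` in terms of `e^{-X}`. -/
theorem exp_neg_mul_le {a X k : ℝ} (hX : 6 ≤ X) (ha : 1 ≤ a) (hk : Real.exp (-(6 * (a - 1))) ≤ k) :
    Real.exp (-(a * X)) ≤ k * Real.exp (-X) := by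
  calc Real.exp (-(a * X)) ≤ Real.exp (-(6 * (a - 1))) * Real.exp (-X) := by
        rw [← Real.exp_add, Real.exp_le_exp]; nlinarith
    _ ≤ _ := mul_le_mul_of_nonneg_right hk (Real.exp_pos _).le

/-- All large-scale estimates are relative to e^{-X}, the weight of the shortest vectors at i. A
vector with x ≥ aX loses at least e^{-6(a-1)} against it. -/
theorem sub_one_mul_exp_le {a X k x : ℝ} (hX : 6 ≤ X) (ha : 1 ≤ a)
    (hk : Real.exp (-(6 * (a - 1))) ≤ k) (hx : a * X ≤ x) :
    (x - 1) * Real.exp (-x) ≤ (a * X - 1) * (k * Real.exp (-X)) := by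
  have h1 : 6 ≤ a * X := by nlinarith
  exact (sub_one_mul_exp_anti (by linarith) hx).trans
    (mul_le_mul_of_nonneg_left (exp_neg_mul_le hX ha hk) (by linarith))

theorem exp_neg_14_le : Real.exp (-(6 * (3.4 - 1)) : ℝ) ≤ 0.000001 := by
  have h : Real.exp (-(6 * (3.4 - 1)) : ℝ) ≤ Real.exp (-((14 : ℕ) : ℝ)) :=
    Real.exp_le_exp.2 (by norm_num)
  refine (h.trans (exp_neg_nat_le 14)).trans (by norm_num)

theorem exp_neg_42_le : Real.exp (-(6 * (8 - 1)) : ℝ) ≤ 0.000001 := by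
  have h : Real.exp (-(6 * (8 - 1)) : ℝ) ≤ Real.exp (-((14 : ℕ) : ℝ)) :=
    Real.exp_le_exp.2 (by norm_num)
  refine (h.trans (exp_neg_nat_le 14)).trans (by norm_num)

set_option maxHeartbeats 2000000 in
/-- Comparison with the value at the square lattice, given bounds for the shortest vectors. -/
theorem G_zero_lt_of_bounds {X u : ℝ} (hX : 6 ≤ X) (hu : u ∈ Set.Icc 0 uHex) {A B : ℝ}
    (hA : (X * Real.cosh u - 1) * Real.exp (-(X * Real.cosh u)) ≤ A * Real.exp (-X))
    (hB : (2 * X * Real.exp (-u) - 1) * Real.exp (-(2 * X * Real.exp (-u))) ≤ B * Real.exp (-X))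
    (hAB : 4 * A + 2 * B + 2 * (2 * X - 1) * 0.00248 + 0.001 * X < 4 * (X - 1)) :
    G 0 X u < G 0 X 0 := by
  have hX0 : 0 < X := by linarith
  have h0 := (abs_le.1 (abs_G_zero_sub_coreReal_le (by linarith : 4 ≤ X) hu)).2
  have h1 := (abs_le.1 (abs_G_zero_sub_coreReal_le (X := X) (u := 0) (by linarith)
    ⟨le_rfl, uHex_pos.le⟩)).1
  have hy1 : 1 ≤ Real.exp u := Real.one_le_exp hu.1
  have hy2 := exp_le_of_le_uHex hu.2
  rw [Real.exp_zero] at h1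
  rw [coreReal_eq] at h0 h1
  have hE := Real.exp_pos (-X)
  have hcosh : X * Real.cosh u = X / 2 * Real.exp u + X / 2 * (1 / Real.exp u) := by
    rw [Real.cosh_eq, Real.exp_neg]; ring
  have hexp : 2 * X * Real.exp (-u) = X / 2 * (1 / Real.exp u) * 4 := by rw [Real.exp_neg]; ring
  rw [hcosh] at hA
  rw [hexp] at hB
  set y := Real.exp u
  have hy0 : 0 < y := by linarith
  have hv1 : 1 / y ≤ 1 := by rw [div_le_one hy0]; exact hy1
  have hv0 : 0.5773 ≤ 1 / y := by rw [le_div_iff₀ hy0]; linarith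
  have hyv : y * (1 / y) = 1 := by field_simp
  set v := 1 / y
  have e6 : Real.exp (-(6 * (2 - 1)) : ℝ) ≤ 0.00248 := by
    have := exp_six_le; norm_num at this ⊢; exact this
  have hP : X / 2 ≤ X / 2 * y := by nlinarith
  have hQ : 0.2886 * X ≤ X / 2 * v := by nlinarith
  have hPQ : X ≤ X / 2 * y + X / 2 * v := by
    rw [← hcosh]; exact le_mul_of_one_le_right hX0.le (Real.one_le_cosh u)
  have h9 : 3.4 * X ≤ X / 2 * y + X / 2 * v * 9 := by
    have : 6.8 ≤ y + v * 9 := by nlinarith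
    nlinarith
  set P := X / 2 * y
  set Q := X / 2 * v
  have b1 := sub_one_mul_exp_le hX (by norm_num) e6 (x := P * 4) (by linarith)
  have b2 := sub_one_mul_exp_le hX (by norm_num) exp_neg_14_le (x := P * 4 + Q * 4) (by linarith)
  have b3 := sub_one_mul_exp_le hX (by norm_num) exp_neg_14_le (x := P + Q * 9) h9
  have b4 := sub_one_mul_exp_le hX (by norm_num) exp_neg_14_le (x := P * 9 + Q) (by linarith)
  have b5 := sub_one_mul_exp_le hX (by norm_num) exp_neg_14_le (x := Q * 16) (by linarith)
  have b6 := exp_neg_mul_le hX (by norm_num) exp_neg_42_le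
  have c1 : 0 ≤ (X / 2 * 1 * 4 - 1) * Real.exp (-(X / 2 * 1 * 4)) :=
    mul_nonneg (by linarith) (Real.exp_pos _).le
  have c2 : 0 ≤ (X / 2 * (1 / 1) * 4 - 1) * Real.exp (-(X / 2 * (1 / 1) * 4)) :=
    mul_nonneg (by linarith) (Real.exp_pos _).le
  have c3 : 0 ≤ (X / 2 * 1 * 4 + X / 2 * (1 / 1) * 4 - 1)
      * Real.exp (-(X / 2 * 1 * 4 + X / 2 * (1 / 1) * 4)) :=
    mul_nonneg (by linarith) (Real.exp_pos _).le
  have c4 : 0 ≤ (X / 2 * 1 + X / 2 * (1 / 1) * 9 - 1) * Real.exp (-(X / 2 * 1 + X / 2 * (1 / 1) * 9)) :=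
    mul_nonneg (by linarith) (Real.exp_pos _).le
  have c5 : 0 ≤ (X / 2 * 1 * 9 + X / 2 * (1 / 1) - 1) * Real.exp (-(X / 2 * 1 * 9 + X / 2 * (1 / 1))) :=
    mul_nonneg (by linarith) (Real.exp_pos _).le
  have c6 : 0 ≤ (X / 2 * (1 / 1) * 16 - 1) * Real.exp (-(X / 2 * (1 / 1) * 16)) :=
    mul_nonneg (by linarith) (Real.exp_pos _).le
  have c7 : X / 2 * 1 + X / 2 * (1 / 1) = X := by ring
  rw [c7] at h1
  have b7 := mul_le_mul_of_nonneg_left b6 (by linarith : 0 ≤ 216 * X)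
  have b8 := mul_lt_mul_of_pos_right hAB hE
  have b9 : 0 ≤ X * Real.exp (-X) := by positivity
  simp only [pol] at h0 h1
  linarith

theorem G_zero_lt_of_cosh_ge {X u : ℝ} (hX : 6 ≤ X) (hu : u ∈ Set.Icc 0 uHex)
    (h : 1 + 0.12 / X ≤ Real.cosh u) : G 0 X u < G 0 X 0 := by
  have hX0 : 0 < X := by linarith
  have hv := exp_le_of_le_uHex hu.2
  have hy1 : 1 ≤ Real.exp u := Real.one_le_exp hu.1
  have hyv : Real.exp u * Real.exp (-u) = 1 := by rw [← Real.exp_add]; simp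
  have hv0 := Real.exp_pos (-u)
  -- For cosh u ≥ 1.06 the four vectors of length X cosh u have lost enough, and the pair of length
  -- 2Xe^{-u} is bounded through 2/√3 > 1.1546. Otherwise the excess 0.12 yields the factor 0.887,
  -- and e^{-u} ≥ 0.708 makes the pair small.
  rcases le_total 1.06 (Real.cosh u) with hw | hw
  · have k1 : Real.exp (-(6 * (1.06 - 1)) : ℝ) ≤ 0.698 := by
      refine (exp_neg_le_inv_sum (by norm_num) 5 (by norm_num)).trans ?_
      norm_num [Finset.sum_range_succ, Nat.factorial]
    have k2 : Real.exp (-(6 * (1.1546 - 1)) : ℝ) ≤ 0.396 := by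
      refine (exp_neg_le_inv_sum (by norm_num) 7 (by norm_num)).trans ?_
      norm_num [Finset.sum_range_succ, Nat.factorial]
    have hA := sub_one_mul_exp_le hX (by norm_num) k1 (x := X * Real.cosh u) (by nlinarith)
    have hB := sub_one_mul_exp_le hX (by norm_num) k2 (x := 2 * X * Real.exp (-u)) (by
      have : 0.5773 ≤ Real.exp (-u) := by nlinarith
      nlinarith)
    rw [← mul_assoc] at hA hB
    exact G_zero_lt_of_bounds hX hu hA hB (by norm_num; linarith)
  · have k1 : Real.exp (-0.12 : ℝ) ≤ 0.887 := by
      refine (exp_neg_le_inv_sum (by norm_num) 5 (by norm_num)).trans ?_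
      norm_num [Finset.sum_range_succ, Nat.factorial]
    have k2 : Real.exp (-(6 * (1.416 - 1)) : ℝ) ≤ 0.083 := by
      refine (exp_neg_le_inv_sum (by norm_num) 9 (by norm_num)).trans ?_
      norm_num [Finset.sum_range_succ, Nat.factorial]
    have hxw : X + 0.12 ≤ X * Real.cosh u := by
      have := mul_le_mul_of_nonneg_left h hX0.le
      rwa [mul_add, mul_one, mul_div_cancel₀ _ hX0.ne'] at this
    have hA : (X * Real.cosh u - 1) * Real.exp (-(X * Real.cosh u)) ≤
        ((X - 0.88) * 0.887) * Real.exp (-X) := by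
      refine (sub_one_mul_exp_anti (by linarith) hxw).trans ?_
      rw [neg_add, Real.exp_add, show X + 0.12 - 1 = X - 0.88 by ring, mul_assoc, mul_comm (Real.exp (-X))]
      exact mul_le_mul_of_nonneg_left (mul_le_mul_of_nonneg_right k1 (Real.exp_pos _).le) (by linarith)
    have hB := sub_one_mul_exp_le hX (by norm_num) k2 (x := 2 * X * Real.exp (-u)) (by
      have h2 : Real.exp u + Real.exp (-u) ≤ 2.12 := by rw [Real.cosh_eq] at hw; linarith
      have : 0.708 ≤ Real.exp (-u) := by nlinarith
      nlinarith)
    rw [← mul_assoc] at hB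
    exact G_zero_lt_of_bounds hX hu hA hB (by norm_num; linarith)

/-- X³ e^{-X/2} decreases for X ≥ 6, so it is replaced by its value at 6; this removes the power of
X. -/
theorem pow_three_mul_exp_le {a X k x : ℝ} (hX : 6 ≤ X) (ha : 1.5 ≤ a)
    (hk : Real.exp (-(6 * (a - 1))) ≤ k) (hx : a * X ≤ x) :
    x ^ 3 * Real.exp (-x) ≤ 216 * a ^ 3 * k * Real.exp (-X) := by
  have ha0 : 0 < a := by linarith
  have h1 : 9 ≤ a * X := by nlinarith
  calc x ^ 3 * Real.exp (-x) ≤ (a * X) ^ 3 * Real.exp (-(a * X)) :=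
        pow_three_mul_exp_anti (by linarith) hx
    _ = a ^ 3 * (X ^ 3 * Real.exp (-(X / 2))) * Real.exp (-((a - 1 / 2) * X)) := by
        rw [mul_assoc, mul_assoc, ← Real.exp_add]
        ring_nf
    _ ≤ a ^ 3 * (6 ^ 3 * Real.exp (-(6 / 2))) * Real.exp (-((a - 1 / 2) * X)) := by
        have h3 := pow_three_mul_exp_anti (x := X / 2) (z := 6 / 2) (by norm_num) (by linarith)
        have h4 : X ^ 3 * Real.exp (-(X / 2)) ≤ 6 ^ 3 * Real.exp (-(6 / 2)) := by
          rw [div_pow, div_pow] at h3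
          linarith
        exact mul_le_mul_of_nonneg_right (mul_le_mul_of_nonneg_left h4 (by positivity))
          (Real.exp_pos _).le
    _ = 216 * a ^ 3 * (Real.exp (-(6 / 2)) * Real.exp (-((a - 1 / 2) * X))) := by ring
    _ ≤ 216 * a ^ 3 * (k * Real.exp (-X)) := by
        refine mul_le_mul_of_nonneg_left ?_ (by positivity)
        refine le_trans ?_ (mul_le_mul_of_nonneg_right hk (Real.exp_pos _).le)
        rw [← Real.exp_add, ← Real.exp_add, Real.exp_le_exp]
        nlinarith
    _ = _ := by ring

theorem exp_neg_3_le : Real.exp (-(6 * (1.6376 - 1)) : ℝ) ≤ 0.0222 := by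
  refine (exp_neg_le_inv_sum (by norm_num) 11 (by norm_num)).trans ?_
  norm_num [Finset.sum_range_succ, Nat.factorial]

theorem pol_two_zero : pol 2 0 0 = 0 := by simp [pol]

/-- The bound on d² is (X + 0.12)² - X², from d² = x² - X² for the shortest vectors. The term 2x -
x² then outweighs d²(x - 3). -/
theorem pol_two_le {X x d : ℝ} (hX : 6 ≤ X) (h1 : X ≤ x) (h2 : x ≤ X + 0.12)
    (hd : d ^ 2 ≤ 0.24 * X + 0.0144) : pol 2 x d ≤ -19 := by
  simp only [pol]
  have h3 : d ^ 2 * (x - 3) ≤ (0.24 * X + 0.0144) * (X - 2.88) :=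
    mul_le_mul hd (by linarith) (by linarith) (by positivity)
  nlinarith

-- The four shortest vectors contribute at most 4 · (-16.72) e^{-X}, with 16.72 = 19 · 0.88. The
-- main opposing term comes from the pair of length 4Q, and all the others together do not close the
-- gap.
set_option maxHeartbeats 2000000 in
theorem G_two_neg_of_cosh_le {X u : ℝ} (hX : 6 ≤ X) (hu : u ∈ Set.Icc 0 uHex)
    (h : Real.cosh u ≤ 1 + 0.12 / X) : G 2 X u < 0 := by
  have hX0 : 0 < X := by linarith
  have h0 := (abs_le.1 (abs_G_two_sub_coreReal_le (by linarith : 4 ≤ X) hu)).2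
  rw [coreReal_eq] at h0
  have hE := Real.exp_pos (-X)
  have hy1 : 1 ≤ Real.exp u := Real.one_le_exp hu.1
  have hw1 := Real.one_le_cosh u
  have hxw : X * Real.cosh u ≤ X + 0.12 := by
    have := mul_le_mul_of_nonneg_left h hX0.le
    rwa [mul_add, mul_one, mul_div_cancel₀ _ hX0.ne'] at this
  have hw : Real.cosh u ≤ 1.02 := by nlinarith
  have hcosh : X * Real.cosh u = X / 2 * Real.exp u + X / 2 * (1 / Real.exp u) := by
    rw [Real.cosh_eq, Real.exp_neg]; ring
  have hsinh : X * Real.sinh u = X / 2 * Real.exp u - X / 2 * (1 / Real.exp u) := by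
    rw [Real.sinh_eq, Real.exp_neg]; ring
  have hcs : Real.cosh u ^ 2 - Real.sinh u ^ 2 = 1 := Real.cosh_sq_sub_sinh_sq u
  have hsum : Real.exp u + 1 / Real.exp u ≤ 2.04 := by
    rw [Real.cosh_eq, Real.exp_neg, ← one_div] at hw; linarith
  rw [← hcosh, ← hsinh] at h0
  set y := Real.exp u
  set w := Real.cosh u
  have hy0 : 0 < y := by linarith
  have hyv : y * (1 / y) = 1 := by field_simp
  have hv1 : 1 / y ≤ 1 := by rw [div_le_one hy0]; exact hy1
  set v := 1 / y
  -- Just below the smaller root of v + 1/v = 2.04; it yields 4Q ≥ 1.6376 X.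
  have hv0 : 0.8188 ≤ v := by nlinarith
  have hd2 : (X * Real.sinh u) ^ 2 ≤ 0.24 * X + 0.0144 := by
    have h1 : (X * Real.sinh u) ^ 2 = (X * w) ^ 2 - X ^ 2 := by linear_combination (-X ^ 2) * hcs
    have h2 : (X * w) ^ 2 ≤ (X + 0.12) ^ 2 := pow_le_pow_left₀ (by positivity) hxw 2
    rw [h1]; linarith
  have main : pol 2 (X * w) (X * Real.sinh u) ≤ -19 :=
    pol_two_le hX (le_mul_of_one_le_right hX0.le hw1) hxw hd2
  have hexp : 0.88 * Real.exp (-X) ≤ Real.exp (-(X * w)) := by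
    have h1 : Real.exp (-X) * Real.exp (-0.12) ≤ Real.exp (-(X * w)) := by
      rw [← Real.exp_add, Real.exp_le_exp]; linarith
    have h2 : (0.88 : ℝ) ≤ Real.exp (-0.12) := by linarith [Real.add_one_le_exp (-0.12 : ℝ)]
    nlinarith
  have t0 : pol 2 (X * w) (X * Real.sinh u) * Real.exp (-(X * w)) ≤ -(16.72 * Real.exp (-X)) := by
    nlinarith [Real.exp_pos (-(X * w))]
  have other : ∀ (x d a k : ℝ), 1.5 ≤ a → a * X ≤ x → |d| ≤ x → Real.exp (-(6 * (a - 1))) ≤ k →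
      pol 2 x d * Real.exp (-x) ≤ 216 * a ^ 3 * k * Real.exp (-X) := by
    intro x d a k ha hx hd hk
    have h1 : 9 ≤ a * X := by nlinarith
    have h2 := (le_abs_self _).trans (abs_pol_two_le (by linarith) hd)
    exact (mul_le_mul_of_nonneg_right h2 (Real.exp_pos _).le).trans (pow_three_mul_exp_le hX ha hk hx)
  have k2 : Real.exp (-(6 * (2 - 1)) : ℝ) ≤ 0.00248 := by
    have := exp_six_le; norm_num at this ⊢; exact this
  have p : ∀ a : ℝ, 0 ≤ a → |a| ≤ a := fun a h => (abs_of_nonneg h).le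
  have hP : X / 2 ≤ X / 2 * y := by nlinarith
  have hQ : 0.4094 * X ≤ X / 2 * v := by nlinarith
  set P := X / 2 * y
  set Q := X / 2 * v
  have hP0 : 0 ≤ P := by linarith
  have hQ0 : 0 ≤ Q := by linarith
  have t1 := other (P * 4) (P * 4) 2 _ (by norm_num) (by linarith) (p _ (by linarith)) k2
  have t2 := other (Q * 4) (-(Q * 4)) 1.6376 _ (by norm_num) (by linarith)
    (by rw [abs_neg]; exact p _ (by linarith)) exp_neg_3_le
  have t3 := other (P * 4 + Q * 4) (P * 4 - Q * 4) 3.4 _ (by norm_num)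
    (by linarith) (abs_le.2 ⟨by linarith, by linarith⟩) exp_neg_14_le
  have t4 := other (P + Q * 9) (P - Q * 9) 3.4 _ (by norm_num)
    (by linarith) (abs_le.2 ⟨by linarith, by linarith⟩) exp_neg_14_le
  have t5 := other (P * 9 + Q) (P * 9 - Q) 3.4 _ (by norm_num)
    (by linarith) (abs_le.2 ⟨by linarith, by linarith⟩) exp_neg_14_le
  have t6 := other (Q * 16) (-(Q * 16)) 3.4 _ (by norm_num) (by linarith)
    (by rw [abs_neg]; exact p _ (by linarith)) exp_neg_14_le
  have t7 := pow_three_mul_exp_le (x := 8 * X) hX (by norm_num) exp_neg_14_le (by linarith)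
  rw [pol_two_zero] at h0
  linarith

/-- Near i, G₀ is strictly concave with a critical point at u = 0; away from i, its value is
compared directly. The threshold cosh u = 1 + 0.12/X is where both arguments work. -/
theorem G_lt_left_of_ge {X : ℝ} (hX : 6 ≤ X) {c : ℝ} (hc0 : 0 < c) (hc : c ≤ uHex) :
    G 0 X c < G 0 X 0 := by
  have hX0 : 0 < X := by linarith
  rcases le_total (Real.cosh c) (1 + 0.12 / X) with h | h
  · have n2 : ∀ u, 0 ≤ u → u ≤ c → G 2 X u < 0 := fun u hu hu' =>
      G_two_neg_of_cosh_le hX ⟨hu, hu'.trans hc⟩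
        ((Real.cosh_le_cosh.2 (by rwa [abs_of_nonneg hu, abs_of_nonneg hc0.le])).trans h)
    by_contra! hcon
    obtain ⟨a, ha, ha'⟩ := exists_deriv_nonneg (hasDerivAt_G (j := 0) (by norm_num) hX0) hc0 hcon
    exact absurd (neg_of_deriv_neg (hasDerivAt_G (j := 1) (by norm_num) hX0)
      (G_odd_zero (by decide) X) n2 ha.1 ha.2.le) (not_lt.2 ha')
  · exact G_zero_lt_of_cosh_ge hX ⟨hc0.le, hc⟩ h

/-! ### Comparison of the two ends of the arc -/

theorem exp_neg_forty_le : Real.exp (-(1.6 * ((5 : ℕ) : ℝ) ^ 2)) ≤ 0.0000000000000000045 := by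
  have h : -(1.6 * ((5 : ℕ) : ℝ) ^ 2) = -((40 : ℕ) : ℝ) := by norm_num
  rw [h]
  refine (exp_neg_nat_le 40).trans (by norm_num)

/-- Outside the square x ≥ 1.8 (m² + n²) ≥ 45. The bound x² ≤ 400 e^{x/10} leaves a Gaussian of rate
1.62 ≥ 1.6, with total below 400 · 8 · e^{-40}. -/
theorem abs_tsum_sub_square_le {f : ℝ → ℝ} (hf : PolyBdd fun x _ => f x)
    (hle : ∀ x : ℝ, 25 ≤ x → |f x| ≤ x ^ 2) {X u : ℝ} (hu : u ∈ Set.Icc 0 uHex) (hX : 3.14 ≤ X) :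
    |∑' p : ℤ × ℤ, f (xx X u p) * Real.exp (-xx X u p)
      - ∑ p ∈ square 5, f (xx X u p) * Real.exp (-xx X u p)| ≤ 0.00000000000002 := by
  have hX0 : 0 < X := by linarith
  have far : ∀ p ∉ square 5, |f (xx X u p) * Real.exp (-xx X u p)| ≤
      400 * Real.exp (-(1.6 * ((p.1 : ℝ) ^ 2 + (p.2 : ℝ) ^ 2))) := by
    intro p hp
    have h1 := sq_add_sq_le_xx hu hX0.le p
    have h25 : (25 : ℝ) ≤ (p.1 : ℝ) ^ 2 + (p.2 : ℝ) ^ 2 := by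
      have key : ∀ n : ℤ, 5 ≤ n.natAbs → (25 : ℝ) ≤ (n : ℝ) ^ 2 := fun n hn => by
        have : (25 : ℤ) ≤ n ^ 2 := by rw [← Int.natAbs_sq]; exact_mod_cast Nat.pow_le_pow_left hn 2
        exact_mod_cast this
      rcases le_natAbs_of_notMem_square hp with h | h
      · linarith [key _ h, sq_nonneg (p.2 : ℝ)]
      · linarith [key _ h, sq_nonneg (p.1 : ℝ)]
    have h2 : 1.8 * ((p.1 : ℝ) ^ 2 + (p.2 : ℝ) ^ 2) ≤ X / 1.7321 * ((p.1 : ℝ) ^ 2 + (p.2 : ℝ) ^ 2) := by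
      refine mul_le_mul_of_nonneg_right ?_ (by linarith)
      rw [le_div_iff₀ (by norm_num)]
      linarith
    set x := xx X u p
    have hx : 25 ≤ x := by linarith
    have h3 : x / 20 ≤ Real.exp (x / 20) := by linarith [Real.add_one_le_exp (x / 20)]
    have h4 := pow_le_pow_left₀ (by linarith) h3 2
    rw [← Real.exp_nat_mul] at h4
    rw [abs_mul, abs_of_pos (Real.exp_pos _)]
    calc |f x| * Real.exp (-x) ≤ 400 * Real.exp ((2 : ℕ) * (x / 20)) * Real.exp (-x) :=
          mul_le_mul_of_nonneg_right (by linarith [hle x hx]) (Real.exp_pos _).le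
      _ ≤ _ := by
          rw [mul_assoc, ← Real.exp_add]
          refine mul_le_mul_of_nonneg_left (Real.exp_le_exp.2 ?_) (by norm_num)
          push_cast
          linarith
  have h := abs_tsum_sub_sum_le (summable_of_halfBdd hf.halfBdd hX0 u) (R := 5) (by norm_num)
    (S := square 5) (b := 1.6) (C := 400) (C' := 400) (by norm_num) (by norm_num)
    (fun p hp => (far p hp).trans (mul_le_of_le_one_right (by norm_num)
      (Real.exp_le_one_iff.2 (neg_nonpos.2 (by positivity))))) far
  refine h.trans ?_
  have := exp_neg_forty_le
  rw [sdiff_self]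
  simp only [Finset.bot_eq_empty, Finset.card_empty, Nat.cast_zero, mul_zero, zero_add]
  linarith

/-- The number of vectors of `square 5` with `m² + n² = N`. -/
def multSquare (N : ℕ) : ℕ :=
  [1, 4, 4, 0, 4, 8, 0, 0, 4, 4, 8, 0, 0, 8, 0, 0, 4, 8, 4, 0, 8, 0, 0, 0, 0, 8, 0, 0, 0, 0, 0, 0,
    4].getD N 0

/-- The number of vectors of `square 5` with `m² + m n + n² = N`. -/
def multHex (N : ℕ) : ℕ :=
  [1, 6, 0, 6, 6, 0, 0, 12, 0, 6, 0, 0, 6, 12, 0, 0, 6, 0, 0, 4, 0, 4, 0, 0, 0, 0, 0, 2, 4, 0, 0, 0, 0,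
    0, 0, 0, 0, 4, 0, 0, 0, 0, 0, 0, 0, 0, 0, 0, 2].getD N 0

/-- At either end x is an integer multiple of one length, so grouping by shells leaves a sum with a
single exponential. The largest norm in the square is 48 = 4² + 4·4 + 4², on the hexagonal side. -/
theorem sum_square_comp (N : ℤ × ℤ → ℕ) (mult : ℕ → ℕ) (hN : ∀ p ∈ square 5, N p < 49)
    (hm : ∀ k < 49, ((square 5).filter fun p => N p = k).card = mult k) (F : ℕ → ℝ) :
    ∑ p ∈ square 5, F (N p) = ∑ k ∈ Finset.range 49, (mult k : ℝ) * F k := by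
  rw [← Finset.sum_fiberwise_of_maps_to (t := Finset.range 49) (g := N)
    (fun p hp => Finset.mem_range.2 (hN p hp))]
  refine Finset.sum_congr rfl fun k hk => ?_
  rw [← hm k (Finset.mem_range.1 hk), ← nsmul_eq_mul, ← Finset.sum_const]
  exact Finset.sum_congr rfl fun p hp => by rw [(Finset.mem_filter.1 hp).2]

theorem sum_square_zero (f : ℝ → ℝ) (X : ℝ) :
    ∑ p ∈ square 5, f (xx X 0 p) * Real.exp (-xx X 0 p)
      = ∑ k ∈ Finset.range 49, (multSquare k : ℝ) * (f (k * X) * Real.exp (-X) ^ k) := by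
  rw [← sum_square_comp (fun p => (p.1 ^ 2 + p.2 ^ 2).natAbs) multSquare (by decide +kernel)
    (by decide +kernel)]
  refine Finset.sum_congr rfl fun p _ => ?_
  have h : xx X 0 p = ((p.1 ^ 2 + p.2 ^ 2).natAbs : ℕ) * X := by
    rw [Nat.cast_natAbs, abs_of_nonneg (by positivity), xx]
    push_cast
    simp
    ring
  rw [← Real.exp_nat_mul, h]
  ring_nf

theorem sum_square_uHex (f : ℝ → ℝ) (X : ℝ) :
    ∑ p ∈ square 5, f (xx X uHex p) * Real.exp (-xx X uHex p)
      = ∑ k ∈ Finset.range 49, (multHex k : ℝ) *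
        (f (k * (2 * √3 / 3 * X)) * Real.exp (-(2 * √3 / 3 * X)) ^ k) := by
  rw [← sum_square_comp (fun p => (p.1 ^ 2 + p.1 * p.2 + p.2 ^ 2).natAbs) multHex (by decide +kernel)
    (by decide +kernel)]
  refine Finset.sum_congr rfl fun p _ => ?_
  have h : xx X uHex p = ((p.1 ^ 2 + p.1 * p.2 + p.2 ^ 2).natAbs : ℕ) * (2 * √3 / 3 * X) := by
    rw [Nat.cast_natAbs, abs_of_nonneg (by nlinarith [sq_nonneg (p.1 + p.2), sq_nonneg p.1, sq_nonneg p.2]),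
      xx_uHex]
    push_cast
    ring
  rw [← Real.exp_nat_mul, h]
  ring_nf

namespace Aff

/-- Horner evaluation of `∑ i ≤ n, coef (k + i) E ^ i`. -/
def powSum (coef : ℕ → Aff) (E : Aff) : ℕ → ℕ → Aff
  | k, 0 => coef k
  | k, n + 1 => (coef k).add (E.mul (powSum coef E (k + 1) n))

theorem Has.powSum {coef : ℕ → Aff} {E : Aff} {c : ℕ → ℝ} {e s t : ℝ}
    (hc : ∀ k, (coef k).Has s t (c k)) (hE : E.Has s t e) (k n : ℕ) :
    (Aff.powSum coef E k n).Has s t (∑ i ∈ Finset.range (n + 1), c (k + i) * e ^ i) := by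
  induction n generalizing k with
  | zero => simpa [Aff.powSum] using hc k
  | succ n ih =>
    refine ((hc k).add (hE.mul (ih (k + 1)))).congr ?_
    rw [Finset.sum_range_succ' _ (n + 1), Finset.mul_sum, add_comm]
    simp only [pow_zero, mul_one, add_zero]
    congr 1
    refine Finset.sum_congr rfl fun i _ => ?_
    rw [show k + (i + 1) = k + 1 + i by ring]
    ring

/-- Enclosure of `∑ k < 49, mult k f(k x) e^{-k x}` with `f(x) = a + b x + c x²`. -/
def shellSum (mult : ℕ → ℕ) (a b c : ℤ) (x : Aff) : Aff :=
  let x2 := x.mul x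
  powSum (fun k => ((x.smul (mult k * b * k)).add (x2.smul (mult k * c * k ^ 2))).addC (mult k * a))
    x.neg.exp 0 48

theorem Has.shellSum (mult : ℕ → ℕ) (a b c : ℤ) {F : Aff} {s t x : ℝ} (hF : F.Has s t x) :
    (Aff.shellSum mult a b c F).Has s t (∑ k ∈ Finset.range 49,
      (mult k : ℝ) * ((a + b * (k * x) + c * (k * x) ^ 2) * Real.exp (-x) ^ k)) := by
  have hcoef : ∀ k : ℕ, (((F.smul (mult k * b * k)).add ((F.mul F).smul (mult k * c * k ^ 2))).addC
      (mult k * a)).Has s t ((mult k : ℝ) * (a + b * (k * x) + c * (k * x) ^ 2)) := fun k => by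
    refine (((hF.smul (mult k * b * k)).add ((hF.mul hF).smul (mult k * c * k ^ 2))).addC
      (mult k * a)).congr ?_
    push_cast
    ring
  have h : (Aff.shellSum mult a b c F).Has s t _ := Has.powSum hcoef hF.neg.exp 0 48
  refine h.congr (Finset.sum_congr rfl fun k _ => ?_)
  rw [zero_add]
  ring

/-- An enclosure of `2 √3 / 3`. -/
def hexConst : Aff := ⟨21300465313256686802, 0, 0, 1⟩

theorem hexConst_has {s t : ℝ} (hs : |s| ≤ 1) (ht : |t| ≤ 1) : hexConst.Has s t (2 * √3 / 3) := by
  refine ⟨hs, ht, ?_⟩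
  have h1 : (21300465313256686802 / 2 ^ 64 * 3 / 2 : ℝ) ≤ √3 := Real.le_sqrt_of_sq_le (by norm_num)
  have h2 : √3 ≤ (21300465313256686803 / 2 ^ 64 * 3 / 2 : ℝ) :=
    Real.sqrt_le_iff.2 ⟨by norm_num, by norm_num⟩
  simp only [hexConst]
  push_cast
  rw [abs_le]
  constructor <;> linarith

/-- Enclosure of the difference of the shell sums of the square and of the hexagonal lattice. -/
def shellDiff (a b c : ℤ) (x : Aff) : Aff :=
  (shellSum multSquare a b c x).sub (shellSum multHex a b c (hexConst.mul x))

end Aff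

/-- The difference of lattice sums `∑ f(x) e^{-x}` of the square and of the hexagonal lattice. -/
noncomputable def latticeDiff (f : ℝ → ℝ) (X : ℝ) : ℝ :=
  ∑' p : ℤ × ℤ, f (xx X 0 p) * Real.exp (-xx X 0 p)
    - ∑' p : ℤ × ℤ, f (xx X uHex p) * Real.exp (-xx X uHex p)

/-- The extra 1000000 units of 2^{-64} cover the two truncation errors of 2·10⁻¹⁴. -/
theorem Aff.Has.abs_shellDiff_sub_le {F : Aff} {s t X : ℝ} (hF : F.Has s t X) (hX : 3.14 ≤ X) {a b c : ℤ}
    (hf : PolyBdd fun x _ => (a : ℝ) + b * x + c * x ^ 2)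
    (hle : ∀ x : ℝ, 25 ≤ x → |(a : ℝ) + b * x + c * x ^ 2| ≤ x ^ 2) :
    |latticeDiff (fun x => a + b * x + c * x ^ 2) X * 2 ^ 64
        - ((shellDiff a b c F).c + (shellDiff a b c F).a * s + (shellDiff a b c F).b * t : ℝ)|
      ≤ (((shellDiff a b c F).e : ℕ) : ℝ) + 1000000 := by
  have h1 := abs_tsum_sub_square_le hf hle (X := X) (u := 0) ⟨le_rfl, uHex_pos.le⟩ hX
  have h2 := abs_tsum_sub_square_le hf hle (X := X) (u := uHex) ⟨uHex_pos.le, le_rfl⟩ hX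
  rw [sum_square_zero (fun x => a + b * x + c * x ^ 2)] at h1
  rw [sum_square_uHex (fun x => a + b * x + c * x ^ 2)] at h2
  have h3 := ((hF.shellSum multSquare a b c).sub
    (((hexConst_has hF.hs hF.ht).mul hF).shellSum multHex a b c)).le
  change |_ - (((shellDiff a b c F).c : ℝ) + (shellDiff a b c F).a * s + (shellDiff a b c F).b * t)| ≤
    ((shellDiff a b c F).e : ℝ) at h3
  unfold latticeDiff
  beta_reduce at *
  rw [abs_le] at *
  constructor <;> linarith [h1.1, h1.2, h2.1, h2.2, h3.1, h3.2]

/-- Checks that the difference is positive for `|X 2^20 - h| ≤ d`. -/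
def diffPos (a b c h : ℤ) (d : ℕ) : Bool :=
  let F := Aff.shellDiff a b c ⟨h * 17592186044416, d * 17592186044416, 0, 0⟩
  decide (((F.a.natAbs + F.b.natAbs + F.e + 1000000 : ℕ) : ℤ) < F.c)

theorem latticeDiff_pos {a b c h : ℤ} {d : ℕ} (hc : diffPos a b c h d = true)
    (hf : PolyBdd fun x _ => (a : ℝ) + b * x + c * x ^ 2)
    (hle : ∀ x : ℝ, 25 ≤ x → |(a : ℝ) + b * x + c * x ^ 2| ≤ x ^ 2) {X : ℝ} (hX : 3.14 ≤ X)
    (hd : |X * 2 ^ 20 - h| ≤ ((d : ℕ) : ℝ)) : 0 < latticeDiff (fun x => a + b * x + c * x ^ 2) X := by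
  obtain ⟨s, hs, es⟩ := exists_param_of_abs_le hd
  have ht : |(0 : ℝ)| ≤ 1 := by simp
  have a1 : (Aff.mk (h * 17592186044416) (d * 17592186044416) 0 0).Has s 0 X := by
    refine ⟨hs, ht, ?_⟩
    push_cast
    rw [show X * 2 ^ 64 - (h * 17592186044416 + d * 17592186044416 * s + 0 * 0)
      = (X * 2 ^ 20 - (h + d * s)) * 2 ^ 44 by ring, es]
    simp
  have a2 := (abs_le.1 (a1.abs_shellDiff_sub_le hX hf hle)).1
  simp only [diffPos, decide_eq_true_eq] at hc
  set F := Aff.shellDiff a b c ⟨h * 17592186044416, d * 17592186044416, 0, 0⟩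
  have hl := (abs_le.1 (Aff.abs_lin_le F.a F.b hs ht)).1
  have hc' : (((F.a.natAbs + F.b.natAbs + F.e + 1000000 : ℕ) : ℤ) : ℝ) < F.c := by exact_mod_cast hc
  rw [Int.cast_natCast] at hc'
  simp only [Nat.cast_add] at hc' hl
  push_cast at a2 hc' hl
  have : 0 < latticeDiff (fun x => a + b * x + c * x ^ 2) X * 2 ^ 64 := by
    linarith
  exact (mul_pos_iff_of_pos_right (by positivity)).1 this

theorem polyBdd_quadratic (a b c : ℝ) : PolyBdd fun x _ => a + b * x + c * x ^ 2 :=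
  ((polyBdd_const a).add ((polyBdd_const b).mul polyBdd_fst)).add
    ((polyBdd_const c).mul (polyBdd_fst.pow 2))

/-- x(2 - x)e^{-x} is x times the derivative of (x - 1)e^{-x}, so this is X times the X-derivative
of the difference of the two ends. -/
theorem latticeDiff_deriv_pos {X : ℝ} (hX : 3.1415 ≤ X) (hX' : X ≤ 3.78) :
    0 < latticeDiff (fun x => x * (2 - x)) X := by
  have e : (fun x : ℝ => x * (2 - x)) = fun x => ((0 : ℤ) : ℝ) + (2 : ℤ) * x + (-1 : ℤ) * x ^ 2 := by
    funext x; push_cast; ring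
  have hle : ∀ x : ℝ, 25 ≤ x → |((0 : ℤ) : ℝ) + (2 : ℤ) * x + (-1 : ℤ) * x ^ 2| ≤ x ^ 2 := fun x hx => by
    push_cast; rw [abs_le]; constructor <;> nlinarith
  -- In units of 2^{-20}, 21 adjacent intervals of width 1/32 start at 3294101, just below 3.1415,
  -- and reach beyond 3.78.
  have key : ∀ i : ℕ, i < 21 → diffPos 0 2 (-1) (3310485 + 32768 * i) 16384 = true := by decide +kernel
  set i := ⌊(X * 2 ^ 20 - 3294101) / 32768⌋₊ with hi
  have h0 : 0 ≤ (X * 2 ^ 20 - 3294101) / 32768 := by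
    apply div_nonneg <;> linarith
  have h1 := Nat.floor_le h0
  have h2 := Nat.lt_floor_add_one ((X * 2 ^ 20 - 3294101) / 32768)
  rw [← hi] at h1 h2
  rw [le_div_iff₀ (by norm_num)] at h1
  rw [div_lt_iff₀ (by norm_num)] at h2
  have hi21 : i < 21 := by
    have : (i : ℝ) < 21 := by nlinarith
    exact_mod_cast this
  rw [e]
  refine latticeDiff_pos (key i hi21) (polyBdd_quadratic _ _ _) hle (by linarith) ?_
  push_cast
  rw [abs_le]
  constructor <;> linarith

theorem latticeDiff_eq (X : ℝ) : latticeDiff (fun x => x - 1) X = G 0 X 0 - G 0 X uHex := by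
  simp only [latticeDiff, G, pol]

theorem hasDerivAt_latticeDiff {X : ℝ} (hX : 0 < X) :
    HasDerivAt (latticeDiff fun x => x - 1) (1 / X * latticeDiff (fun x => x * (2 - x)) X) X := by
  have h := fun u => hasDerivAt_tsum_left (f := fun x => x - 1) (f' := fun x => 2 - x)
    (polyBdd_fst.sub (polyBdd_const 1)) ((polyBdd_const 2).sub polyBdd_fst)
    (fun x => (((hasDerivAt_id x).sub_const 1).mul (hasDerivAt_neg x).exp).congr_deriv
      (by simp; ring)) hX u
  exact ((h 0).sub (h uHex)).congr_deriv (by rw [← mul_sub]; rfl)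

theorem strictMonoOn_latticeDiff :
    StrictMonoOn (latticeDiff fun x => x - 1) (Set.Icc 3.1415 3.78) := by
  refine strictMonoOn_of_deriv_pos (convex_Icc _ _) (fun X hX => ?_) (fun X hX => ?_)
  · exact (hasDerivAt_latticeDiff (by linarith [hX.1])).continuousAt.continuousWithinAt
  · rw [interior_Icc] at hX
    have hX0 : 0 < X := by linarith [hX.1]
    rw [(hasDerivAt_latticeDiff hX0).deriv]
    exact mul_pos (by positivity) (latticeDiff_deriv_pos hX.1.le hX.2.le)

theorem Aff.has_pi_div {c : ℤ} {a : ℝ} (ha : 0 < a)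
    (h1 : (c - 2) * a ≤ 3.14159265358979323846 * 2 ^ 64)
    (h2 : 3.14159265358979323847 * 2 ^ 64 ≤ (c + 2) * a) : (Aff.mk c 0 0 2).Has 0 0 (Real.pi / a) := by
  refine ⟨by simp, by simp, ?_⟩
  have p1 := Real.pi_gt_d20
  have p2 := Real.pi_lt_d20
  have e : Real.pi / a * 2 ^ 64 = Real.pi * 2 ^ 64 / a := by ring
  simp only [Int.cast_zero, zero_mul, add_zero]
  push_cast
  rw [abs_le, e]
  constructor
  · have : (c - 2 : ℝ) ≤ Real.pi * 2 ^ 64 / a := by rw [le_div_iff₀ ha]; linarith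
    linarith
  · have : Real.pi * 2 ^ 64 / a ≤ c + 2 := by rw [div_le_iff₀ ha]; linarith
    linarith

theorem latticeDiff_pi_div {c : ℤ} {a : ℝ} (hF : (Aff.mk c 0 0 2).Has 0 0 (Real.pi / a))
    (ha : 3.14 ≤ Real.pi / a) :
    |latticeDiff (fun x => x - 1) (Real.pi / a) * 2 ^ 64 - (Aff.shellDiff (-1) 1 0 ⟨c, 0, 0, 2⟩).c| ≤
      (((Aff.shellDiff (-1) 1 0 ⟨c, 0, 0, 2⟩).e : ℕ) : ℝ) + 1000000 := by
  have e : (fun x : ℝ => x - 1) = fun x => ((-1 : ℤ) : ℝ) + (1 : ℤ) * x + (0 : ℤ) * x ^ 2 := by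
    funext x; push_cast; ring
  rw [e]
  have h := hF.abs_shellDiff_sub_le ha (a := -1) (b := 1) (c := 0) (polyBdd_quadratic _ _ _)
    (fun x hx => by push_cast; rw [abs_le]; constructor <;> nlinarith)
  simpa only [mul_zero, add_zero] using h

/-- The parameter is 0.9203340927 + 5·10⁻¹¹; its companion below takes the other end of the window.
The integer c approximates 2^64 π / α within 2 units. -/
theorem latticeDiff_pi_div_neg : latticeDiff (fun x => x - 1) (Real.pi / 0.92033409275) < 0 := by
  have h := latticeDiff_pi_div (Aff.has_pi_div (c := 62968606858247871573) (a := 0.92033409275)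
    (by norm_num) (by norm_num) (by norm_num))
    (by rw [le_div_iff₀ (by norm_num)]; linarith [Real.pi_gt_d20])
  have hk : (Aff.shellDiff (-1) 1 0 ⟨62968606858247871573, 0, 0, 2⟩).c
      + ((Aff.shellDiff (-1) 1 0 ⟨62968606858247871573, 0, 0, 2⟩).e + 1000000 : ℕ) < 0 := by
    decide +kernel
  set F := Aff.shellDiff (-1) 1 0 ⟨62968606858247871573, 0, 0, 2⟩
  have hk' : ((F.c + (F.e + 1000000 : ℕ) : ℤ) : ℝ) < 0 := by exact_mod_cast hk
  push_cast at hk'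
  have := (abs_le.1 h).2
  have : latticeDiff (fun x => x - 1) (Real.pi / 0.92033409275) * 2 ^ 64 < 0 := by linarith
  exact neg_of_mul_neg_left this (by positivity)

theorem latticeDiff_pi_div_pos : 0 < latticeDiff (fun x => x - 1) (Real.pi / 0.92033409265) := by
  have h := latticeDiff_pi_div (Aff.has_pi_div (c := 62968606865089800755) (a := 0.92033409265)
    (by norm_num) (by norm_num) (by norm_num))
    (by rw [le_div_iff₀ (by norm_num)]; linarith [Real.pi_gt_d20])
  have hk : ((Aff.shellDiff (-1) 1 0 ⟨62968606865089800755, 0, 0, 2⟩).e + 1000000 : ℕ)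
      < (Aff.shellDiff (-1) 1 0 ⟨62968606865089800755, 0, 0, 2⟩).c := by
    decide +kernel
  set F := Aff.shellDiff (-1) 1 0 ⟨62968606865089800755, 0, 0, 2⟩
  have hk' : (((F.e + 1000000 : ℕ) : ℤ) : ℝ) < F.c := by exact_mod_cast hk
  push_cast at hk'
  have := (abs_le.1 h).1
  have : 0 < latticeDiff (fun x => x - 1) (Real.pi / 0.92033409265) * 2 ^ 64 := by linarith
  exact (mul_pos_iff_of_pos_right (by positivity)).1 this

/-! ### Minimizers on the arc -/

theorem M_lt_iff {α : ℝ} (hα : 0 < α) {z w : UpperHalfPlane} {u v : ℝ}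
    (hz : ∀ p, quadForm z p = xx 1 u p) (hw : ∀ p, quadForm w p = xx 1 v p) :
    M α z < M α w ↔ G 0 (Real.pi / α) v < G 0 (Real.pi / α) u := by
  have : 0 < 1 / (Real.pi * α ^ 2) := by have := Real.pi_pos; positivity
  rw [M_eq_G hα hz, M_eq_G hα hw, neg_lt_neg_iff, mul_lt_mul_iff_right₀ this]

theorem M_I_lt_hexPoint_iff {α : ℝ} (hα : 0 < α) :
    M α UpperHalfPlane.I < M α hexPoint ↔ 0 < latticeDiff (fun x => x - 1) (Real.pi / α) := by
  rw [M_lt_iff hα quadForm_I quadForm_hexPoint, latticeDiff_eq, sub_pos]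

theorem M_hexPoint_lt_I_iff {α : ℝ} (hα : 0 < α) :
    M α hexPoint < M α UpperHalfPlane.I ↔ latticeDiff (fun x => x - 1) (Real.pi / α) < 0 := by
  rw [M_lt_iff hα quadForm_hexPoint quadForm_I, latticeDiff_eq, sub_neg]

theorem M_I_eq_hexPoint_iff {α : ℝ} (hα : 0 < α) :
    M α UpperHalfPlane.I = M α hexPoint ↔ latticeDiff (fun x => x - 1) (Real.pi / α) = 0 := by
  rw [← not_iff_not, ← ne_eq, ← ne_eq, ne_iff_lt_or_gt, ne_iff_lt_or_gt,
    M_I_lt_hexPoint_iff hα, M_hexPoint_lt_I_iff hα, or_comm]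

/-- Inside the arc, `M α` exceeds its smaller value at the two ends. -/
theorem min_lt_M {α : ℝ} (h0 : 0 < α) (h1 : α ≤ 1) {z : UpperHalfPlane} (hz : z ∈ arcB)
    (hI : z ≠ UpperHalfPlane.I) (hH : z ≠ hexPoint) :
    min (M α UpperHalfPlane.I) (M α hexPoint) < M α z := by
  obtain ⟨u, ⟨hu0, hu1⟩, hq, hu, hu'⟩ := exists_param hz
  have c0 : 0 < u := hu0.lt_of_ne fun h => hI (hu h.symm)
  have c1 : u < uHex := hu1.lt_of_ne fun h => hH (hu' h)
  -- The assumption α ≤ 1 enters here, as X ≥ π.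
  have hX : 3.1415 ≤ Real.pi / α := by
    rw [le_div_iff₀ h0]
    nlinarith [Real.pi_gt_d4]
  rw [min_lt_iff, M_lt_iff h0 quadForm_I hq, M_lt_iff h0 quadForm_hexPoint hq, ← lt_max_iff]
  rcases le_total (Real.pi / α) 3.77 with h | h
  · exact G_lt_max hX h c0 c1
  · refine lt_max_of_lt_left ?_
    rcases le_total (Real.pi / α) 6 with h' | h'
    · exact G_lt_left_of_le h h' c0 c1.le
    · exact G_lt_left_of_ge h' c0 c1.le

/-- The arc estimates for X ≥ 3.77 include the hexagonal end, so the ends need no separate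
comparison there. -/
theorem M_I_lt_hexPoint_of_le {α : ℝ} (h0 : 0 < α) (h : 3.77 ≤ Real.pi / α) :
    M α UpperHalfPlane.I < M α hexPoint := by
  rw [M_lt_iff h0 quadForm_I quadForm_hexPoint]
  rcases le_total (Real.pi / α) 6 with h' | h'
  · exact G_lt_left_of_le h h' uHex_pos le_rfl
  · exact G_lt_left_of_ge h' uHex_pos le_rfl

theorem arcMinimizers_eq_singleton {α : ℝ} {a : UpperHalfPlane} (ha : a ∈ arcB)
    (h : ∀ z ∈ arcB, z ≠ a → M α a < M α z) : arcMinimizers α = {a} := by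
  ext z
  rw [Set.mem_singleton_iff]
  constructor
  · rintro ⟨hz, hm⟩
    by_contra hne
    exact absurd (isMinOn_iff.1 hm a ha) (not_le.2 (h z hz hne))
  · intro hz
    subst hz
    refine ⟨ha, isMinOn_iff.2 fun w hw => ?_⟩
    rcases eq_or_ne w z with rfl | hne
    · exact le_rfl
    · exact (h w hw hne).le

theorem arcMinimizers_eq_I {α : ℝ} (h0 : 0 < α) (h1 : α ≤ 1)
    (h : M α UpperHalfPlane.I < M α hexPoint) : arcMinimizers α = {UpperHalfPlane.I} := by
  refine arcMinimizers_eq_singleton I_mem_arcB fun z hz hne => ?_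
  rcases eq_or_ne z hexPoint with rfl | hH
  · exact h
  · simpa only [min_eq_left h.le] using min_lt_M h0 h1 hz hne hH

theorem arcMinimizers_eq_hexPoint {α : ℝ} (h0 : 0 < α) (h1 : α ≤ 1)
    (h : M α hexPoint < M α UpperHalfPlane.I) : arcMinimizers α = {hexPoint} := by
  refine arcMinimizers_eq_singleton hexPoint_mem_arcB fun z hz hne => ?_
  rcases eq_or_ne z UpperHalfPlane.I with rfl | hI
  · exact h
  · simpa only [min_eq_right h.le] using min_lt_M h0 h1 hz hI hne

theorem arcMinimizers_eq_pair {α : ℝ} (h0 : 0 < α) (h1 : α ≤ 1)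
    (h : M α UpperHalfPlane.I = M α hexPoint) :
    arcMinimizers α = {UpperHalfPlane.I, hexPoint} := by
  have key : ∀ z ∈ arcB, z ≠ UpperHalfPlane.I → z ≠ hexPoint → M α UpperHalfPlane.I < M α z :=
    fun z hz hI hH => by simpa only [← h, min_self] using min_lt_M h0 h1 hz hI hH
  have hle : ∀ z ∈ arcB, M α UpperHalfPlane.I ≤ M α z := fun z hz => by
    rcases eq_or_ne z UpperHalfPlane.I with rfl | hI
    · exact le_rfl
    rcases eq_or_ne z hexPoint with rfl | hH
    · exact h.le
    · exact (key z hz hI hH).le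
  ext z
  rw [Set.mem_insert_iff, Set.mem_singleton_iff]
  constructor
  · rintro ⟨hz, hm⟩
    by_contra! hne
    exact absurd (isMinOn_iff.1 hm _ I_mem_arcB) (not_le.2 (key z hz hne.1 hne.2))
  · rintro (rfl | rfl)
    · exact ⟨I_mem_arcB, isMinOn_iff.2 hle⟩
    · exact ⟨hexPoint_mem_arcB, isMinOn_iff.2 fun w hw => h ▸ hle w hw⟩

theorem exists_latticeDiff_eq_zero : ∃ α ∈ Set.Ioo (0.92033409265 : ℝ) 0.92033409275,
    latticeDiff (fun x => x - 1) (Real.pi / α) = 0 := by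
  have hc : ContinuousOn (fun α => latticeDiff (fun x => x - 1) (Real.pi / α))
      (Set.Icc 0.92033409265 0.92033409275) := fun α hα => by
    have h0 : 0 < α := by linarith [hα.1]
    have h1 : ContinuousAt (latticeDiff fun x => x - 1) (Real.pi / α) :=
      (hasDerivAt_latticeDiff (div_pos Real.pi_pos h0)).continuousAt
    exact (ContinuousAt.comp (f := fun α => Real.pi / α) h1
      (continuousAt_const.div continuousAt_id h0.ne')).continuousWithinAt
  obtain ⟨α, hα, h⟩ := intermediate_value_Ioo' (by norm_num) hc
    ⟨latticeDiff_pi_div_neg, latticeDiff_pi_div_pos⟩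
  exact ⟨α, hα, h⟩

theorem pi_div_mem_Icc {β : ℝ} (h : β ∈ Set.Icc (5 / 6 : ℝ) 1) :
    Real.pi / β ∈ Set.Icc (3.1415 : ℝ) 3.78 := by
  have h0 : 0 < β := by linarith [h.1]
  constructor
  · rw [le_div_iff₀ h0]
    nlinarith [Real.pi_gt_d4, h.2]
  · rw [div_le_iff₀ h0]
    nlinarith [Real.pi_lt_d4, h.1]

end LatticePhase

/-! ### Assembly of the theorem -/

theorem theorem6p1 :
    ∃ α₂ : ℝ,
      ((α₂ ∈ Set.Icc (5 / 6 : ℝ) 1 ∧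
          LatticePhase.M α₂ UpperHalfPlane.I = LatticePhase.M α₂ LatticePhase.hexPoint) ∧
        ∀ β ∈ Set.Icc (5 / 6 : ℝ) 1,
          LatticePhase.M β UpperHalfPlane.I = LatticePhase.M β LatticePhase.hexPoint → β = α₂) ∧
      |α₂ - 0.9203340927| < 5 * (10 : ℝ)⁻¹ ^ 11 ∧
      ∀ α : ℝ, 0 < α → α ≤ 1 →
        (α < α₂ → LatticePhase.arcMinimizers α = {UpperHalfPlane.I}) ∧
        (α = α₂ → LatticePhase.arcMinimizers α = {UpperHalfPlane.I, LatticePhase.hexPoint}) ∧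
        (α₂ < α → LatticePhase.arcMinimizers α = {LatticePhase.hexPoint}) := by
  obtain ⟨a, ⟨ha1, ha2⟩, ha⟩ := LatticePhase.exists_latticeDiff_eq_zero
  have ha0 : 0 < a := by linarith
  have hI : a ∈ Set.Icc (5 / 6 : ℝ) 1 := ⟨by linarith, by linarith⟩
  have hm := LatticePhase.pi_div_mem_Icc hI
  have hπ := Real.pi_pos
  refine ⟨a, ⟨⟨hI, (LatticePhase.M_I_eq_hexPoint_iff ha0).2 ha⟩, fun β hβ h => ?_⟩, ?_, fun α h0 h1 =>
    ⟨fun h => LatticePhase.arcMinimizers_eq_I h0 h1 ?_, ?_,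
      fun h => LatticePhase.arcMinimizers_eq_hexPoint h0 h1 ?_⟩⟩
  · have hβ0 : 0 < β := by linarith [hβ.1]
    have hX := LatticePhase.strictMonoOn_latticeDiff.injOn (LatticePhase.pi_div_mem_Icc hβ) hm
      (((LatticePhase.M_I_eq_hexPoint_iff hβ0).1 h).trans ha.symm)
    rw [div_eq_div_iff hβ0.ne' ha0.ne'] at hX
    exact (mul_left_cancel₀ hπ.ne' hX).symm
  · rw [abs_lt]
    constructor <;> norm_num <;> linarith
  -- Small α leave the range where `latticeDiff` is known to be monotone; from 3.77 on the arc
  -- estimates decide, and below it monotonicity does.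
  · rcases le_or_gt 3.77 (Real.pi / α) with h' | h'
    · exact LatticePhase.M_I_lt_hexPoint_of_le h0 h'
    · rw [LatticePhase.M_I_lt_hexPoint_iff h0, ← ha]
      have hlt := div_lt_div_of_pos_left hπ h0 h
      exact LatticePhase.strictMonoOn_latticeDiff hm ⟨hm.1.trans hlt.le, by linarith⟩ hlt
  · rintro rfl
    exact LatticePhase.arcMinimizers_eq_pair h0 h1 ((LatticePhase.M_I_eq_hexPoint_iff h0).2 ha)
  · rw [LatticePhase.M_hexPoint_lt_I_iff h0, ← ha]
    exact LatticePhase.strictMonoOn_latticeDiff (LatticePhase.pi_div_mem_Icc ⟨hI.1.trans h.le, h1⟩) hm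
      (div_lt_div_of_pos_left hπ ha0 h)
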